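/- **Setting.** System $A$ has a finite-dimensional Hilbert space with reference basis $\{|i\rangle\}$; $|\psi\rangle_A,|\phi\rangle_A$ are pure states with diagonal coefficients $p_i=|\langle i|\psi\rangle|^2$, $q_j=|\langle j|\phi\rangle|^2$; $\Delta$ denotes dephasing in the (product) reference basis. An incoherent operation (IO) is a map $\rho\mapsto\sum_lK_l\rho K_l^\dagger$, $\sum_lK_l^\dagger K_l=\mathbb 1$, each $K_l$ mapping incoherent (diagonal) states to incoherent states after normalisation; it is strictly incoherent (SIO) if each $K_l^\dagger$ does so too. *Battery.* For integers $u\ge2$, $n\ge0$ the battery $B$ has $n$ cells with basis $|1\rangle,\dots,|2u-1\rangle$. Put $|\Upsilon^+\rangle=u^{-1/2}\sum_{i\le u}|i\rangle$, $|\Upsilon^-\rangle=(u-1)^{-1/2}\sum_{u<i\le2u-1}|i\rangle$, $|c_x\rangle=|\Upsilon^+\rangle^{\otimes x}\otimes|\Upsilon^-\rangle^{\otimes(n-x)}$ ($0\le x\le n$), $\Pi^x=u^x(u-1)^{n-x}\Delta(|c_x\rangle\langle c_x|)$, $\mathbb B=\sum_x\Pi^x$, $\delta w=\ln\frac{u}{u-1}$,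 $\Gamma^k|c_x\rangle=|c_{x+k}\rangle$ (indices mod $n+1$), $|\lambda\rangle=\sum_x\sqrt{\alpha_x}|c_x\rangle$ with $\alpha$ a probability vector. For $w_{\max}>0$ let $f=\lfloor w_{\max}/\delta w\rfloor$. The battery is *$\varepsilon$-ideal* (with respect to IO, resp. SIO) if $\alpha_x\neq0$ only for $f\le x\le n-f$, and, whenever $|\psi'\rangle\otimes|\lambda\rangle$ and $|\Phi'\rangle=\sum_{|k|\le f}|\phi'_k\rangle\otimes\Gamma^k|\lambda\rangle$ are pure states (with an arbitrary finite-dimensional system in place of $A$) that can be converted into each other, in both directions, by IO (resp. SIO), and $|\phi'\rangle=\sum_k|\phi'_k\rangle$ is normalised with $\Delta(\mathrm{Tr}_B\Phi')=\Delta(\phi')$, then $\|\Phi'-\phi'\otimes\lambda\|_1\le\varepsilon$. *Battery-assisted protocols.* An *$\varepsilon$-realisation* of $|\psi\rangle\otimes|\lambda\rangle\to|\Phi\rangle\approx|\phi\rangle\otimes|\lambda\rangle$ by IO (resp. SIO) with range $w_{\max}$ consists of an $\varepsilon$-ideal battery, pure states $|\Psi\rangle,|\Phi\rangle\in\mathrm{span}\{|i\rangle\otimes|c_x\rangle\}$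 with $\|\Psi-\psi\otimes\lambda\|_1\le\varepsilon$ and $\|\Phi-\phi\otimes\lambda\|_1\le\varepsilon$ such that some IO (resp. SIO) maps $\Psi$ to $\Phi$, and a unital map $\mathcal E=\sum_mr_m\,\Xi_m\cdot\Xi_m^\dagger$ (a convex mixture of permutations of the reference basis) with $\Delta(\Psi)=\mathcal E(\Delta(\Phi))$, $\mathcal E(\mathbb 1\otimes\mathbb B)=\mathbb 1\otimes\mathbb B$, which changes the battery level by at most $f$ units: $\mathrm{Tr}[(|i\rangle\langle i|\otimes\Pi^x)\,\mathcal E(|j\rangle\langle j|\otimes\Pi^{x'})]=0$ if $|x-x'|>f$. Its conditional distribution is $$P(i,w|j)=\sum_{x,x':\,(x'-x)\delta w=w}\mathrm{Tr}\big[(|i\rangle\langle i|\otimes\Pi^{x})\,\mathcal E(|j\rangle\langle j|\otimes\Pi^{x'}\Delta(\lambda)\Pi^{x'})\big],$$ and the extracted coherence distribution is $P(w)=\sum_{i,j}P(i,w|j)q_j$. Let $(u_N)$ be a sequence of integers $\ge2$. A finitely supported probability distribution $P(w)$ on $\mathbb R$ is *extracted by IO (resp. SIO) in the ideal-battery limit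 along $(u_N)$* if there are $w_{\max}>0$ and, for each $N$, an $\varepsilon_N$-realisation by IO (resp. SIO) with range $w_{\max}$, on a battery with parameter $u_N$ and some number $n_N$ of cells, such that, with $f_N=\lfloor w_{\max}/\delta w_N\rfloor$, $\varepsilon_N\to0$ and $\sqrt{8\varepsilon_N}\,f_N(f_N+1)\to0$, and the extracted coherence distributions converge weakly to $P(w)$ (i.e. against every continuous function). **Theorem (Necessary and sufficient conditions for B(S)IO transformations).** Both for IO and for SIO: 1. (Finite batteries.) For every $u\ge2$, $n$, $w_{\max}>0$, $\varepsilon$, the conditional distribution of every $\varepsilon$-realisation with range $w_{\max}$ satisfies $P(i,w|j)\ge0$, $\sum_{i,w}P(i,w|j)=1$ for all $j$, $\big|\sum_{j,w}P(i,w|j)e^w-1\big|\le\sqrt{8\varepsilon}\,f(f+1)$ for all $i$, and $\sum_i\big|\sum_{j,w}P(i,w|j)q_j-p_i\big|\le2\varepsilon$. 2. (Ideal-battery limit.) Let $(u_N)$ be a sequence of integers $\ge2$ and $P(w)$ a finitely supported probability distribution on $\mathbb R$ each of whose atoms $w$ is resolved in the limit, i.e. its distance to $\delta w_N\mathbb Z$,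 $\delta w_N=\ln\frac{u_N}{u_N-1}$, tends to $0$ (as holds if $u_N\to\infty$, or if $u_N=u$ is constant and $w\in\delta w\,\mathbb Z$). Then $P(w)$ is extracted in the ideal-battery limit along $(u_N)$ if and only if there is a nonnegative $P(i,w|j)$, finitely supported in $w\in\mathbb R$, with $\sum_{i,j}P(i,w|j)q_j=P(w)$ and $$\sum_{i,w}P(i,w|j)=1\ \ \forall j,\qquad \sum_{j,w}P(i,w|j)e^w=1\ \ \forall i,\qquad \sum_{j,w}P(i,w|j)q_j=p_i\ \ \forall i .$$ -/

import Mathlib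

open scoped Matrix Kronecker BigOperators
open Filter Topology

noncomputable section

namespace CoherenceBattery

/-! ### Pure states, incoherent states, (strictly) incoherent operations

A finite type `X` labels the reference basis of a finite-dimensional Hilbert space; the reference
basis of a composite system is labelled by the product type. -/

section Resource

variable {X Y : Type*} [Fintype X] [DecidableEq X] [Fintype Y]

/-- Normalised kets, given by their amplitudes in the reference basis. -/
def IsKet (v : X → ℂ) : Prop := ∑ s, ‖v s‖ ^ 2 = 1

/-- The operator `|v⟩⟨v|`. -/
def density (v : X → ℂ) : Matrix X X ℂ := Matrix.vecMulVec v (star v)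

/-- The product ket `|v⟩ ⊗ |w⟩`. -/
def tensorKet (v : X → ℂ) (w : Y → ℂ) : X × Y → ℂ := fun s => v s.1 * w s.2

/-- The dephasing operation `Δ`. -/
def dephase (M : Matrix X X ℂ) : Matrix X X ℂ := Matrix.diagonal M.diag

/-- The partial trace over the second factor. -/
def partialTraceRight (M : Matrix (X × Y) (X × Y) ℂ) : Matrix X X ℂ :=
  Matrix.of fun i j => ∑ y, M (i, y) (j, y)

/-- The trace norm `Tr √(M† M)`, i.e. the sum of the singular values of `M`. -/
def traceNorm (M : Matrix X X ℂ) : ℝ :=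
  ∑ s, Real.sqrt ((Matrix.isHermitian_conjTranspose_mul_self M).eigenvalues s)

/-- Incoherent states: density matrices that are diagonal in the reference basis. -/
def IsIncoherentState (σ : Matrix X X ℂ) : Prop :=
  ∃ c : X → ℝ, (∀ s, 0 ≤ c s) ∧ ∑ s, c s = 1 ∧ σ = Matrix.diagonal fun s => (c s : ℂ)

/-- `K σ K† / Tr (K σ K†)` is incoherent for every incoherent `σ` for which it is defined. -/
def PreservesIncoherence (K : Matrix X X ℂ) : Prop :=
  ∀ σ, IsIncoherentState σ → (K * σ * Kᴴ).trace ≠ 0 →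
    IsIncoherentState (((K * σ * Kᴴ).trace)⁻¹ • (K * σ * Kᴴ))

/-- The two classes of free operations. -/
inductive FreeClass
  | incoherent
  | strictlyIncoherent

/-- `Λ` is an incoherent, respectively a strictly incoherent, operation. -/
def IsFree (c : FreeClass) (Λ : Matrix X X ℂ → Matrix X X ℂ) : Prop :=
  ∃ (m : ℕ) (K : Fin m → Matrix X X ℂ),
    ∑ l, (K l)ᴴ * K l = 1 ∧
    (∀ ρ, Λ ρ = ∑ l, K l * ρ * (K l)ᴴ) ∧
    (∀ l, PreservesIncoherence (K l)) ∧
    (c = FreeClass.strictlyIncoherent → ∀ l, PreservesIncoherence (K l)ᴴ)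

/-- The pure-state transformation `|v⟩ → |w⟩` is possible by a free operation. -/
def Converts (c : FreeClass) (v w : X → ℂ) : Prop :=
  ∃ Λ : Matrix X X ℂ → Matrix X X ℂ, IsFree c Λ ∧ Λ (density v) = density w

/-- The unital map `M ↦ ∑ r_m Ξ_m M Ξ_m†`, with `Ξ_m` ranging over the permutation matrices. -/
def permMix (r : Equiv.Perm X → ℝ) (M : Matrix X X ℂ) : Matrix X X ℂ :=
  ∑ π : Equiv.Perm X,
    (r π : ℂ) • (Equiv.Perm.permMatrix ℂ π * M * (Equiv.Perm.permMatrix ℂ π)ᴴ)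

end Resource

/-! ### The coherence battery -/

/-- Labels of the reference basis of `n` battery cells, each of dimension `2u - 1`. -/
abbrev BatteryIndex (u n : ℕ) : Type := Fin n → Fin (2 * u - 1)

/-- The charged cell state: uniform superposition of the first `u` basis states. -/
def chargedKet (u : ℕ) : Fin (2 * u - 1) → ℂ := fun z =>
  if (z : ℕ) < u then ((1 / Real.sqrt u : ℝ) : ℂ) else 0

/-- The discharged cell state: uniform superposition of the last `u - 1` basis states. -/
def dischargedKet (u : ℕ) : Fin (2 * u - 1) → ℂ := fun z =>
  if u ≤ (z : ℕ) then ((1 / Real.sqrt ((u : ℝ) - 1) : ℝ) : ℂ) else 0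

/-- The coherence eigenstate `|c_x⟩`: the first `x` cells charged, the others discharged. -/
def levelKet (u n x : ℕ) : BatteryIndex u n → ℂ := fun z =>
  ∏ k : Fin n, if (k : ℕ) < x then chargedKet u (z k) else dischargedKet u (z k)

/-- The incoherent state `χ_x = Δ(|c_x⟩⟨c_x|)`. -/
def levelState (u n x : ℕ) : Matrix (BatteryIndex u n) (BatteryIndex u n) ℂ :=
  dephase (density (levelKet u n x))

/-- The projector `Π^x = u^x (u-1)^(n-x) χ_x` (for `x ≤ n`). -/
def levelProj (u n x : ℕ) : Matrix (BatteryIndex u n) (BatteryIndex u n) ℂ :=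
  ((u : ℂ) ^ x * ((u : ℂ) - 1) ^ (n - x)) • levelState u n x

/-- The projector `∑_x Π^x` on the diagonal support of the battery. -/
def batteryProj (u n : ℕ) : Matrix (BatteryIndex u n) (BatteryIndex u n) ℂ :=
  ∑ x : Fin (n + 1), levelProj u n x

/-- The unit `δw = ln (u / (u - 1))` of coherence. -/
def quid (u : ℕ) : ℝ := Real.log ((u : ℝ) / ((u : ℝ) - 1))

/-- The largest number of units of coherence that fit into `wmax`. -/
def maxStep (wmax : ℝ) (u : ℕ) : ℕ := ⌊wmax / quid u⌋₊

/-- `Γ^k |λ⟩` for `|λ⟩ = ∑_x √α_x |c_x⟩`, where `Γ^k |c_x⟩ = |c_{x+k}⟩` with `x + k` taken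
modulo `n + 1`. -/
def shiftedBattery (u n : ℕ) (α : Fin (n + 1) → ℝ) (k : ℤ) : BatteryIndex u n → ℂ := fun z =>
  ∑ x : Fin (n + 1),
    (Real.sqrt (α x) : ℂ) * levelKet u n ((((x : ℕ) : ℤ) + k) % ((n : ℤ) + 1)).toNat z

/-- The battery state `|λ⟩ = ∑_x √α_x |c_x⟩`. -/
def batteryKet (u n : ℕ) (α : Fin (n + 1) → ℝ) : BatteryIndex u n → ℂ := fun z =>
  ∑ x : Fin (n + 1), (Real.sqrt (α x) : ℂ) * levelKet u n x z

/-- The joint ket `∑_{i,x} a_{i,x} |i⟩ ⊗ |c_x⟩`. -/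
def jointKet {ι : Type*} (u n : ℕ) (a : ι → Fin (n + 1) → ℂ) : ι × BatteryIndex u n → ℂ :=
  fun s => ∑ x : Fin (n + 1), a s.1 x * levelKet u n x s.2

/-- The battery state with coefficients `α` is ideal up to `ε` for changes of at most `f` levels:
`α` is a probability distribution that stays `f` levels away from bottom and top, and every
reversible free transformation of a system and the battery that acts on the battery only by level
shifts `Γ^k`, `|k| ≤ f`, i.e. every reversible transformation
`|ψ⟩ ⊗ |λ⟩ → |Φ⟩ = ∑_k |φ_k⟩ ⊗ Γ^k |λ⟩`
whose diagonal marginal on the system is that of the target state `|φ⟩ = ∑_k |φ_k⟩`, has a final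
state that is `ε`-close in trace norm to `|φ⟩ ⊗ |λ⟩`. -/
def IsIdealBattery (c : FreeClass) (u n : ℕ) (α : Fin (n + 1) → ℝ) (f : ℕ) (ε : ℝ) : Prop :=
  (∀ x, 0 ≤ α x) ∧ ∑ x, α x = 1 ∧
  (∀ x : Fin (n + 1), α x ≠ 0 → f ≤ (x : ℕ) ∧ (x : ℕ) + f ≤ n) ∧
  ∀ (m : ℕ) (ψ φ : Fin m → ℂ) (φs : ℤ → Fin m → ℂ) (Φ : Fin m × BatteryIndex u n → ℂ),
    IsKet ψ → IsKet φ → IsKet Φ →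
    φ = ∑ k ∈ Finset.Icc (-(f : ℤ)) f, φs k →
    Φ = ∑ k ∈ Finset.Icc (-(f : ℤ)) f, tensorKet (φs k) (shiftedBattery u n α k) →
    dephase (partialTraceRight (density Φ)) = dephase (density φ) →
    Converts c (tensorKet ψ (batteryKet u n α)) Φ →
    Converts c Φ (tensorKet ψ (batteryKet u n α)) →
    traceNorm (density Φ - density (tensorKet φ (batteryKet u n α))) ≤ ε

/-! ### Battery assisted protocols and the extracted coherence -/

section Protocol

variable {ι : Type*} [Fintype ι] [DecidableEq ι]

/-- The data of a battery assisted protocol: the coefficients `α` of the battery state, the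
amplitudes of the initial and final joint kets `|Ψ⟩`, `|Φ⟩`, and the weights of the mixture of
permutations that defines the unital map. -/
structure Protocol (ι : Type*) (u n : ℕ) where
  α : Fin (n + 1) → ℝ
  Ψ : ι → Fin (n + 1) → ℂ
  Φ : ι → Fin (n + 1) → ℂ
  r : Equiv.Perm (ι × BatteryIndex u n) → ℝ

variable {u n : ℕ}

/-- The initial joint ket. -/
def Protocol.initialKet (S : Protocol ι u n) : ι × BatteryIndex u n → ℂ := jointKet u n S.Ψ

/-- The final joint ket. -/
def Protocol.finalKet (S : Protocol ι u n) : ι × BatteryIndex u n → ℂ := jointKet u n S.Φ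

/-- The unital map of the protocol. -/
def Protocol.unital (S : Protocol ι u n)
    (M : Matrix (ι × BatteryIndex u n) (ι × BatteryIndex u n) ℂ) :
    Matrix (ι × BatteryIndex u n) (ι × BatteryIndex u n) ℂ := permMix S.r M

/-- `S` realises `|ψ⟩ ⊗ |λ⟩ → |Φ⟩ ≈ |φ⟩ ⊗ |λ⟩` by a free operation of class `c`, up to errors `ε`,
with the level of the battery changing by at most `maxStep wmax u` units. -/
structure Protocol.Realises (S : Protocol ι u n) (c : FreeClass) (wmax ε : ℝ) (ψ φ : ι → ℂ) :
    Prop where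
  ideal : IsIdealBattery c u n S.α (maxStep wmax u) ε
  isKet_initial : IsKet S.initialKet
  isKet_final : IsKet S.finalKet
  initial_close :
    traceNorm (density S.initialKet - density (tensorKet ψ (batteryKet u n S.α))) ≤ ε
  final_close :
    traceNorm (density S.finalKet - density (tensorKet φ (batteryKet u n S.α))) ≤ ε
  converts : Converts c S.initialKet S.finalKet
  weight_nonneg : ∀ π, 0 ≤ S.r π
  weight_sum : ∑ π, S.r π = 1
  /-- `Δ(Ψ)` is the image of `Δ(Φ)` under the unital map. -/
  majorised : dephase (density S.initialKet) = S.unital (dephase (density S.finalKet))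
  /-- The unital map leaves the diagonal support of system and battery invariant. -/
  support_invariant :
    S.unital ((1 : Matrix ι ι ℂ) ⊗ₖ batteryProj u n) = (1 : Matrix ι ι ℂ) ⊗ₖ batteryProj u n
  /-- The battery is raised or lowered by at most `wmax`. -/
  bounded_step : ∀ (i j : ι) (x x' : Fin (n + 1)),
    (maxStep wmax u : ℤ) < |((x' : ℕ) : ℤ) - ((x : ℕ) : ℤ)| →
    ((Matrix.single i i (1 : ℂ) ⊗ₖ levelProj u n x) *
      S.unital (Matrix.single j j (1 : ℂ) ⊗ₖ levelProj u n x')).trace = 0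

/-- The conditional distribution `P(i, · | j)` of the protocol: prepare `|j⟩⟨j| ⊗ Δ(λ)`, find the
battery at level `x'`, apply the unital map, find the system in `|i⟩` and the battery at level `x`,
and record `w = (x' - x) δw`. -/
def Protocol.cond (S : Protocol ι u n) (i j : ι) : ℝ →₀ ℝ :=
  ∑ x' : Fin (n + 1), ∑ x : Fin (n + 1),
    Finsupp.single ((((x' : ℕ) : ℝ) - ((x : ℕ) : ℝ)) * quid u)
      (((Matrix.single i i (1 : ℂ) ⊗ₖ levelProj u n x) *
        S.unital (Matrix.single j j (1 : ℂ) ⊗ₖ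
          (levelProj u n x' * dephase (density (batteryKet u n S.α)) *
            levelProj u n x'))).trace).re

/-! ### The three conditions

`P i j : ℝ →₀ ℝ` is the finitely supported function `w ↦ P(i, w | j)`. -/

/-- `∑_{i,w} P(i,w|j)`. -/
def totalMass (P : ι → ι → ℝ →₀ ℝ) (j : ι) : ℝ := ∑ i, (P i j).sum fun _ a => a

/-- `∑_{j,w} P(i,w|j) e^w`. -/
def expMass (P : ι → ι → ℝ →₀ ℝ) (i : ι) : ℝ := ∑ j, (P i j).sum fun w a => a * Real.exp w

/-- `∑_{j,w} P(i,w|j) q_j`. -/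
def rowMarginal (P : ι → ι → ℝ →₀ ℝ) (q : ι → ℝ) (i : ι) : ℝ :=
  ∑ j, (P i j).sum fun _ a => a * q j

/-- The distribution `P(w) = ∑_{i,j} P(i,w|j) q_j`. -/
def coherenceMarginal (P : ι → ι → ℝ →₀ ℝ) (q : ι → ℝ) : ℝ →₀ ℝ := ∑ i, ∑ j, q j • P i j

/-- `P` is nonnegative and satisfies the three conditions. -/
structure Conditions (p q : ι → ℝ) (P : ι → ι → ℝ →₀ ℝ) : Prop where
  nonneg : ∀ i j w, 0 ≤ P i j w
  normalisation : ∀ j, totalMass P j = 1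
  exponential : ∀ i, expMass P i = 1
  marginal : ∀ i, rowMarginal P q i = p i

/-- The diagonal coefficients of `|v⟩⟨v|`. -/
def diagCoeff (v : ι → ℂ) (i : ι) : ℝ := ‖v i‖ ^ 2

/-- In the ideal-battery limit, along batteries with parameters `u N`, the transformation
`|ψ⟩ ⊗ |λ⟩ → |Φ⟩ ≈ |φ⟩ ⊗ |λ⟩` is implemented by free operations of class `c` while extracting
the coherence distribution `Pw`: all errors `ε N` vanish, fast enough for the resulting deviation
of the battery from uniformity to vanish over the range of levels used, and the extracted
distributions of `w` converge weakly to `Pw`. -/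
def Implements (c : FreeClass) (ψ φ : ι → ℂ) (u : ℕ → ℕ) (Pw : ℝ →₀ ℝ) : Prop :=
  ∃ (wmax : ℝ) (ε : ℕ → ℝ) (n : ℕ → ℕ) (S : ∀ N, Protocol ι (u N) (n N)),
    0 < wmax ∧
    (∀ N, (S N).Realises c wmax (ε N) ψ φ) ∧
    Tendsto ε atTop (𝓝 0) ∧
    Tendsto (fun N => Real.sqrt (8 * ε N) *
      ((maxStep wmax (u N) : ℝ) * ((maxStep wmax (u N) : ℝ) + 1))) atTop (𝓝 0) ∧
    ∀ g : ℝ → ℝ, Continuous g →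
      Tendsto (fun N => (coherenceMarginal (S N).cond (diagCoeff φ)).sum fun w a => a * g w)
        atTop (𝓝 (Pw.sum fun w a => a * g w))

end Protocol

end CoherenceBattery

end

/-!
The theorem reduces to classical transition weights between blocks of basis states. The ket `|c_x⟩`
is uniform on a set of `u ^ x * (u - 1) ^ (n - x)` reference basis states, which up to a constant is
`exp (x * δw)` (`levelDim_eq`), and these sets are disjoint. A mixture of permutations acts on
diagonal matrices as a doubly stochastic matrix, and the conditional distribution of a protocol
depends only on the battery coefficients `α` and on the weights `G (i, x) (j, x')` which that matrix
transfers from the block `(j, x')` to the block `(i, x)` (`transfer`, `Protocol.cond_eq`). When the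
support of the battery is preserved, the rows and the columns of `G` add up to the sizes of the
blocks.

*Finite batteries.* The column sums give `∑ P(i,w|j) = 1`. The factor `exp w = exp ((x' - x) * δw)`
replaces the normalisation by the size of the block `x'` by that for the block `x`, so that the row
sums give `∑ P(i,w|j) exp w = 1`, apart from an error that is bounded by the differences
`|α_x' - α_x|` with `|x' - x| ≤ f` (`Protocol.Realises.abs_expMass_sub_one_le`). These are small for
an ideal battery: the uniform superposition of `u` system states, with the battery at `|c_x⟩`, and
that of `u - 1` system states, with the battery at `|c_{x+1}⟩`, are uniform on equally many basis
states. A permutation hence converts `ψ ⊗ λ` into `φ ⊗ Γ λ`, for uniform `ψ`, `φ` on `u` and on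
`u - 1` states, and ideality bounds the distance between `α` and its shift by one
(`IsIdealBattery.variation_le`). The estimate of the marginal follows from the triangle inequality,
as the trace norm dominates the `ℓ¹` norm of the diagonal and as mixtures of permutations contract
the latter.

*Necessity in the limit.* The conditional distributions live on a fixed compact interval, so that
along an ultrafilter all their continuous moments converge (`exists_conditions_of_tendsto`). For
`q j > 0` the limit is concentrated on the atoms of `P(w)`. For `q j = 0` only its mass and its
exponential moment matter, and it may be replaced by a single atom.

*Sufficiency.* Every atom `w` is split between its two neighbours in `δw ℤ`, preserving mass and
exponential moment; for resolved atoms this converges weakly to the identity (`tendsto_split`). The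
resulting jump probabilities `Q i j k` are realised exactly (`exists_realisation`), on a battery
that is uniform on the levels from `f` to `n - f`. Let blocks in the middle exchange the weights
given by `Q`. Near the bottom and the top of the battery, where jumps would leave the range of
levels, the deficits of the rows and of the columns have equal totals because of the exponential
condition, and are coupled arbitrarily (`exists_weights`). Birkhoff's theorem turns the weights into
a mixture of permutations (`exists_mixture_of_weights`). Take `φ ⊗ λ` as the final ket. The image of
its diagonal under this mixture gives the squared moduli of an initial ket, which agrees with
`ψ ⊗ λ` in the middle of the battery, and majorisation yields the strictly incoherent Kraus
operators (`converts_of_mixture`). A battery that is long in comparison with `f` has little weight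
near its ends, which makes it ideal (`isIdealBattery_box`) and the errors small.
-/

noncomputable section

namespace CoherenceBattery

/-! ### Pure states -/

section Kets

variable {X : Type*}

theorem density_apply (v : X → ℂ) (s t : X) : density v s t = v s * star (v t) := rfl

theorem density_smul (a : ℂ) (v : X → ℂ) :
    density (a • v) = ((‖a‖ ^ 2 : ℝ) : ℂ) • density v := by
  ext s t
  simp only [density_apply, Pi.smul_apply, smul_eq_mul, star_mul', RCLike.star_def,
    Matrix.smul_apply]
  push_cast
  rw [← Complex.mul_conj']
  ring

theorem dephase_density [DecidableEq X] (v : X → ℂ) :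
    dephase (density v) = Matrix.diagonal fun s => ((‖v s‖ ^ 2 : ℝ) : ℂ) := by
  unfold dephase
  congr 1
  ext s
  simp [density_apply, Complex.mul_conj']

theorem mul_density_mul [Fintype X] (K : Matrix X X ℂ) (v : X → ℂ) :
    K * density v * Kᴴ = density (K *ᵥ v) := by
  rw [density, density, Matrix.mul_vecMulVec, Matrix.vecMulVec_mul, Matrix.star_mulVec]

end Kets

/-! ### The trace norm -/

section TraceNorm

variable {X : Type*} [Fintype X] [DecidableEq X]

theorem traceNorm_nonneg (M : Matrix X X ℂ) : 0 ≤ traceNorm M :=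
  Finset.sum_nonneg fun _ _ => Real.sqrt_nonneg _

/-- The image of an eigenvector of `M† M` has norm the corresponding singular value. -/
theorem norm_mulVec_eigenvectorBasis (M : Matrix X X ℂ) (s : X) :
    ∑ t, ‖(M *ᵥ ⇑((Matrix.isHermitian_conjTranspose_mul_self M).eigenvectorBasis s)) t‖ ^ 2 =
      (Matrix.isHermitian_conjTranspose_mul_self M).eigenvalues s := by
  set hM := Matrix.isHermitian_conjTranspose_mul_self M
  set e : X → ℂ := ⇑(hM.eigenvectorBasis s) with he
  have h1 : star (M *ᵥ e) ⬝ᵥ (M *ᵥ e) = ((∑ t, ‖(M *ᵥ e) t‖ ^ 2 : ℝ) : ℂ) := by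
    simp [dotProduct, Complex.conj_mul']
  have h2 : star e ⬝ᵥ e = 1 := by
    have h := hM.eigenvectorBasis.orthonormal.1 s
    have h' : ‖hM.eigenvectorBasis s‖ ^ 2 = 1 := by rw [h]; norm_num
    rw [EuclideanSpace.norm_sq_eq] at h'
    have : star e ⬝ᵥ e = ((∑ t, ‖e t‖ ^ 2 : ℝ) : ℂ) := by
      simp [dotProduct, Complex.conj_mul']
    rw [this, he, h']; simp
  have h3 : star (M *ᵥ e) ⬝ᵥ (M *ᵥ e) = (hM.eigenvalues s : ℂ) := by
    rw [Matrix.star_mulVec, ← Matrix.dotProduct_mulVec, Matrix.mulVec_mulVec,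
      hM.mulVec_eigenvectorBasis s]
    change star e ⬝ᵥ (hM.eigenvalues s • e) = _
    rw [dotProduct_smul, h2]
    simp
  exact_mod_cast h1.symm.trans h3

/-- The trace norm dominates the sum of the moduli of the diagonal entries: expand every diagonal
entry in an eigenbasis of `M† M` and use the Cauchy-Schwarz inequality. -/
theorem sum_norm_diag_le_traceNorm (M : Matrix X X ℂ) : ∑ t, ‖M t t‖ ≤ traceNorm M := by
  set hM := Matrix.isHermitian_conjTranspose_mul_self M
  set U : Matrix X X ℂ := (hM.eigenvectorUnitary : Matrix X X ℂ) with hU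
  have hUU : U * star U = 1 := Unitary.coe_mul_star_self _
  have hcol : ∀ s, ∑ t, ‖U t s‖ ^ 2 = 1 := by
    intro s
    have h := hM.eigenvectorBasis.orthonormal.1 s
    have h' : ‖hM.eigenvectorBasis s‖ ^ 2 = 1 := by rw [h]; norm_num
    rw [EuclideanSpace.norm_sq_eq] at h'
    simpa [hU] using h'
  have hM' : ∀ t, M t t = ∑ s, (M * U) t s * star (U t s) := by
    intro t
    conv_lhs => rw [← Matrix.mul_one M, ← hUU, ← Matrix.mul_assoc, Matrix.mul_apply]
    rfl
  have hsv : ∀ s, ∑ t, ‖(M * U) t s‖ ^ 2 = hM.eigenvalues s := by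
    intro s
    rw [← norm_mulVec_eigenvectorBasis M s]
    rfl
  calc ∑ t, ‖M t t‖ ≤ ∑ t, ∑ s, ‖(M * U) t s‖ * ‖U t s‖ := by
        refine Finset.sum_le_sum fun t _ => ?_
        rw [hM' t]
        refine (norm_sum_le _ _).trans (Finset.sum_le_sum fun s _ => ?_)
        rw [norm_mul, norm_star]
    _ = ∑ s, ∑ t, ‖(M * U) t s‖ * ‖U t s‖ := Finset.sum_comm
    _ ≤ ∑ s, Real.sqrt (hM.eigenvalues s) := by
        refine Finset.sum_le_sum fun s _ => ?_
        refine (Real.sum_mul_le_sqrt_mul_sqrt _ _ _).trans ?_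
        rw [hsv, hcol]; simp
    _ = traceNorm M := rfl

/-- The diagonals of two pure states differ in `ℓ¹` norm by at most their trace distance. -/
theorem sum_abs_norm_sq_sub_le (v w : X → ℂ) :
    ∑ s, |‖v s‖ ^ 2 - ‖w s‖ ^ 2| ≤ traceNorm (density v - density w) := by
  refine le_trans (le_of_eq ?_) (sum_norm_diag_le_traceNorm _)
  refine Finset.sum_congr rfl fun s _ => ?_
  have h1 : (density v - density w) s s = ((‖v s‖ ^ 2 - ‖w s‖ ^ 2 : ℝ) : ℂ) := by
    rw [Matrix.sub_apply, density_apply, density_apply]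
    push_cast
    rw [RCLike.star_def, Complex.mul_conj', Complex.mul_conj']
  rw [h1, Complex.norm_real, Real.norm_eq_abs]

/-- A matrix of rank at most two has at most two nonzero singular values, so its trace norm is
controlled by its Hilbert-Schmidt norm. -/
theorem traceNorm_le_of_rank_le_two (M : Matrix X X ℂ) (h : M.rank ≤ 2) :
    traceNorm M ≤ Real.sqrt (2 * ∑ s, ∑ t, ‖M s t‖ ^ 2) := by
  set hM := Matrix.isHermitian_conjTranspose_mul_self M
  have hev : ∀ s, 0 ≤ hM.eigenvalues s := fun s => by
    rw [← norm_mulVec_eigenvectorBasis M s]; positivity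
  have htr : ∑ s, hM.eigenvalues s = ∑ s, ∑ t, ‖M s t‖ ^ 2 := by
    have h1 := hM.trace_eq_sum_eigenvalues
    have h2 : (Mᴴ * M).trace = ((∑ s, ∑ t, ‖M s t‖ ^ 2 : ℝ) : ℂ) := by
      rw [Finset.sum_comm]
      simp [Matrix.trace, Matrix.mul_apply, Complex.conj_mul']
    rw [h2] at h1
    refine Complex.ofReal_injective ?_
    rw [h1]
    simp
  have hcard : ((Finset.univ.filter fun s => hM.eigenvalues s ≠ 0).card : ℝ) ≤ 2 := by
    have h1 : (Mᴴ * M).rank = Fintype.card {i // hM.eigenvalues i ≠ 0} :=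
      hM.rank_eq_card_non_zero_eigs
    have h2 : (Mᴴ * M).rank ≤ 2 := (Matrix.rank_mul_le_right _ _).trans h
    rw [h1, Fintype.card_subtype] at h2
    exact_mod_cast h2
  have hsum : traceNorm M =
      ∑ s ∈ Finset.univ.filter (fun s => hM.eigenvalues s ≠ 0), Real.sqrt (hM.eigenvalues s) := by
    rw [Finset.sum_filter_of_ne]
    · rfl
    · intro s _ hs h0
      exact hs (by rw [h0, Real.sqrt_zero])
  apply Real.le_sqrt_of_sq_le
  rw [hsum]
  refine (sq_sum_le_card_mul_sum_sq).trans ?_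
  refine mul_le_mul hcard ?_ (Finset.sum_nonneg fun _ _ => sq_nonneg _) (by norm_num)
  rw [← htr]
  calc _ = ∑ s ∈ Finset.univ.filter (fun s => hM.eigenvalues s ≠ 0), hM.eigenvalues s :=
        Finset.sum_congr rfl fun s _ => Real.sq_sqrt (hev s)
    _ ≤ _ := Finset.sum_le_univ_sum_of_nonneg hev

/-- Pure states of kets that are close in Hilbert space norm are close in trace norm. -/
theorem traceNorm_density_sub_le (a b : X → ℂ) (ha : IsKet a) (hb : IsKet b) :
    traceNorm (density a - density b) ≤ Real.sqrt (8 * ∑ s, ‖a s - b s‖ ^ 2) := by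
  have hrank : (density a - density b).rank ≤ 2 := by
    have h1 : density a - density b =
        (Matrix.of fun s => ![a s, b s] : Matrix X (Fin 2) ℂ) * Matrix.of ![star a, -star b] := by
      ext s t
      simp [density_apply, Matrix.mul_apply, sub_eq_add_neg]
    rw [h1]
    exact (Matrix.rank_mul_le_left _ _).trans ((Matrix.rank_le_card_width _).trans (by simp))
  refine (traceNorm_le_of_rank_le_two _ hrank).trans (Real.sqrt_le_sqrt ?_)
  have key : ∀ s t, ‖(density a - density b) s t‖ ^ 2 ≤
      2 * (‖a s‖ ^ 2 * ‖a t - b t‖ ^ 2) + 2 * (‖a s - b s‖ ^ 2 * ‖b t‖ ^ 2) := by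
    intro s t
    have h1 : (density a - density b) s t =
        a s * star (a t - b t) + (a s - b s) * star (b t) := by
      rw [Matrix.sub_apply, density_apply, density_apply, star_sub]; ring
    have h2 : ‖(density a - density b) s t‖ ≤ ‖a s‖ * ‖a t - b t‖ + ‖a s - b s‖ * ‖b t‖ := by
      rw [h1]
      refine (norm_add_le _ _).trans ?_
      rw [norm_mul, norm_mul, norm_star, norm_star]
    calc _ ≤ (‖a s‖ * ‖a t - b t‖ + ‖a s - b s‖ * ‖b t‖) ^ 2 := by gcongr
      _ ≤ _ := by nlinarith [sq_nonneg (‖a s‖ * ‖a t - b t‖ - ‖a s - b s‖ * ‖b t‖)]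
  have hS : ∑ s, ∑ t, ‖(density a - density b) s t‖ ^ 2 ≤ 4 * ∑ s, ‖a s - b s‖ ^ 2 := by
    calc _ ≤ ∑ s, ∑ t, (2 * (‖a s‖ ^ 2 * ‖a t - b t‖ ^ 2) + 2 * (‖a s - b s‖ ^ 2 * ‖b t‖ ^ 2)) :=
          Finset.sum_le_sum fun s _ => Finset.sum_le_sum fun t _ => key s t
      _ = 2 * ((∑ s, ‖a s‖ ^ 2) * ∑ t, ‖a t - b t‖ ^ 2) +
          2 * ((∑ s, ‖a s - b s‖ ^ 2) * ∑ t, ‖b t‖ ^ 2) := by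
          simp only [Finset.sum_add_distrib, ← Finset.mul_sum, ← Finset.sum_mul]
      _ = _ := by rw [ha, hb]; ring
  linarith

end TraceNorm

/-! ### Mixtures of permutations and free transformations of pure states -/

section Free

variable {X : Type*} [Fintype X] [DecidableEq X]

theorem permMix_apply (r : Equiv.Perm X → ℝ) (M : Matrix X X ℂ) (s t : X) :
    permMix r M s t = ∑ π : Equiv.Perm X, (r π : ℂ) * M (π s) (π t) := by
  have h : ∀ π : Equiv.Perm X,
      Equiv.Perm.permMatrix ℂ π * M * (Equiv.Perm.permMatrix ℂ π)ᴴ = M.submatrix π π := by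
    intro π
    rw [Matrix.conjTranspose_permMatrix, Equiv.Perm.permMatrix, Equiv.Perm.permMatrix,
      PEquiv.toMatrix_toPEquiv_mul, PEquiv.mul_toMatrix_toPEquiv]
    rfl
  simp only [permMix, h, Matrix.sum_apply, Matrix.smul_apply, smul_eq_mul, Matrix.submatrix_apply]

theorem permMix_diagonal (r : Equiv.Perm X → ℝ) (d : X → ℂ) :
    permMix r (Matrix.diagonal d) =
      Matrix.diagonal fun s => ∑ π : Equiv.Perm X, (r π : ℂ) * d (π s) := by
  ext s t
  rw [permMix_apply]
  by_cases h : s = t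
  · subst h; simp
  · simp [h]

theorem preservesIncoherence_of_diagonal (K : Matrix X X ℂ)
    (h : ∀ d : X → ℝ, (∀ s, 0 ≤ d s) → ∃ d' : X → ℝ, (∀ s, 0 ≤ d' s) ∧
      K * (Matrix.diagonal fun s => (d s : ℂ)) * Kᴴ = Matrix.diagonal fun s => (d' s : ℂ)) :
    PreservesIncoherence K := by
  rintro σ ⟨d, hd, -, rfl⟩ hne
  obtain ⟨d', hd', he⟩ := h d hd
  rw [he] at hne ⊢
  have htr : (Matrix.diagonal fun s => (d' s : ℂ)).trace = ((∑ s, d' s : ℝ) : ℂ) := by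
    simp [Matrix.trace]
  rw [htr] at hne ⊢
  have hne' : (∑ s, d' s) ≠ 0 := by exact_mod_cast hne
  have hpos : 0 ≤ ∑ s, d' s := Finset.sum_nonneg fun s _ => hd' s
  refine ⟨fun s => (∑ s, d' s)⁻¹ * d' s, fun s => mul_nonneg (inv_nonneg.2 hpos) (hd' s), ?_, ?_⟩
  · rw [← Finset.mul_sum, inv_mul_cancel₀ hne']
  · ext s t
    by_cases hst : s = t
    · subst hst; simp
    · simp [hst]

/-- Weighted permutation matrices, and their adjoints, map diagonal matrices to diagonal
matrices. -/
theorem preservesIncoherence_monomial (w : X → ℂ) (π : Equiv.Perm X) :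
    PreservesIncoherence (Matrix.diagonal w * Equiv.Perm.permMatrix ℂ π) ∧
      PreservesIncoherence (Matrix.diagonal w * Equiv.Perm.permMatrix ℂ π)ᴴ := by
  have hc : ∀ (π : Equiv.Perm X) (d : X → ℂ),
      Equiv.Perm.permMatrix ℂ π * Matrix.diagonal d * Equiv.Perm.permMatrix ℂ π⁻¹ =
        Matrix.diagonal fun s => d (π s) := by
    intro π d
    rw [Equiv.Perm.permMatrix, Equiv.Perm.permMatrix,
      PEquiv.toMatrix_toPEquiv_mul, PEquiv.mul_toMatrix_toPEquiv]
    change (Matrix.diagonal d).submatrix π π = _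
    exact Matrix.submatrix_diagonal _ _ π.injective
  constructor
  · refine preservesIncoherence_of_diagonal _ fun d hd => ⟨fun s => ‖w s‖ ^ 2 * d (π s),
      fun s => mul_nonneg (by positivity) (hd _), ?_⟩
    rw [Matrix.conjTranspose_mul, Matrix.conjTranspose_permMatrix, Matrix.diagonal_conjTranspose]
    have : ∀ A B C D E : Matrix X X ℂ, A * B * C * (D * E) = A * (B * C * D) * E := by
      intros; simp only [Matrix.mul_assoc]
    rw [this, hc, Matrix.diagonal_mul_diagonal, Matrix.diagonal_mul_diagonal]
    congr 1
    ext s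
    simp only [Pi.star_apply, RCLike.star_def]
    push_cast
    rw [← Complex.mul_conj']
    ring
  · refine preservesIncoherence_of_diagonal _ fun d hd =>
      ⟨fun s => ‖w (π⁻¹ s)‖ ^ 2 * d (π⁻¹ s), fun s => mul_nonneg (by positivity) (hd _), ?_⟩
    rw [Matrix.conjTranspose_conjTranspose, Matrix.conjTranspose_mul,
      Matrix.conjTranspose_permMatrix, Matrix.diagonal_conjTranspose]
    have : ∀ A B C D E : Matrix X X ℂ, A * B * C * (D * E) = A * (B * C * D) * E := by
      intros; simp only [Matrix.mul_assoc]
    rw [this, Matrix.diagonal_mul_diagonal, Matrix.diagonal_mul_diagonal]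
    have h := hc π⁻¹ (fun i => star w i * (d i : ℂ) * w i)
    rw [inv_inv] at h
    rw [h]
    congr 1
    ext s
    simp only [Pi.star_apply, RCLike.star_def]
    push_cast
    rw [← Complex.mul_conj']
    ring

theorem isFree_of_kraus {κ : Type*} [Fintype κ] (c : FreeClass) (K : κ → Matrix X X ℂ)
    (h1 : ∑ l, (K l)ᴴ * K l = 1) (h2 : ∀ l, PreservesIncoherence (K l))
    (h3 : ∀ l, PreservesIncoherence (K l)ᴴ) : IsFree c fun ρ => ∑ l, K l * ρ * (K l)ᴴ := by
  classical
  let e := (Fintype.equivFin κ).symm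
  refine ⟨Fintype.card κ, fun l => K (e l), ?_, fun ρ => ?_, fun l => h2 _, fun _ l => h3 _⟩
  · rw [← h1]; exact Equiv.sum_comp e fun l => (K l)ᴴ * K l
  · exact (Equiv.sum_comp e fun l => K l * ρ * (K l)ᴴ).symm

/-- Majorisation suffices for free transformations of pure states: if `|v|²` is the image of `|w|²`
under a mixture of permutations `π`, the weighted permutations `|s⟩ ↦ √r_π (w (π s) / v s) |π s⟩`
map `v` to multiples of `w`. Together with the projector onto the zeros of `v` they are the Kraus
operators of a strictly incoherent operation. -/
theorem converts_of_mixture (c : FreeClass) (v w : X → ℂ) (r : Equiv.Perm X → ℝ)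
    (hr : ∀ π, 0 ≤ r π) (hr1 : ∑ π, r π = 1)
    (h : ∀ s, ‖v s‖ ^ 2 = ∑ π : Equiv.Perm X, r π * ‖w (π s)‖ ^ 2) : Converts c v w := by
  have hzero : ∀ s, v s = 0 → ∀ π : Equiv.Perm X, (Real.sqrt (r π) : ℂ) * w (π s) = 0 := by
    intro s hs π
    have h1 := h s
    rw [hs, norm_zero, zero_pow two_ne_zero, eq_comm,
      Finset.sum_eq_zero_iff_of_nonneg fun π _ => mul_nonneg (hr π) (sq_nonneg _)] at h1
    rcases mul_eq_zero.1 (h1 π (Finset.mem_univ _)) with h2 | h2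
    · simp [h2]
    · simp only [ne_eq, OfNat.ofNat_ne_zero, not_false_eq_true, pow_eq_zero_iff, norm_eq_zero] at h2
      simp [h2]
  let a : Option (Equiv.Perm X) → X → ℂ := fun o => match o with
    | none => fun s => if v s = 0 then 1 else 0
    | some π => fun t => (Real.sqrt (r π) : ℂ) * w t / v (π⁻¹ t)
  let σ : Option (Equiv.Perm X) → Equiv.Perm X := fun o => match o with
    | none => 1
    | some π => π⁻¹
  let K : Option (Equiv.Perm X) → Matrix X X ℂ := fun o =>
    Matrix.diagonal (a o) * Equiv.Perm.permMatrix ℂ (σ o)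
  have hKK : ∀ o, (K o)ᴴ * K o = Matrix.diagonal fun s => ((‖a o ((σ o)⁻¹ s)‖ ^ 2 : ℝ) : ℂ) := by
    intro o
    have h1 : (K o)ᴴ * K o = Equiv.Perm.permMatrix ℂ (σ o)⁻¹ *
        (Matrix.diagonal (star (a o)) * Matrix.diagonal (a o)) * Equiv.Perm.permMatrix ℂ (σ o) := by
      simp only [K, Matrix.conjTranspose_mul, Matrix.conjTranspose_permMatrix,
        Matrix.diagonal_conjTranspose, Matrix.mul_assoc]
    rw [h1, Matrix.diagonal_mul_diagonal, Equiv.Perm.permMatrix, Equiv.Perm.permMatrix,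
      PEquiv.toMatrix_toPEquiv_mul, PEquiv.mul_toMatrix_toPEquiv]
    ext i j
    by_cases hij : i = j
    · subst hij; simp [Complex.conj_mul']
    · simp [hij]
  refine ⟨_, isFree_of_kraus c K ?_ (fun o => (preservesIncoherence_monomial _ _).1)
    (fun o => (preservesIncoherence_monomial _ _).2), ?_⟩
  · simp only [hKK]
    rw [← Matrix.diagonal_one]
    ext i j
    by_cases hij : i = j
    · subst hij
      simp only [Matrix.sum_apply, Matrix.diagonal_apply_eq]
      rw [← Complex.ofReal_sum, Fintype.sum_option]
      have : ‖a none ((σ none)⁻¹ i)‖ ^ 2 + ∑ π, ‖a (some π) ((σ (some π))⁻¹ i)‖ ^ 2 = 1 := by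
        have hinv : ∀ π : Equiv.Perm X, π⁻¹ (π i) = i := fun π => π.symm_apply_apply i
        simp only [a, σ, inv_one, Equiv.Perm.coe_one, id_eq, inv_inv, hinv]
        by_cases hi : v i = 0
        · simp [hi]
        · have hv : ‖v i‖ ^ 2 ≠ 0 := by simpa using hi
          simp only [hi, if_false, norm_zero, norm_div, norm_mul, div_pow, mul_pow,
            Complex.norm_real, Real.norm_eq_abs, sq_abs]
          rw [← Finset.sum_div, zero_pow two_ne_zero, zero_add, div_eq_one_iff_eq hv, h i]
          exact Finset.sum_congr rfl fun π _ => by rw [Real.sq_sqrt (hr π)]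
      rw [this]; simp
    · simp [hij, Matrix.sum_apply]
  · have hKv : ∀ π, K (some π) *ᵥ v = (Real.sqrt (r π) : ℂ) • w := by
      intro π
      simp only [K, ← Matrix.mulVec_mulVec, Matrix.permMatrix_mulVec, a, σ]
      ext t
      rw [Matrix.mulVec_diagonal]
      simp only [Function.comp, Pi.smul_apply, smul_eq_mul]
      by_cases ht : v (π⁻¹ t) = 0
      · have := hzero _ ht π
        rw [Equiv.Perm.inv_def, Equiv.apply_symm_apply] at this
        simp [this]
      · field_simp
    have hKn : K none *ᵥ v = 0 := by
      simp only [K, ← Matrix.mulVec_mulVec, Matrix.permMatrix_mulVec, a, σ]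
      ext t
      rw [Matrix.mulVec_diagonal]
      simp only [Function.comp, Equiv.Perm.coe_one, id_eq, Pi.zero_apply]
      split_ifs with ht <;> simp [ht]
    simp only [mul_density_mul, Fintype.sum_option, hKn, hKv, density_smul]
    rw [← Finset.sum_smul]
    have h0 : density (0 : X → ℂ) = 0 := by ext; simp [density_apply]
    rw [h0, zero_add]
    have : ∑ π : Equiv.Perm X, ((‖(Real.sqrt (r π) : ℂ)‖ ^ 2 : ℝ) : ℂ) = 1 := by
      rw [← Complex.ofReal_sum, ← Complex.ofReal_one, ← hr1]
      congr 1
      refine Finset.sum_congr rfl fun π _ => ?_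
      rw [Complex.norm_real, Real.norm_eq_abs, sq_abs, Real.sq_sqrt (hr π)]
    rw [this, one_smul]

/-- Kets whose moduli differ by a permutation of the basis are interconvertible. -/
theorem converts_of_perm (c : FreeClass) (v w : X → ℂ) (π : Equiv.Perm X)
    (h : ∀ s, ‖v s‖ = ‖w (π s)‖) : Converts c v w := by
  refine converts_of_mixture c v w (fun σ => if σ = π then 1 else 0)
    (fun σ => by split_ifs <;> norm_num) (by simp) fun s => ?_
  simp [h s]

end Free

/-! ### The supports of the coherence eigenstates -/

/-- The reference basis states on which `|c_x⟩` is supported: the first `x` cells are in one of the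
first `u` basis states, the other cells in one of the last `u - 1`. -/
def levelSet (u n x : ℕ) : Finset (BatteryIndex u n) :=
  Fintype.piFinset fun k : Fin n =>
    if (k : ℕ) < x then Finset.univ.filter fun z : Fin (2 * u - 1) => (z : ℕ) < u
    else Finset.univ.filter fun z : Fin (2 * u - 1) => u ≤ (z : ℕ)

/-- The number of elements of `levelSet u n x`, as a real number. -/
def levelDim (u n x : ℕ) : ℝ := (u : ℝ) ^ x * ((u : ℝ) - 1) ^ (n - x)

theorem levelDim_pos {u : ℕ} (hu : 2 ≤ u) (n x : ℕ) : 0 < levelDim u n x := by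
  have h : (2 : ℝ) ≤ u := by exact_mod_cast hu
  have h1 : (0 : ℝ) < u := by linarith
  have h2 : (0 : ℝ) < (u : ℝ) - 1 := by linarith
  unfold levelDim
  positivity

theorem mem_levelSet {u n x : ℕ} {z : BatteryIndex u n} :
    z ∈ levelSet u n x ↔ ∀ k : Fin n, if (k : ℕ) < x then (z k : ℕ) < u else u ≤ (z k : ℕ) := by
  rw [levelSet, Fintype.mem_piFinset]
  refine forall_congr' fun k => ?_
  split_ifs <;> simp

theorem prod_ite_lt {M : Type*} [CommMonoid M] {n x : ℕ} (hx : x ≤ n) (a b : M) :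
    (∏ k : Fin n, if (k : ℕ) < x then a else b) = a ^ x * b ^ (n - x) := by
  have hc : (Finset.univ.filter fun k : Fin n => (k : ℕ) < x).card = x := by
    rw [Fin.card_filter_val_lt, min_eq_right hx]
  have hc' : (Finset.univ.filter fun k : Fin n => ¬ (k : ℕ) < x).card = n - x := by
    have := Finset.card_filter_add_card_filter_not (s := (Finset.univ : Finset (Fin n)))
      (fun k : Fin n => (k : ℕ) < x)
    rw [hc, Finset.card_univ, Fintype.card_fin] at this
    omega
  rw [Finset.prod_ite, Finset.prod_const, Finset.prod_const, hc, hc']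

theorem card_levelSet {u : ℕ} (hu : 2 ≤ u) {n x : ℕ} (hx : x ≤ n) :
    ((levelSet u n x).card : ℝ) = levelDim u n x := by
  have h1 : (Finset.univ.filter fun z : Fin (2 * u - 1) => (z : ℕ) < u).card = u := by
    rw [Fin.card_filter_val_lt, min_eq_right (by omega)]
  have h2 : (Finset.univ.filter fun z : Fin (2 * u - 1) => u ≤ (z : ℕ)).card = u - 1 := by
    have := Finset.card_filter_add_card_filter_not (s := (Finset.univ : Finset (Fin (2 * u - 1))))
      (fun z : Fin (2 * u - 1) => (z : ℕ) < u)
    simp only [h1, Finset.card_univ, Fintype.card_fin, not_lt] at this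
    omega
  have h3 : (levelSet u n x).card = u ^ x * (u - 1) ^ (n - x) := by
    rw [levelSet, Fintype.card_piFinset, ← prod_ite_lt hx]
    refine Finset.prod_congr rfl fun k _ => ?_
    split_ifs
    · exact h1
    · exact h2
  rw [h3, levelDim]
  push_cast [Nat.cast_sub (show 1 ≤ u by omega)]
  rfl

theorem eq_of_mem_levelSet {u n x y : ℕ} (hx : x ≤ n) (hy : y ≤ n) {z : BatteryIndex u n}
    (h : z ∈ levelSet u n x) (h' : z ∈ levelSet u n y) : x = y := by
  rw [mem_levelSet] at h h'
  rcases lt_trichotomy x y with hlt | heq | hlt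
  · have h1 := h ⟨x, by omega⟩
    have h2 := h' ⟨x, by omega⟩
    simp only [lt_irrefl, if_false, hlt, if_true] at h1 h2
    omega
  · exact heq
  · have h1 := h ⟨y, by omega⟩
    have h2 := h' ⟨y, by omega⟩
    simp only [lt_irrefl, if_false, hlt, if_true] at h1 h2
    omega

theorem levelKet_eq {u n x : ℕ} (hu : 2 ≤ u) (hx : x ≤ n) (z : BatteryIndex u n) :
    levelKet u n x z = if z ∈ levelSet u n x then (((Real.sqrt (levelDim u n x))⁻¹ : ℝ) : ℂ)
      else 0 := by
  have h2 : (2 : ℝ) ≤ u := by exact_mod_cast hu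
  split_ifs with h
  · rw [mem_levelSet] at h
    have h1 : levelKet u n x z = ∏ k : Fin n, if (k : ℕ) < x then
        (((Real.sqrt u)⁻¹ : ℝ) : ℂ) else (((Real.sqrt ((u : ℝ) - 1))⁻¹ : ℝ) : ℂ) := by
      refine Finset.prod_congr rfl fun k _ => ?_
      have := h k
      split_ifs at this ⊢ with hk
      · rw [chargedKet, if_pos this, one_div]
      · rw [dischargedKet, if_pos this, one_div]
    rw [h1, prod_ite_lt hx, levelDim, Real.sqrt_mul (by positivity)]
    have hs : ∀ (a : ℝ) (m : ℕ), 0 ≤ a → Real.sqrt (a ^ m) = Real.sqrt a ^ m := fun a m ha => by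
      rw [Real.sqrt_eq_iff_mul_self_eq (by positivity) (by positivity), ← mul_pow,
        Real.mul_self_sqrt ha]
    rw [hs _ _ (by linarith), hs _ _ (by linarith)]
    push_cast
    rw [mul_inv, inv_pow, inv_pow]
  · rw [mem_levelSet] at h
    push Not at h
    obtain ⟨k, hk⟩ := h
    refine Finset.prod_eq_zero (Finset.mem_univ k) ?_
    split_ifs at hk ⊢
    · rw [chargedKet, if_neg hk]
    · rw [dischargedKet, if_neg hk]

/-- The function on the joint reference basis that takes the value `d i x` on `|i⟩` times the
support of `|c_x⟩`, and vanishes off these supports. -/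
def blockFn {ι R : Type*} [AddCommMonoid R] {u n : ℕ} (d : ι → Fin (n + 1) → R) :
    ι × BatteryIndex u n → R :=
  fun s => ∑ x : Fin (n + 1), if s.2 ∈ levelSet u n x then d s.1 x else 0

section Block

variable {ι R : Type*} [AddCommMonoid R] {u n : ℕ}

theorem blockFn_of_mem (d : ι → Fin (n + 1) → R) (i : ι) {x : Fin (n + 1)}
    {z : BatteryIndex u n} (h : z ∈ levelSet u n x) : blockFn d (i, z) = d i x := by
  rw [blockFn, Finset.sum_eq_single x]
  · simp [h]
  · intro y _ hy
    rw [if_neg]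
    intro h'
    exact hy (Fin.ext (eq_of_mem_levelSet (by omega) (by omega) h' h))
  · simp

theorem blockFn_of_notMem (d : ι → Fin (n + 1) → R) (i : ι)
    {z : BatteryIndex u n} (h : ∀ x : Fin (n + 1), z ∉ levelSet u n x) :
    blockFn d (i, z) = 0 := by
  simp [blockFn, h]

theorem blockFn_map {R' : Type*} [AddCommMonoid R'] (F : R → R') (hF : F 0 = 0)
    (d : ι → Fin (n + 1) → R) (s : ι × BatteryIndex u n) :
    F (blockFn d s) = blockFn (fun i x => F (d i x)) s := by
  obtain ⟨i, z⟩ := s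
  by_cases h : ∃ x : Fin (n + 1), z ∈ levelSet u n x
  · obtain ⟨x, hx⟩ := h
    rw [blockFn_of_mem _ _ hx, blockFn_of_mem _ _ hx]
  · push Not at h
    rw [blockFn_of_notMem _ _ h, blockFn_of_notMem _ _ h, hF]

theorem blockFn_map₂ {R₁ R₂ : Type*} [AddCommMonoid R₁] [AddCommMonoid R₂] (F : R₁ → R₂ → R)
    (hF : F 0 0 = 0) (d : ι → Fin (n + 1) → R₁) (e : ι → Fin (n + 1) → R₂)
    (s : ι × BatteryIndex u n) :
    F (blockFn d s) (blockFn e s) = blockFn (fun i x => F (d i x) (e i x)) s := by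
  obtain ⟨i, z⟩ := s
  by_cases h : ∃ x : Fin (n + 1), z ∈ levelSet u n x
  · obtain ⟨x, hx⟩ := h
    rw [blockFn_of_mem _ _ hx, blockFn_of_mem _ _ hx, blockFn_of_mem _ _ hx]
  · push Not at h
    rw [blockFn_of_notMem _ _ h, blockFn_of_notMem _ _ h, blockFn_of_notMem _ _ h, hF]

theorem sum_blockFn_mul [Fintype ι] (d : ι → Fin (n + 1) → ℝ) (F : ι × BatteryIndex u n → ℝ) :
    ∑ s, blockFn d s * F s = ∑ i, ∑ x : Fin (n + 1), d i x * ∑ z ∈ levelSet u n x, F (i, z) := by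
  rw [Fintype.sum_prod_type]
  refine Finset.sum_congr rfl fun i _ => ?_
  simp only [blockFn, Finset.sum_mul]
  rw [Finset.sum_comm]
  refine Finset.sum_congr rfl fun x _ => ?_
  simp only [ite_mul, zero_mul, ← Finset.sum_filter, Finset.mul_sum]
  refine Finset.sum_congr ?_ fun _ _ => rfl
  ext; simp

theorem sum_blockFn [Fintype ι] (hu : 2 ≤ u) (d : ι → Fin (n + 1) → ℝ) :
    ∑ s : ι × BatteryIndex u n, blockFn d s = ∑ i, ∑ x : Fin (n + 1), levelDim u n x * d i x := by
  have h := sum_blockFn_mul (u := u) d fun _ => 1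
  simp only [mul_one, Finset.sum_const, nsmul_eq_mul] at h
  rw [h]
  refine Finset.sum_congr rfl fun i _ => Finset.sum_congr rfl fun x _ => ?_
  rw [card_levelSet hu (by omega), mul_comm]

theorem sum_blockFn_row (hu : 2 ≤ u) (d : ι → Fin (n + 1) → ℝ) (i : ι) :
    ∑ z : BatteryIndex u n, blockFn d (i, z) = ∑ x : Fin (n + 1), levelDim u n x * d i x := by
  simp only [blockFn]
  rw [Finset.sum_comm]
  refine Finset.sum_congr rfl fun x _ => ?_
  rw [← Finset.sum_filter, Finset.sum_const, nsmul_eq_mul, ← card_levelSet hu (by omega)]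
  congr 3
  ext; simp

end Block

/-! ### Joint kets and projectors in terms of the supports -/

section Joint

variable {ι : Type*} {u n : ℕ}

theorem jointKet_eq_blockFn (hu : 2 ≤ u) (a : ι → Fin (n + 1) → ℂ) :
    jointKet u n a =
      blockFn fun i x => a i x * (((Real.sqrt (levelDim u n x))⁻¹ : ℝ) : ℂ) := by
  ext s
  refine Finset.sum_congr rfl fun x _ => ?_
  rw [levelKet_eq hu (by omega)]
  split_ifs <;> simp

theorem norm_sq_jointKet (hu : 2 ≤ u) (a : ι → Fin (n + 1) → ℂ) (s : ι × BatteryIndex u n) :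
    ‖jointKet u n a s‖ ^ 2 = blockFn (fun i x => ‖a i x‖ ^ 2 / levelDim u n x) s := by
  rw [jointKet_eq_blockFn hu, blockFn_map (fun c : ℂ => ‖c‖ ^ 2) (by simp)]
  congr 1
  ext i x
  rw [norm_mul, mul_pow, Complex.norm_real, norm_inv, inv_pow, Real.norm_eq_abs, sq_abs,
    Real.sq_sqrt (levelDim_pos hu n x).le, div_eq_mul_inv]

theorem jointKet_sub (a b : ι → Fin (n + 1) → ℂ) :
    jointKet u n a - jointKet u n b = jointKet u n (a - b) := by
  ext s
  simp [jointKet, sub_mul, Finset.sum_sub_distrib]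

theorem sum_norm_sq_jointKet [Fintype ι] (hu : 2 ≤ u) (a : ι → Fin (n + 1) → ℂ) :
    ∑ s, ‖jointKet u n a s‖ ^ 2 = ∑ i, ∑ x, ‖a i x‖ ^ 2 := by
  simp only [norm_sq_jointKet hu]
  rw [sum_blockFn hu]
  refine Finset.sum_congr rfl fun i _ => Finset.sum_congr rfl fun x _ => ?_
  rw [mul_div_cancel₀ _ (levelDim_pos hu n x).ne']

theorem tensorKet_batteryKet (v : ι → ℂ) (α : Fin (n + 1) → ℝ) :
    tensorKet v (batteryKet u n α) = jointKet u n fun i x => v i * (Real.sqrt (α x) : ℂ) := by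
  ext s
  simp [tensorKet, batteryKet, jointKet, Finset.mul_sum, mul_assoc]

theorem norm_sq_tensorKet_batteryKet (hu : 2 ≤ u) (v : ι → ℂ) {α : Fin (n + 1) → ℝ}
    (hα : ∀ x, 0 ≤ α x) (s : ι × BatteryIndex u n) :
    ‖tensorKet v (batteryKet u n α) s‖ ^ 2 =
      blockFn (fun i x => ‖v i‖ ^ 2 * α x / levelDim u n x) s := by
  rw [tensorKet_batteryKet, norm_sq_jointKet hu]
  congr 1
  ext i x
  rw [norm_mul, mul_pow, Complex.norm_real, Real.norm_eq_abs, sq_abs, Real.sq_sqrt (hα x)]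

/-- A sequence on the levels, extended by zero to the integers. -/
def extendZero (α : Fin (n + 1) → ℝ) (y : ℤ) : ℝ :=
  if h : 0 ≤ y ∧ y ≤ n then α ⟨y.toNat, by omega⟩ else 0

theorem extendZero_coe (α : Fin (n + 1) → ℝ) (x : Fin (n + 1)) :
    extendZero α ((x : ℕ) : ℤ) = α x := by
  rw [extendZero, dif_pos (by omega)]
  rfl

/-- If no populated level is shifted beyond the top or the bottom, `Γ^k` shifts the coefficients of
the battery state without wrapping around. -/
theorem tensorKet_shiftedBattery (v : ι → ℂ) (α : Fin (n + 1) → ℝ) (k : ℤ)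
    (hk : ∀ x : Fin (n + 1), α x ≠ 0 → 0 ≤ ((x : ℕ) : ℤ) + k ∧ ((x : ℕ) : ℤ) + k ≤ n) :
    tensorKet v (shiftedBattery u n α k) =
      jointKet u n fun i x => v i * (Real.sqrt (extendZero α (((x : ℕ) : ℤ) - k)) : ℂ) := by
  ext s
  simp only [tensorKet, shiftedBattery, jointKet, Finset.mul_sum, mul_assoc]
  have hsupp : ∀ x : Fin (n + 1), ∀ c : ℂ, v s.1 * ((Real.sqrt (α x) : ℂ) * c) ≠ 0 → α x ≠ 0 := by
    intro x c h h0
    simp [h0] at h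
  refine Finset.sum_bij_ne_zero (fun x _ _ => Fin.ofNat (n + 1) (((x : ℕ) : ℤ) + k).toNat)
    (fun _ _ _ => Finset.mem_univ _) ?_ ?_ ?_
  · intro x _ hx y _ hy hxy
    have h1 := hk x (hsupp x _ hx)
    have h2 := hk y (hsupp y _ hy)
    have := congrArg Fin.val hxy
    simp only [Fin.ofNat] at this
    rw [Nat.mod_eq_of_lt (by omega), Nat.mod_eq_of_lt (by omega)] at this
    ext; omega
  · intro y _ hy
    have h0 : extendZero α (((y : ℕ) : ℤ) - k) ≠ 0 := by
      intro h0; simp [h0] at hy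
    have h1 : 0 ≤ ((y : ℕ) : ℤ) - k ∧ ((y : ℕ) : ℤ) - k ≤ n := by
      by_contra h; rw [extendZero, dif_neg h] at h0; exact h0 rfl
    refine ⟨⟨(((y : ℕ) : ℤ) - k).toNat, by omega⟩, Finset.mem_univ _, ?_, ?_⟩
    · have h2 : ((((((y : ℕ) : ℤ) - k).toNat : ℕ) : ℤ) + k) % ((n : ℤ) + 1) = (y : ℕ) := by
        rw [Int.toNat_of_nonneg h1.1, sub_add_cancel]
        exact Int.emod_eq_of_lt (by omega) (by omega)
      rw [extendZero, dif_pos h1] at hy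
      simp only [h2, Int.toNat_natCast]
      exact hy
    · ext
      simp only [Fin.ofNat]
      rw [Nat.mod_eq_of_lt (by omega)]
      omega
  · intro x _ hx
    have h1 := hk x (hsupp x _ hx)
    have h2 : ((Fin.ofNat (n + 1) (((x : ℕ) : ℤ) + k).toNat : Fin (n + 1)) : ℕ) =
        (((x : ℕ) : ℤ) + k).toNat := by
      simp only [Fin.ofNat]
      rw [Nat.mod_eq_of_lt (by omega)]
    rw [h2, Int.emod_eq_of_lt (by omega) (by omega), Int.toNat_of_nonneg h1.1, add_sub_cancel_right,
      extendZero_coe]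

theorem levelProj_eq (hu : 2 ≤ u) {x : ℕ} (hx : x ≤ n) :
    levelProj u n x = Matrix.diagonal fun z => if z ∈ levelSet u n x then (1 : ℂ) else 0 := by
  have hD := levelDim_pos hu n x
  rw [levelProj, levelState, dephase_density, ← Matrix.diagonal_smul]
  congr 1
  ext z
  simp only [Pi.smul_apply, smul_eq_mul]
  rw [levelKet_eq hu hx]
  split_ifs
  · rw [Complex.norm_real, norm_inv, inv_pow, Real.norm_eq_abs, sq_abs, Real.sq_sqrt hD.le]
    have : ((u : ℂ) ^ x * ((u : ℂ) - 1) ^ (n - x)) = (levelDim u n x : ℂ) := by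
      rw [levelDim]; push_cast; rfl
    rw [this, ← Complex.ofReal_mul, mul_inv_cancel₀ hD.ne', Complex.ofReal_one]
  · simp

theorem single_kronecker_diagonal [DecidableEq ι] (j : ι) (f : BatteryIndex u n → ℂ) :
    Matrix.single j j (1 : ℂ) ⊗ₖ Matrix.diagonal f =
      Matrix.diagonal fun s : ι × BatteryIndex u n => if s.1 = j then f s.2 else 0 := by
  rw [← Matrix.diagonal_single, Matrix.diagonal_kronecker_diagonal]
  congr 1
  ext s
  by_cases h : s.1 = j
  · subst h; simp
  · simp [h]

theorem one_kronecker_batteryProj [DecidableEq ι] (hu : 2 ≤ u) :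
    (1 : Matrix ι ι ℂ) ⊗ₖ batteryProj u n = Matrix.diagonal fun s : ι × BatteryIndex u n =>
      ((blockFn (fun _ _ => (1 : ℝ)) s : ℝ) : ℂ) := by
  have h : batteryProj u n = Matrix.diagonal fun z : BatteryIndex u n =>
      ∑ x : Fin (n + 1), if z ∈ levelSet u n x then (1 : ℂ) else 0 := by
    ext z z'
    simp only [batteryProj, Matrix.sum_apply]
    by_cases hz : z = z'
    · subst hz
      simp only [Matrix.diagonal_apply_eq]
      refine Finset.sum_congr rfl fun x _ => ?_
      rw [levelProj_eq hu (by omega), Matrix.diagonal_apply_eq]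
    · rw [Matrix.diagonal_apply_ne _ hz]
      refine Finset.sum_eq_zero fun x _ => ?_
      rw [levelProj_eq hu (by omega), Matrix.diagonal_apply_ne _ hz]
  rw [h, ← Matrix.diagonal_one, Matrix.diagonal_kronecker_diagonal]
  congr 1
  ext s
  simp [blockFn]

end Joint

/-! ### Ideal batteries have almost uniform coefficients -/

theorem exists_perm_of_card_fiber_eq {X : Type*} [Fintype X] [DecidableEq X] (f g : X → ℕ)
    (h : ∀ y, y ≠ 0 → (Finset.univ.filter fun s => f s = y).card =
      (Finset.univ.filter fun s => g s = y).card) :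
    ∃ π : Equiv.Perm X, ∀ s, g (π s) = f s := by
  have h0 : ∀ y, (Finset.univ.filter fun s => f s = y).card =
      (Finset.univ.filter fun s => g s = y).card := by
    intro y
    by_cases hy : y = 0
    · subst hy
      set t : Finset ℕ := insert 0 (Finset.univ.image f ∪ Finset.univ.image g) with ht
      have hf := Finset.card_eq_sum_card_fiberwise (s := (Finset.univ : Finset X)) (f := f) (t := t)
        (fun s _ => by simp [ht])
      have hg := Finset.card_eq_sum_card_fiberwise (s := (Finset.univ : Finset X)) (f := g) (t := t)
        (fun s _ => by simp [ht])
      have ht0 : (0 : ℕ) ∈ t := by simp [ht]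
      rw [← Finset.add_sum_erase _ _ ht0] at hf hg
      have he : ∑ y ∈ t.erase 0, (Finset.univ.filter fun s => f s = y).card =
          ∑ y ∈ t.erase 0, (Finset.univ.filter fun s => g s = y).card :=
        Finset.sum_congr rfl fun y hy => h y (Finset.ne_of_mem_erase hy)
      omega
    · exact h y hy
  have e : ∀ y, {s // f s = y} ≃ {s // g s = y} := fun y =>
    Fintype.equivOfCardEq (by rw [Fintype.card_subtype, Fintype.card_subtype]; exact h0 y)
  exact ⟨Equiv.ofFiberEquiv e, fun s => Equiv.ofFiberEquiv_map e s⟩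

theorem card_fiber_blockFn {ι : Type*} [Fintype ι] [DecidableEq ι] {u n : ℕ} (hu : 2 ≤ u)
    (d : ι → Fin (n + 1) → ℕ) {y : ℕ} (hy : y ≠ 0) :
    ((Finset.univ.filter fun s : ι × BatteryIndex u n => blockFn d s = y).card : ℝ) =
      ∑ i, ∑ x : Fin (n + 1), levelDim u n x * if d i x = y then 1 else 0 := by
  rw [← sum_blockFn hu, Finset.card_filter]
  push_cast
  refine Finset.sum_congr rfl fun s _ => ?_
  exact blockFn_map (fun m : ℕ => if m = y then (1 : ℝ) else 0) (by simp [hy.symm]) d s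

theorem levelDim_succ {u n x : ℕ} (hx : x + 1 ≤ n) :
    (u : ℝ) * levelDim u n x = ((u : ℝ) - 1) * levelDim u n (x + 1) := by
  have h : n - x = (n - (x + 1)) + 1 := by omega
  rw [levelDim, levelDim, h, pow_succ, pow_succ]
  ring

theorem extendZero_of_lt {n : ℕ} (α : Fin (n + 1) → ℝ) {y : ℤ} (h : y < 0) :
    extendZero α y = 0 := by
  rw [extendZero, dif_neg (by omega)]

theorem extendZero_nonneg {n : ℕ} {α : Fin (n + 1) → ℝ} (h : ∀ x, 0 ≤ α x) (y : ℤ) :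
    0 ≤ extendZero α y := by
  rw [extendZero]
  split_ifs
  · exact h _
  · rfl

theorem sum_extendZero_sub_one {n : ℕ} (α : Fin (n + 1) → ℝ) (h : α (Fin.last n) = 0) :
    ∑ y : Fin (n + 1), extendZero α (((y : ℕ) : ℤ) - 1) = ∑ y, α y := by
  rw [Fin.sum_univ_succ, Fin.sum_univ_castSucc α, h, add_zero, extendZero_of_lt _ (by simp),
    zero_add]
  refine Finset.sum_congr rfl fun x _ => ?_
  rw [← extendZero_coe α x.castSucc]
  simp

theorem dephase_partialTrace_density {ι κ : Type*} [DecidableEq ι] [Fintype κ] (v : ι × κ → ℂ) :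
    dephase (partialTraceRight (density v)) =
      Matrix.diagonal fun i => ((∑ y, ‖v (i, y)‖ ^ 2 : ℝ) : ℂ) := by
  unfold dephase
  congr 1
  ext i
  simp [partialTraceRight, density_apply, Complex.mul_conj']

/-- The ket of `u` basis states that is uniform on the first `m` of them. -/
def uniformKet (u m : ℕ) : Fin u → ℂ := fun i =>
  if (i : ℕ) < m then (((Real.sqrt m)⁻¹ : ℝ) : ℂ) else 0

theorem norm_sq_uniformKet (u m : ℕ) (i : Fin u) :
    ‖uniformKet u m i‖ ^ 2 = if (i : ℕ) < m then (m : ℝ)⁻¹ else 0 := by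
  rw [uniformKet]
  split_ifs
  · rw [Complex.norm_real, Real.norm_eq_abs, sq_abs, inv_pow, Real.sq_sqrt (by positivity)]
  · simp

theorem sum_ite_lt {u m : ℕ} (hm : m ≤ u) (a : ℝ) :
    ∑ i : Fin u, (if (i : ℕ) < m then a else 0) = m * a := by
  rw [← Finset.sum_filter, Finset.sum_const, Fin.card_filter_val_lt, min_eq_right hm, nsmul_eq_mul]

theorem isKet_uniformKet {u m : ℕ} (hm : m ≤ u) (hm0 : m ≠ 0) : IsKet (uniformKet u m) := by
  simp only [IsKet, norm_sq_uniformKet]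
  rw [sum_ite_lt hm, mul_inv_cancel₀ (by exact_mod_cast hm0)]

/-- An ideal battery that may change by at least one level has coefficients that hardly vary from
one level to the next. The test transformation discharges the battery into the system: the
uniform superposition of `u` states, and the battery at `|c_x⟩`, is a permutation of the uniform
superposition of `u - 1` states, and the battery at `|c_{x+1}⟩`. -/
theorem IsIdealBattery.variation_le {c : FreeClass} {u n f : ℕ} {α : Fin (n + 1) → ℝ} {ε : ℝ}
    (hu : 2 ≤ u) (hf : 1 ≤ f) (h : IsIdealBattery c u n α f ε) :
    ∑ y : Fin (n + 1), |extendZero α (((y : ℕ) : ℤ) - 1) - α y| ≤ ε := by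
  obtain ⟨hα, hα1, hsupp, hideal⟩ := h
  have hu1 : 1 ≤ u := by omega
  have hcast : ((u - 1 : ℕ) : ℝ) = (u : ℝ) - 1 := by push_cast [Nat.cast_sub hu1]; rfl
  have hlast : α (Fin.last n) = 0 := by
    by_contra h0
    have := (hsupp _ h0).2
    simp only [Fin.val_last] at this
    omega
  set ψ := uniformKet u u with hψ
  set φ := uniformKet u (u - 1) with hφ
  have hψk : IsKet ψ := isKet_uniformKet le_rfl (by omega)
  have hφk : IsKet φ := isKet_uniformKet (by omega) (by omega)
  set Φ := tensorKet φ (shiftedBattery u n α 1) with hΦ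
  have hΦj : Φ = jointKet u n fun i x =>
      φ i * (Real.sqrt (extendZero α (((x : ℕ) : ℤ) - 1)) : ℂ) := by
    refine tensorKet_shiftedBattery φ α 1 fun x hx => ?_
    have := hsupp x hx
    omega
  have hna : ∀ (v : Fin u → ℂ) (i : Fin u) (a : ℝ), 0 ≤ a →
      ‖v i * (Real.sqrt a : ℂ)‖ ^ 2 = ‖v i‖ ^ 2 * a := by
    intro v i a ha
    rw [norm_mul, mul_pow, Complex.norm_real, Real.norm_eq_abs, sq_abs, Real.sq_sqrt ha]
  have hΦn : ∀ s, ‖Φ s‖ ^ 2 = blockFn (fun i x =>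
      ‖φ i‖ ^ 2 * extendZero α (((x : ℕ) : ℤ) - 1) / levelDim u n x) s := by
    intro s
    rw [hΦj, norm_sq_jointKet hu]
    simp only [hna _ _ _ (extendZero_nonneg hα _)]
  have hin : ∀ (v : Fin u → ℂ) s, ‖tensorKet v (batteryKet u n α) s‖ ^ 2 = blockFn (fun i x =>
      ‖v i‖ ^ 2 * α x / levelDim u n x) s :=
    fun v s => norm_sq_tensorKet_batteryKet hu v hα s
  have hrow : ∀ i, ∑ z, ‖Φ (i, z)‖ ^ 2 = ‖φ i‖ ^ 2 := by
    intro i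
    simp only [hΦn]
    rw [sum_blockFn_row hu]
    simp only [mul_div_cancel₀ _ (levelDim_pos hu n _).ne']
    rw [← Finset.mul_sum, sum_extendZero_sub_one α hlast, hα1, mul_one]
  have hΦk : IsKet Φ := by
    rw [IsKet, Fintype.sum_prod_type]
    simp only [hrow]
    exact hφk
  -- the permutation matches `z ∈ levelSet x` with the states of the next level that come with one
  -- of the first `u - 1` system states
  set val : ℕ → ℝ := fun y => if y = 0 then 0 else
    extendZero α ((y : ℤ) - 1) / (u * levelDim u n (y - 1)) with hval
  obtain ⟨π, hπ⟩ := exists_perm_of_card_fiber_eq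
    (blockFn (u := u) (n := n) fun (_ : Fin u) (x : Fin (n + 1)) =>
      if (x : ℕ) < n then (x : ℕ) + 1 else 0)
    (blockFn (u := u) (n := n) fun (i : Fin u) (x : Fin (n + 1)) =>
      if (i : ℕ) < u - 1 then (x : ℕ) else 0) (by
    intro y hy
    have h1 := card_fiber_blockFn (u := u) hu (fun (_ : Fin u) (x : Fin (n + 1)) =>
      if (x : ℕ) < n then (x : ℕ) + 1 else 0) hy
    have h2 := card_fiber_blockFn (u := u) hu (fun (i : Fin u) (x : Fin (n + 1)) =>
      if (i : ℕ) < u - 1 then (x : ℕ) else 0) hy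
    rw [← Nat.cast_inj (R := ℝ)]
    · refine h1.trans (Eq.trans ?_ h2.symm)
      have hL : ∀ i : Fin u, ∑ x : Fin (n + 1), levelDim u n x *
          (if (if (x : ℕ) < n then (x : ℕ) + 1 else 0) = y then (1 : ℝ) else 0) =
          if y ≤ n then levelDim u n (y - 1) else 0 := by
        intro _
        split_ifs with hyn
        · rw [Finset.sum_eq_single ⟨y - 1, by omega⟩]
          · rw [if_pos, mul_one]
            rw [if_pos (by simp only; omega)]
            simp only; omega
          · intro x _ hx
            rw [if_neg, mul_zero]
            intro h3
            apply hx
            ext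
            simp only
            split_ifs at h3 <;> omega
          · simp
        · refine Finset.sum_eq_zero fun x _ => ?_
          rw [if_neg, mul_zero]
          split_ifs <;> omega
      have hR : ∀ i : Fin u, ∑ x : Fin (n + 1), levelDim u n x *
          (if (if (i : ℕ) < u - 1 then (x : ℕ) else 0) = y then (1 : ℝ) else 0) =
          if (i : ℕ) < u - 1 then (if y ≤ n then levelDim u n y else 0) else 0 := by
        intro i
        by_cases hi : (i : ℕ) < u - 1
        · simp only [hi, if_true]
          split_ifs with hyn
          · rw [Finset.sum_eq_single ⟨y, by omega⟩]
            · simp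
            · intro x _ hx
              rw [if_neg, mul_zero]
              intro h3
              exact hx (Fin.ext h3)
            · simp
          · refine Finset.sum_eq_zero fun x _ => ?_
            rw [if_neg, mul_zero]
            omega
        · simp only [hi, if_false, if_neg hy.symm, mul_zero, Finset.sum_const_zero]
      rw [Finset.sum_congr rfl fun i _ => hL i, Finset.sum_congr rfl fun i _ => hR i,
        sum_ite_lt (by omega), Finset.sum_const, Finset.card_univ, Fintype.card_fin,
        nsmul_eq_mul, hcast]
      split_ifs with hyn
      · have := levelDim_succ (u := u) (n := n) (x := y - 1) (by omega)
        rwa [Nat.sub_add_cancel (by omega)] at this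
      · simp)
  have hv1 : ∀ s, ‖tensorKet ψ (batteryKet u n α) s‖ ^ 2 = val (blockFn (u := u) (n := n)
      (fun (_ : Fin u) (x : Fin (n + 1)) => if (x : ℕ) < n then (x : ℕ) + 1 else 0) s) := by
    intro s
    rw [hin, blockFn_map val (by simp [hval])]
    congr 1
    ext i x
    rw [hψ, norm_sq_uniformKet, if_pos i.2]
    by_cases hx : (x : ℕ) < n
    · simp only [hx, if_true, hval, Nat.add_eq_zero_iff, one_ne_zero, and_false, if_false,
        Nat.add_sub_cancel]
      have : (((x : ℕ) + 1 : ℕ) : ℤ) - 1 = ((x : ℕ) : ℤ) := by push_cast; ring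
      rw [this, extendZero_coe, inv_mul_eq_div, div_div]
    · have : x = Fin.last n := Fin.ext (by simp only [Fin.val_last]; omega)
      subst this
      simp [hlast, hval]
  have hv2 : ∀ s, ‖Φ s‖ ^ 2 = val (blockFn (u := u) (n := n)
      (fun (i : Fin u) (x : Fin (n + 1)) => if (i : ℕ) < u - 1 then (x : ℕ) else 0) s) := by
    intro s
    rw [hΦn, blockFn_map val (by simp [hval])]
    congr 1
    ext i x
    rw [hφ, norm_sq_uniformKet]
    by_cases hi : (i : ℕ) < u - 1
    · simp only [hi, if_true, hval]
      split_ifs with hx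
      · rw [extendZero_of_lt _ (by omega)]; simp
      · have := levelDim_succ (u := u) (n := n) (x := (x : ℕ) - 1) (by omega)
        rw [Nat.sub_add_cancel (by omega)] at this
        rw [this, hcast, inv_mul_eq_div, div_div]
    · simp [hi, hval]
  have hperm : ∀ s, ‖tensorKet ψ (batteryKet u n α) s‖ = ‖Φ (π s)‖ := by
    intro s
    rw [← sq_eq_sq₀ (norm_nonneg _) (norm_nonneg _), hv1, hv2, hπ]
  have hmain := hideal u ψ φ (fun k => if k = 1 then φ else 0) Φ hψk hφk hΦk
    (by rw [Finset.sum_ite_eq' (Finset.Icc (-(f : ℤ)) f) 1 fun _ => φ,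
          if_pos (by rw [Finset.mem_Icc]; omega)])
    (by
      rw [Finset.sum_eq_single 1]
      · simp [hΦ]
      · intro k _ hk
        ext s
        simp [hk, tensorKet]
      · intro h1
        exact absurd (Finset.mem_Icc.2 ⟨by omega, by omega⟩) h1)
    (by
      rw [dephase_partialTrace_density, dephase_density]
      simp only [hrow])
    (converts_of_perm c _ _ π hperm)
    (converts_of_perm c _ _ π⁻¹ fun s => by rw [hperm (π⁻¹ s), Equiv.Perm.inv_def,
      Equiv.apply_symm_apply])
  refine le_trans (le_of_eq ?_) ((sum_abs_norm_sq_sub_le _ _).trans hmain)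
  have hdiag : ∀ s, |‖Φ s‖ ^ 2 - ‖tensorKet φ (batteryKet u n α) s‖ ^ 2| =
      blockFn (fun i x => ‖φ i‖ ^ 2 * |extendZero α (((x : ℕ) : ℤ) - 1) - α x| /
        levelDim u n x) s := by
    intro s
    rw [hΦn, hin, blockFn_map₂ (fun a b : ℝ => |a - b|) (by simp)]
    congr 1
    ext i x
    rw [← sub_div, ← mul_sub, abs_div, abs_mul, abs_of_pos (levelDim_pos hu n x),
      abs_of_nonneg (sq_nonneg _)]
  simp only [hdiag]
  rw [sum_blockFn hu]
  simp only [mul_div_cancel₀ _ (levelDim_pos hu n _).ne']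
  simp only [← Finset.mul_sum]
  rw [← Finset.sum_mul, show ∑ i, ‖φ i‖ ^ 2 = 1 from hφk, one_mul]

/-! ### The classical transition weights of a unital map -/

section Mix

theorem diagonal_ofReal_injective {X : Type*} [DecidableEq X] {d e : X → ℝ}
    (h : (Matrix.diagonal fun s => (d s : ℂ)) = Matrix.diagonal fun s => (e s : ℂ)) : d = e := by
  ext s
  have := congrFun (Matrix.diagonal_injective h) s
  exact_mod_cast this

variable {X : Type*} [Fintype X] [DecidableEq X]

/-- The action of `permMix r` on diagonal matrices. -/
def mixFn (r : Equiv.Perm X → ℝ) (d : X → ℝ) : X → ℝ := fun s => ∑ π : Equiv.Perm X, r π * d (π s)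

theorem permMix_diagonal_ofReal (r : Equiv.Perm X → ℝ) (d : X → ℝ) :
    permMix r (Matrix.diagonal fun s => (d s : ℂ)) =
      Matrix.diagonal fun s => ((mixFn r d s : ℝ) : ℂ) := by
  rw [permMix_diagonal]
  congr 1
  ext s
  simp [mixFn]

theorem mixFn_nonneg {r : Equiv.Perm X → ℝ} (hr : ∀ π, 0 ≤ r π) {d : X → ℝ} (hd : ∀ s, 0 ≤ d s)
    (s : X) : 0 ≤ mixFn r d s :=
  Finset.sum_nonneg fun π _ => mul_nonneg (hr π) (hd _)

theorem mixFn_mono {r : Equiv.Perm X → ℝ} (hr : ∀ π, 0 ≤ r π) {d e : X → ℝ}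
    (hde : ∀ s, d s ≤ e s) (s : X) : mixFn r d s ≤ mixFn r e s :=
  Finset.sum_le_sum fun π _ => mul_le_mul_of_nonneg_left (hde _) (hr π)

theorem sum_mixFn {r : Equiv.Perm X → ℝ} (hr : ∑ π, r π = 1) (d : X → ℝ) :
    ∑ s, mixFn r d s = ∑ s, d s := by
  simp only [mixFn]
  rw [Finset.sum_comm]
  simp only [← Finset.mul_sum]
  have : ∀ π : Equiv.Perm X, ∑ s, d (π s) = ∑ s, d s := fun π => Equiv.sum_comp π d
  simp only [this]
  rw [← Finset.sum_mul, hr, one_mul]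

theorem mixFn_sum {κ : Type*} (t : Finset κ) (r : Equiv.Perm X → ℝ) (d : κ → X → ℝ) (s : X) :
    mixFn r (fun s => ∑ k ∈ t, d k s) s = ∑ k ∈ t, mixFn r (d k) s := by
  simp only [mixFn, Finset.mul_sum]
  rw [Finset.sum_comm]

theorem mixFn_const_mul (r : Equiv.Perm X → ℝ) (a : ℝ) (d : X → ℝ) (s : X) :
    mixFn r (fun s => a * d s) s = a * mixFn r d s := by
  simp only [mixFn, Finset.mul_sum]
  exact Finset.sum_congr rfl fun π _ => by ring

/-- Mixtures of permutations are contractions for the `ℓ¹` norm. -/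
theorem sum_abs_mixFn_sub_le {r : Equiv.Perm X → ℝ} (hr : ∀ π, 0 ≤ r π) (hr1 : ∑ π, r π = 1)
    (d e : X → ℝ) : ∑ s, |mixFn r d s - mixFn r e s| ≤ ∑ s, |d s - e s| := by
  rw [← sum_mixFn hr1 fun s => |d s - e s|]
  refine Finset.sum_le_sum fun s _ => ?_
  simp only [mixFn]
  rw [← Finset.sum_sub_distrib]
  refine (Finset.abs_sum_le_sum_abs _ _).trans (Finset.sum_le_sum fun π _ => ?_)
  rw [← mul_sub, abs_mul, abs_of_nonneg (hr π)]

end Mix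

section Transfer

variable {ι : Type*} [Fintype ι] [DecidableEq ι] {u n : ℕ}

/-- The indicator function of `|j⟩` times the support of `|c_x⟩`. -/
def blockInd (u n : ℕ) (j : ι) (x : ℕ) : ι × BatteryIndex u n → ℝ :=
  fun s => if s.1 = j ∧ s.2 ∈ levelSet u n x then 1 else 0

/-- The weight `Tr[(|i⟩⟨i| ⊗ Π^x) ℰ(|j⟩⟨j| ⊗ Π^x')]` that a unital map transfers from the block
`(j, x')` to the block `(i, x)`. -/
def transfer (r : Equiv.Perm (ι × BatteryIndex u n) → ℝ) (i : ι) (x : ℕ) (j : ι) (x' : ℕ) : ℝ :=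
  ∑ z ∈ levelSet u n x, mixFn r (blockInd u n j x') (i, z)

theorem single_kronecker_levelProj {κ : Type*} [DecidableEq κ] (hu : 2 ≤ u) (j : κ) {x : ℕ}
    (hx : x ≤ n) :
    Matrix.single j j (1 : ℂ) ⊗ₖ levelProj u n x =
      Matrix.diagonal fun s => ((blockInd u n j x s : ℝ) : ℂ) := by
  rw [levelProj_eq hu hx, single_kronecker_diagonal]
  congr 1
  ext s
  by_cases h : s.1 = j <;> by_cases h' : s.2 ∈ levelSet u n x <;> simp [blockInd, h, h']

theorem trace_levelProj_mul (hu : 2 ≤ u) (i : ι) {x : ℕ} (hx : x ≤ n)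
    (g : ι × BatteryIndex u n → ℝ) :
    ((Matrix.single i i (1 : ℂ) ⊗ₖ levelProj u n x) * Matrix.diagonal fun s => (g s : ℂ)).trace =
      ((∑ z ∈ levelSet u n x, g (i, z) : ℝ) : ℂ) := by
  rw [single_kronecker_levelProj hu i hx, Matrix.diagonal_mul_diagonal, Matrix.trace_diagonal,
    Fintype.sum_prod_type, Finset.sum_eq_single i]
  · simp only [blockInd, true_and, ← Complex.ofReal_mul, ite_mul, one_mul, zero_mul]
    rw [← Complex.ofReal_sum, ← Finset.sum_filter]
    congr 2
    ext; simp
  · intro j _ hj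
    simp [blockInd, hj]
  · simp

theorem trace_transfer (hu : 2 ≤ u) (r : Equiv.Perm (ι × BatteryIndex u n) → ℝ) (i j : ι)
    {x x' : ℕ} (hx : x ≤ n) (hx' : x' ≤ n) :
    ((Matrix.single i i (1 : ℂ) ⊗ₖ levelProj u n x) *
      permMix r (Matrix.single j j (1 : ℂ) ⊗ₖ levelProj u n x')).trace =
      ((transfer r i x j x' : ℝ) : ℂ) := by
  rw [single_kronecker_levelProj hu j hx', permMix_diagonal_ofReal, trace_levelProj_mul hu i hx]
  rfl

theorem transfer_nonneg {r : Equiv.Perm (ι × BatteryIndex u n) → ℝ} (hr : ∀ π, 0 ≤ r π)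
    (i : ι) (x : ℕ) (j : ι) (x' : ℕ) : 0 ≤ transfer r i x j x' :=
  Finset.sum_nonneg fun z _ => mixFn_nonneg hr (fun s => by
    rw [blockInd]; split_ifs <;> norm_num) _

theorem sum_mul_blockInd (d : ι → Fin (n + 1) → ℝ) (s : ι × BatteryIndex u n) :
    ∑ j, ∑ x : Fin (n + 1), d j x * blockInd u n j x s = blockFn d s := by
  rw [Finset.sum_eq_single s.1]
  · simp [blockInd, blockFn]
  · intro j _ hj
    simp [blockInd, hj.symm]
  · simp

/-- The image of a function of block form, summed over a block. -/
theorem sum_mul_transfer (r : Equiv.Perm (ι × BatteryIndex u n) → ℝ) (d : ι → Fin (n + 1) → ℝ)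
    (i : ι) (x : ℕ) :
    ∑ j, ∑ x' : Fin (n + 1), d j x' * transfer r i x j x' =
      ∑ z ∈ levelSet u n x, mixFn r (blockFn d) (i, z) := by
  have h : ∀ z, mixFn r (blockFn d) (i, z) =
      ∑ j, ∑ x' : Fin (n + 1), d j x' * mixFn r (blockInd u n j x') (i, z) := by
    intro z
    have : (blockFn d : ι × BatteryIndex u n → ℝ) =
        fun s => ∑ j, ∑ x : Fin (n + 1), d j x * blockInd u n j x s := by
      ext s; rw [sum_mul_blockInd]
    rw [this, mixFn_sum]
    refine Finset.sum_congr rfl fun j _ => ?_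
    rw [mixFn_sum]
    exact Finset.sum_congr rfl fun x' _ => mixFn_const_mul _ _ _ _
  simp only [h, transfer, Finset.mul_sum]
  rw [Finset.sum_comm]
  conv_rhs => rw [Finset.sum_comm]
  rw [Finset.sum_comm]
  refine Finset.sum_congr rfl fun j _ => ?_
  rw [Finset.sum_comm]

theorem sum_blockInd (hu : 2 ≤ u) (j : ι) (x : Fin (n + 1)) :
    ∑ s, blockInd u n j x s = levelDim u n x := by
  rw [← card_levelSet hu (by omega : (x : ℕ) ≤ n), Fintype.sum_prod_type, Finset.sum_eq_single j]
  · simp [blockInd]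
  · intro i _ hi
    simp [blockInd, hi]
  · simp

theorem blockInd_le (j : ι) (x : Fin (n + 1)) (s : ι × BatteryIndex u n) :
    blockInd u n j x s ≤ blockFn (fun _ _ => (1 : ℝ)) s := by
  rw [← sum_mul_blockInd]
  have h0 : ∀ j x, 0 ≤ blockInd u n j x s := fun j x => by
    rw [blockInd]; split_ifs <;> norm_num
  simp only [one_mul]
  exact (Finset.single_le_sum (f := fun x : Fin (n + 1) => blockInd u n j x s)
    (fun y _ => h0 j y) (Finset.mem_univ x)).trans
    (Finset.single_le_sum (f := fun j => ∑ x : Fin (n + 1), blockInd u n j x s)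
      (fun k _ => Finset.sum_nonneg fun y _ => h0 k y) (Finset.mem_univ j))

/-- Total weight received by a block, for a map that preserves the support of the battery. -/
theorem sum_transfer_right (hu : 2 ≤ u) {r : Equiv.Perm (ι × BatteryIndex u n) → ℝ}
    (hinv : mixFn r (blockFn fun _ _ => 1) = blockFn fun _ _ => 1) (i : ι) (x : Fin (n + 1)) :
    ∑ j, ∑ x' : Fin (n + 1), transfer r i x j x' = levelDim u n x := by
  have h := sum_mul_transfer r (fun _ _ => 1) i x
  simp only [one_mul] at h
  rw [h, hinv, ← card_levelSet hu (by omega : (x : ℕ) ≤ n), Finset.sum_congr rfl fun z hz =>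
    blockFn_of_mem _ i (x := x) hz]
  simp

/-- Total weight sent by a block, for a map that preserves the support of the battery. -/
theorem sum_transfer_left (hu : 2 ≤ u) {r : Equiv.Perm (ι × BatteryIndex u n) → ℝ}
    (hr : ∀ π, 0 ≤ r π) (hr1 : ∑ π, r π = 1)
    (hinv : mixFn r (blockFn fun _ _ => 1) = blockFn fun _ _ => 1) (j : ι) (x' : Fin (n + 1)) :
    ∑ i, ∑ x : Fin (n + 1), transfer r i x j x' = levelDim u n x' := by
  have h := sum_blockFn_mul (u := u) (n := n) (fun (_ : ι) _ => (1 : ℝ))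
    (mixFn r (blockInd u n j x'))
  simp only [one_mul] at h
  have h0 : ∀ s, 0 ≤ blockInd u n j x' s := fun s => by
    rw [blockInd]; split_ifs <;> norm_num
  calc _ = ∑ s, blockFn (fun _ _ => (1 : ℝ)) s * mixFn r (blockInd u n j x') s := h.symm
    _ = ∑ s, mixFn r (blockInd u n j x') s := by
        refine Finset.sum_congr rfl fun s => fun _ => ?_
        obtain ⟨i, z⟩ := s
        by_cases hz : ∃ x : Fin (n + 1), z ∈ levelSet u n x
        · obtain ⟨x, hx⟩ := hz
          rw [blockFn_of_mem _ _ hx, one_mul]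
        · push Not at hz
          -- nothing is sent off the support
          have h1 := mixFn_mono hr (blockInd_le (u := u) j x') (i, z)
          rw [hinv, blockFn_of_notMem _ _ hz] at h1
          rw [le_antisymm h1 (mixFn_nonneg hr h0 _), mul_zero]
    _ = _ := by rw [sum_mixFn hr1, sum_blockInd hu]

/-! ### Moments of the conditional distribution -/

theorem sum_mul_eq_linearCombination (g : ℝ → ℝ) (P : ℝ →₀ ℝ) :
    (P.sum fun w a => a * g w) = Finsupp.linearCombination ℝ g P := by
  simp [Finsupp.linearCombination_apply]

theorem sum_eq_linearCombination (P : ℝ →₀ ℝ) :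
    (P.sum fun _ a => a) = Finsupp.linearCombination ℝ (fun _ => (1 : ℝ)) P := by
  simp [Finsupp.linearCombination_apply]

theorem Protocol.cond_eq (hu : 2 ≤ u) (S : Protocol ι u n) (hα : ∀ x, 0 ≤ S.α x) (i j : ι) :
    S.cond i j = ∑ x' : Fin (n + 1), ∑ x : Fin (n + 1),
      Finsupp.single ((((x' : ℕ) : ℝ) - ((x : ℕ) : ℝ)) * quid u)
        (S.α x' / levelDim u n x' * transfer S.r i x j x') := by
  unfold Protocol.cond
  refine Finset.sum_congr rfl fun x' _ => Finset.sum_congr rfl fun x _ => ?_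
  congr 1
  have hb : ∀ z, ‖batteryKet u n S.α z‖ ^ 2 =
      blockFn (fun (_ : Unit) x => S.α x / levelDim u n x) ((), z) := by
    intro z
    have h1 : batteryKet u n S.α z =
        jointKet u n (fun (_ : Unit) x => (Real.sqrt (S.α x) : ℂ)) ((), z) := rfl
    rw [h1, norm_sq_jointKet hu]
    congr 1
    ext _ x
    rw [Complex.norm_real, Real.norm_eq_abs, sq_abs, Real.sq_sqrt (hα x)]
  have h : Matrix.single j j (1 : ℂ) ⊗ₖ (levelProj u n x' *
      dephase (density (batteryKet u n S.α)) * levelProj u n x') =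
      Matrix.diagonal fun s : ι × BatteryIndex u n =>
        ((S.α x' / levelDim u n x' * blockInd u n j x' s : ℝ) : ℂ) := by
    rw [levelProj_eq hu (by omega), dephase_density, Matrix.diagonal_mul_diagonal,
      Matrix.diagonal_mul_diagonal, single_kronecker_diagonal]
    congr 1
    ext s
    by_cases h1 : s.1 = j
    · by_cases h2 : s.2 ∈ levelSet u n x'
      · simp only [h1, if_true, h2, one_mul, mul_one, blockInd, and_self]
        rw [hb, blockFn_of_mem _ _ h2]
      · simp [h2, blockInd]
    · simp [h1, blockInd]
  rw [h, Protocol.unital, permMix_diagonal_ofReal, trace_levelProj_mul hu i (by omega),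
    Complex.ofReal_re]
  simp only [mixFn_const_mul]
  rw [← Finset.mul_sum]
  rfl

theorem Protocol.linearCombination_cond (hu : 2 ≤ u) (S : Protocol ι u n) (hα : ∀ x, 0 ≤ S.α x)
    (i j : ι) (g : ℝ → ℝ) :
    Finsupp.linearCombination ℝ g (S.cond i j) = ∑ x' : Fin (n + 1), ∑ x : Fin (n + 1),
      S.α x' / levelDim u n x' * transfer S.r i x j x' *
        g ((((x' : ℕ) : ℝ) - ((x : ℕ) : ℝ)) * quid u) := by
  rw [S.cond_eq hu hα]
  simp only [map_sum, Finsupp.linearCombination_single, smul_eq_mul]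

theorem quid_pos {u : ℕ} (hu : 2 ≤ u) : 0 < quid u := by
  have h : (2 : ℝ) ≤ u := by exact_mod_cast hu
  refine Real.log_pos ?_
  rw [one_lt_div (by linarith)]
  linarith

theorem exp_quid {u : ℕ} (hu : 2 ≤ u) : Real.exp (quid u) = (u : ℝ) / ((u : ℝ) - 1) := by
  have h : (2 : ℝ) ≤ u := by exact_mod_cast hu
  exact Real.exp_log (div_pos (by linarith) (by linarith))

theorem levelDim_eq {u n x : ℕ} (hu : 2 ≤ u) (hx : x ≤ n) :
    levelDim u n x = ((u : ℝ) - 1) ^ n * Real.exp (x * quid u) := by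
  have h : (2 : ℝ) ≤ u := by exact_mod_cast hu
  have h1 : (u : ℝ) - 1 ≠ 0 := by linarith
  rw [Real.exp_nat_mul, exp_quid hu, levelDim, div_pow, mul_div_assoc', mul_comm,
    mul_div_right_comm]
  congr 1
  rw [eq_div_iff (pow_ne_zero _ h1), ← pow_add, Nat.sub_add_cancel hx]

theorem levelDim_mul_exp {u n x x' : ℕ} (hu : 2 ≤ u) (hx : x ≤ n) (hx' : x' ≤ n) :
    levelDim u n x * Real.exp (((x' : ℝ) - x) * quid u) = levelDim u n x' := by
  rw [levelDim_eq hu hx, levelDim_eq hu hx', mul_assoc, ← Real.exp_add]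
  congr 2
  ring

end Transfer

/-! ### Sums of differences of a slowly varying sequence -/

theorem sum_abs_shift_le (a : ℕ → ℝ) (n : ℕ) (ha : ∀ x, n < x → a x = 0) (k : ℕ) :
    ∑ x ∈ Finset.range (n + 1), |a (x + k) - a x| ≤
      k * ∑ x ∈ Finset.range (n + 1), |a (x + 1) - a x| := by
  induction k with
  | zero => simp
  | succ k ih =>
    have h1 : ∑ x ∈ Finset.range (n + 1), |a (x + k + 1) - a (x + k)| ≤
        ∑ x ∈ Finset.range (n + 1), |a (x + 1) - a x| := by
      calc _ = ∑ x ∈ Finset.Ico k (k + (n + 1)), |a (x + 1) - a x| := by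
            rw [Finset.sum_Ico_eq_sum_range, Nat.add_sub_cancel_left]
            refine Finset.sum_congr rfl fun x _ => ?_
            rw [add_comm k x]
        _ ≤ ∑ x ∈ Finset.range (k + (n + 1)), |a (x + 1) - a x| := by
            refine Finset.sum_le_sum_of_subset_of_nonneg ?_ fun _ _ _ => abs_nonneg _
            rw [Finset.range_eq_Ico]
            exact Finset.Ico_subset_Ico_left (Nat.zero_le k)
        _ = _ := by
            refine (Finset.sum_subset (Finset.range_mono (by omega)) fun x _ hx => ?_).symm
            rw [Finset.mem_range] at hx
            rw [ha x (by omega), ha (x + 1) (by omega), sub_zero, abs_zero]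
    calc _ ≤ ∑ x ∈ Finset.range (n + 1), (|a (x + k + 1) - a (x + k)| + |a (x + k) - a x|) := by
          refine Finset.sum_le_sum fun x _ => ?_
          rw [show x + (k + 1) = x + k + 1 by ring]
          exact abs_sub_le _ _ _
      _ ≤ _ := by
          rw [Finset.sum_add_distrib]
          push_cast
          linarith

/-- The differences between all pairs of terms at distance at most `f` are controlled by the
differences between neighbours: there are `2 * k` ways to choose such a pair, at distance `k`,
around a given neighbouring pair. -/
theorem sum_abs_sub_le_of_near (a : ℕ → ℝ) (n f : ℕ) (ha : ∀ x, n < x → a x = 0) :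
    ∑ x : Fin (n + 1), ∑ x' : Fin (n + 1),
      (if |((x' : ℕ) : ℤ) - ((x : ℕ) : ℤ)| ≤ f then |a x' - a x| else 0) ≤
      ((f : ℝ) * (f + 1)) * ∑ x ∈ Finset.range (n + 1), |a (x + 1) - a x| := by
  set V := ∑ x ∈ Finset.range (n + 1), |a (x + 1) - a x| with hV
  have hup : ∀ k : ℕ, ∑ x : Fin (n + 1), ∑ x' : Fin (n + 1),
      (if (x' : ℕ) = (x : ℕ) + k then |a x' - a x| else 0) ≤ k * V := by
    intro k
    refine le_trans ?_ (sum_abs_shift_le a n ha k)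
    rw [← Fin.sum_univ_eq_sum_range (fun x => |a (x + k) - a x|)]
    refine Finset.sum_le_sum fun x _ => ?_
    rw [Fin.sum_univ_eq_sum_range
      (fun x' => if x' = (x : ℕ) + k then |a x' - a x| else 0), Finset.sum_ite_eq']
    split_ifs
    · rfl
    · exact abs_nonneg _
  calc _ ≤ ∑ x : Fin (n + 1), ∑ x' : Fin (n + 1), ∑ k ∈ Finset.range f,
        ((if (x' : ℕ) = (x : ℕ) + (k + 1) then |a x' - a x| else 0) +
          (if (x : ℕ) = (x' : ℕ) + (k + 1) then |a x - a x'| else 0)) := by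
        refine Finset.sum_le_sum fun x _ => Finset.sum_le_sum fun x' _ => ?_
        have hnn : ∀ k ∈ Finset.range f, 0 ≤
            ((if (x' : ℕ) = (x : ℕ) + (k + 1) then |a x' - a x| else 0) +
              (if (x : ℕ) = (x' : ℕ) + (k + 1) then |a x - a x'| else 0)) := by
          intro k _
          split_ifs <;> positivity
        split_ifs with h
        · rw [abs_le] at h
          rcases lt_trichotomy (x : ℕ) (x' : ℕ) with hlt | heq | hlt
          · refine le_trans ?_ (Finset.single_le_sum hnn
              (Finset.mem_range.2 (show (x' : ℕ) - (x : ℕ) - 1 < f by omega)))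
            rw [if_pos (by omega), if_neg (by omega), add_zero]
          · refine le_trans (le_of_eq ?_) (Finset.sum_nonneg hnn)
            rw [heq, sub_self, abs_zero]
          · refine le_trans ?_ (Finset.single_le_sum hnn
              (Finset.mem_range.2 (show (x : ℕ) - (x' : ℕ) - 1 < f by omega)))
            rw [if_neg (by omega), if_pos (by omega), zero_add, abs_sub_comm]
        · exact Finset.sum_nonneg hnn
    _ = ∑ k ∈ Finset.range f,
        ((∑ x : Fin (n + 1), ∑ x' : Fin (n + 1),
            (if (x' : ℕ) = (x : ℕ) + (k + 1) then |a x' - a x| else 0)) +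
          ∑ x' : Fin (n + 1), ∑ x : Fin (n + 1),
            (if (x : ℕ) = (x' : ℕ) + (k + 1) then |a x - a x'| else 0)) := by
        simp only [Finset.sum_add_distrib]
        have hswap : ∀ F : Fin (n + 1) → Fin (n + 1) → ℕ → ℝ,
            ∑ x, ∑ x', ∑ k ∈ Finset.range f, F x x' k =
              ∑ k ∈ Finset.range f, ∑ x, ∑ x', F x x' k := by
          intro F
          rw [Finset.sum_congr rfl fun x _ => Finset.sum_comm]
          exact Finset.sum_comm
        rw [hswap, hswap]
        congr 1
        exact Finset.sum_congr rfl fun k _ => Finset.sum_comm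
    _ ≤ ∑ k ∈ Finset.range f, (((k + 1 : ℕ) : ℝ) * V + ((k + 1 : ℕ) : ℝ) * V) :=
        Finset.sum_le_sum fun k _ => add_le_add (hup _) (hup _)
    _ = _ := by
        clear_value V
        clear hup hV
        induction f with
        | zero => simp
        | succ f ih => rw [Finset.sum_range_succ, ih]; push_cast; ring

/-! ### Necessity for a finite battery -/

/-- The variation is at most `min ε 2`, being bounded both by `ε` and by twice the total weight. -/
theorem IsIdealBattery.variation_le_sqrt {c : FreeClass} {u n f : ℕ} {α : Fin (n + 1) → ℝ} {ε : ℝ}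
    (hu : 2 ≤ u) (hf : 1 ≤ f) (hε : 0 ≤ ε) (h : IsIdealBattery c u n α f ε) :
    ∑ x ∈ Finset.range (n + 1),
      |extendZero α ((x + 1 : ℕ) : ℤ) - extendZero α ((x : ℕ) : ℤ)| ≤ Real.sqrt (8 * ε) := by
  have hV := h.variation_le hu hf
  obtain ⟨hα, hα1, hsupp, -⟩ := h
  have hlast : α (Fin.last n) = 0 := by
    by_contra h0
    have := (hsupp _ h0).2
    simp only [Fin.val_last] at this
    omega
  have hV2 : ∑ y : Fin (n + 1), |extendZero α (((y : ℕ) : ℤ) - 1) - α y| ≤ 2 := by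
    calc _ ≤ ∑ y : Fin (n + 1), (extendZero α (((y : ℕ) : ℤ) - 1) + α y) := by
          refine Finset.sum_le_sum fun y _ => ?_
          have := extendZero_nonneg hα (((y : ℕ) : ℤ) - 1)
          rw [abs_le]
          constructor <;> linarith [hα y]
      _ = 2 := by
          rw [Finset.sum_add_distrib, sum_extendZero_sub_one α hlast, hα1]; norm_num
  have hle : ∑ x ∈ Finset.range (n + 1),
      |extendZero α ((x + 1 : ℕ) : ℤ) - extendZero α ((x : ℕ) : ℤ)| ≤
      ∑ y : Fin (n + 1), |extendZero α (((y : ℕ) : ℤ) - 1) - α y| := by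
    rw [Finset.sum_range_succ, Fin.sum_univ_succ]
    have h1 : extendZero α ((n + 1 : ℕ) : ℤ) = 0 := by rw [extendZero, dif_neg (by omega)]
    have h2 : extendZero α (n : ℤ) = 0 := by
      have := extendZero_coe α (Fin.last n)
      rw [Fin.val_last] at this
      rw [this, hlast]
    have h3 : ∑ i : Fin n, |extendZero α (((i.succ : ℕ) : ℤ) - 1) - α i.succ| =
        ∑ x ∈ Finset.range n,
          |extendZero α ((x + 1 : ℕ) : ℤ) - extendZero α ((x : ℕ) : ℤ)| := by
      rw [← Fin.sum_univ_eq_sum_range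
        (fun x => |extendZero α ((x + 1 : ℕ) : ℤ) - extendZero α ((x : ℕ) : ℤ)|)]
      refine Finset.sum_congr rfl fun i _ => ?_
      rw [← extendZero_coe α i.succ, abs_sub_comm]
      simp
    rw [h1, h2, h3, sub_zero, abs_zero, add_zero]
    exact le_add_of_nonneg_left (abs_nonneg _)
  refine Real.le_sqrt_of_sq_le ?_
  have h0 : 0 ≤ ∑ x ∈ Finset.range (n + 1),
      |extendZero α ((x + 1 : ℕ) : ℤ) - extendZero α ((x : ℕ) : ℤ)| :=
    Finset.sum_nonneg fun _ _ => abs_nonneg _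
  nlinarith

section

variable {ι : Type*} [Fintype ι] [DecidableEq ι] {u n : ℕ} {S : Protocol ι u n} {c : FreeClass}
  {wmax ε : ℝ} {ψ φ : ι → ℂ}

/-- On diagonals, the invariance of `1 ⊗ 𝔹` says that the mixture of permutations preserves the
union of all blocks. -/
theorem Protocol.Realises.mixFn_support (hu : 2 ≤ u) (h : S.Realises c wmax ε ψ φ) :
    mixFn S.r (blockFn (u := u) (n := n) fun (_ : ι) _ => (1 : ℝ)) = blockFn fun _ _ => 1 := by
  have h1 := h.support_invariant
  rw [one_kronecker_batteryProj hu, Protocol.unital, permMix_diagonal_ofReal] at h1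
  exact diagonal_ofReal_injective h1

theorem Protocol.Realises.transfer_eq_zero (hu : 2 ≤ u) (h : S.Realises c wmax ε ψ φ) (i j : ι)
    (x x' : Fin (n + 1)) (hx : (maxStep wmax u : ℤ) < |((x' : ℕ) : ℤ) - ((x : ℕ) : ℤ)|) :
    transfer S.r i x j x' = 0 := by
  have h1 := h.bounded_step i j x x' hx
  rw [Protocol.unital, trace_transfer hu _ _ _ (by omega) (by omega)] at h1
  exact_mod_cast h1

theorem Protocol.Realises.cond_nonneg (hu : 2 ≤ u) (h : S.Realises c wmax ε ψ φ) (i j : ι)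
    (w : ℝ) : 0 ≤ S.cond i j w := by
  rw [S.cond_eq hu h.ideal.1, Finsupp.finsetSum_apply]
  refine Finset.sum_nonneg fun x' _ => ?_
  rw [Finsupp.finsetSum_apply]
  refine Finset.sum_nonneg fun x _ => ?_
  rw [Finsupp.single_apply]
  split_ifs
  · exact mul_nonneg (div_nonneg (h.ideal.1 _) (levelDim_pos hu _ _).le)
      (transfer_nonneg h.weight_nonneg _ _ _ _)
  · rfl

theorem Protocol.Realises.totalMass_cond (hu : 2 ≤ u) (h : S.Realises c wmax ε ψ φ) (j : ι) :
    totalMass S.cond j = 1 := by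
  simp only [totalMass, sum_eq_linearCombination, S.linearCombination_cond hu h.ideal.1, mul_one]
  rw [Finset.sum_comm, ← h.ideal.2.1]
  refine Finset.sum_congr rfl fun x' _ => ?_
  simp only [← Finset.mul_sum]
  rw [sum_transfer_left hu h.weight_nonneg h.weight_sum (h.mixFn_support hu),
    div_mul_cancel₀ _ (levelDim_pos hu _ _).ne']

theorem Protocol.Realises.epsilon_nonneg (h : S.Realises c wmax ε ψ φ) : 0 ≤ ε :=
  (traceNorm_nonneg _).trans h.final_close

/-- Weighting a transition from level `x'` to level `x` by `e^w` turns the normalisation by the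
size of the initial block into the normalisation by the size of the final one. The exponential
moment thus differs from the total weight received by the final blocks only by the variation of
the battery coefficients over at most `f` levels. -/
theorem Protocol.Realises.abs_expMass_sub_one_le (hu : 2 ≤ u) (h : S.Realises c wmax ε ψ φ)
    (i : ι) : |expMass S.cond i - 1| ≤
      Real.sqrt (8 * ε) * ((maxStep wmax u : ℝ) * ((maxStep wmax u : ℝ) + 1)) := by
  set f := maxStep wmax u with hf
  set t : Fin (n + 1) → Fin (n + 1) → ℝ := fun x x' =>
    (∑ j, transfer S.r i x j x') / levelDim u n x with ht
  have hD := levelDim_pos hu n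
  have ht0 : ∀ x x', 0 ≤ t x x' := fun x x' =>
    div_nonneg (Finset.sum_nonneg fun j _ => transfer_nonneg h.weight_nonneg _ _ _ _) (hD _).le
  have ht1 : ∀ x, ∑ x', t x x' = 1 := by
    intro x
    simp only [ht]
    rw [← Finset.sum_div, Finset.sum_comm, sum_transfer_right hu (h.mixFn_support hu),
      div_self (hD _).ne']
  have htle : ∀ x x', t x x' ≤ 1 := fun x x' => by
    rw [← ht1 x]
    exact Finset.single_le_sum (fun y _ => ht0 x y) (Finset.mem_univ x')
  have htz : ∀ x x' : Fin (n + 1), ¬ |((x' : ℕ) : ℤ) - ((x : ℕ) : ℤ)| ≤ f → t x x' = 0 := by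
    intro x x' hx
    simp only [ht]
    rw [Finset.sum_eq_zero fun j _ => h.transfer_eq_zero hu i j x x' (not_le.1 hx), zero_div]
  have hexp : expMass S.cond i = ∑ x, ∑ x', S.α x' * t x x' := by
    simp only [expMass, sum_mul_eq_linearCombination, S.linearCombination_cond hu h.ideal.1]
    have hterm : ∀ (j : ι) (x' x : Fin (n + 1)),
        S.α x' / levelDim u n x' * transfer S.r i x j x' *
          Real.exp ((((x' : ℕ) : ℝ) - ((x : ℕ) : ℝ)) * quid u) =
        S.α x' * (transfer S.r i x j x' / levelDim u n x) := by
      intro j x' x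
      have h1 := levelDim_mul_exp (u := u) (n := n) (x := x) (x' := x') hu (by omega) (by omega)
      have h2 := (hD x).ne'
      have h3 := (hD x').ne'
      rw [← h1] at h3 ⊢
      have h4 := Real.exp_ne_zero ((((x' : ℕ) : ℝ) - ((x : ℕ) : ℝ)) * quid u)
      field_simp
    simp only [hterm, ht]
    rw [Finset.sum_comm, Finset.sum_comm (f := fun x x' : Fin (n + 1) =>
      S.α x' * ((∑ j, transfer S.r i x j x') / levelDim u n x))]
    refine Finset.sum_congr rfl fun x' _ => ?_
    rw [Finset.sum_comm]
    refine Finset.sum_congr rfl fun x _ => ?_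
    rw [← Finset.mul_sum, Finset.sum_div]
  have hone : (1 : ℝ) = ∑ x, ∑ x', S.α x * t x x' := by
    simp only [← Finset.mul_sum, ht1, mul_one]
    exact h.ideal.2.1.symm
  set a : ℕ → ℝ := fun x => extendZero S.α ((x : ℕ) : ℤ) with ha
  have haα : ∀ x : Fin (n + 1), a x = S.α x := extendZero_coe S.α
  have ha0 : ∀ x, n < x → a x = 0 := by
    intro x hx
    simp only [ha]
    rw [extendZero, dif_neg (by omega)]
  calc |expMass S.cond i - 1| = |∑ x, ∑ x', (S.α x' - S.α x) * t x x'| := by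
        conv_lhs => rw [hexp, hone]
        simp only [sub_mul, Finset.sum_sub_distrib]
    _ ≤ ∑ x, ∑ x', |(S.α x' - S.α x) * t x x'| :=
        (Finset.abs_sum_le_sum_abs _ _).trans
          (Finset.sum_le_sum fun x _ => Finset.abs_sum_le_sum_abs _ _)
    _ ≤ ∑ x : Fin (n + 1), ∑ x' : Fin (n + 1),
        (if |((x' : ℕ) : ℤ) - ((x : ℕ) : ℤ)| ≤ f then |a x' - a x| else 0) := by
        refine Finset.sum_le_sum fun x _ => Finset.sum_le_sum fun x' _ => ?_
        rw [abs_mul, abs_of_nonneg (ht0 x x'), haα, haα]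
        split_ifs with hx
        · exact mul_le_of_le_one_right (abs_nonneg _) (htle x x')
        · rw [htz x x' hx, mul_zero]
    _ ≤ ((f : ℝ) * (f + 1)) * ∑ x ∈ Finset.range (n + 1), |a (x + 1) - a x| :=
        sum_abs_sub_le_of_near a n f ha0
    _ ≤ _ := by
        rcases Nat.eq_zero_or_pos f with h0 | hpos
        · simp [h0]
        · rw [mul_comm]
          exact mul_le_mul_of_nonneg_right
            (h.ideal.variation_le_sqrt hu hpos h.epsilon_nonneg) (by positivity)

theorem Protocol.Realises.norm_sq_initialKet (h : S.Realises c wmax ε ψ φ) :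
    (fun s => ‖S.initialKet s‖ ^ 2) = mixFn S.r fun s => ‖S.finalKet s‖ ^ 2 := by
  have h1 := h.majorised
  rw [dephase_density, dephase_density, Protocol.unital,
    permMix_diagonal_ofReal S.r fun s => ‖S.finalKet s‖ ^ 2] at h1
  exact diagonal_ofReal_injective (d := fun s => ‖S.initialKet s‖ ^ 2) h1

/-- The system marginal of the image of `Δ(φ ⊗ λ)` is the row marginal, and that of `Δ(ψ ⊗ λ)` is
`diagCoeff ψ`; each of the approximations `Φ ≈ φ ⊗ λ` and `Ψ ≈ ψ ⊗ λ` contributes one `ε`. -/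
theorem Protocol.Realises.sum_abs_rowMarginal_sub_le (hu : 2 ≤ u) (h : S.Realises c wmax ε ψ φ) :
    ∑ i, |rowMarginal S.cond (diagCoeff φ) i - diagCoeff ψ i| ≤ 2 * ε := by
  have hD := levelDim_pos hu n
  set dφ : ι × BatteryIndex u n → ℝ := fun s => ‖tensorKet φ (batteryKet u n S.α) s‖ ^ 2 with hdφ
  set dψ : ι × BatteryIndex u n → ℝ := fun s => ‖tensorKet ψ (batteryKet u n S.α) s‖ ^ 2 with hdψ
  have hφ : dφ = blockFn fun j x => ‖φ j‖ ^ 2 * S.α x / levelDim u n x :=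
    funext fun s => norm_sq_tensorKet_batteryKet hu φ h.ideal.1 s
  have hψ : dψ = blockFn fun j x => ‖ψ j‖ ^ 2 * S.α x / levelDim u n x :=
    funext fun s => norm_sq_tensorKet_batteryKet hu ψ h.ideal.1 s
  have hrow : ∀ i, rowMarginal S.cond (diagCoeff φ) i =
      ∑ x : Fin (n + 1), ∑ z ∈ levelSet u n x, mixFn S.r dφ (i, z) := by
    intro i
    simp only [rowMarginal, sum_mul_eq_linearCombination (fun _ => diagCoeff φ _),
      S.linearCombination_cond hu h.ideal.1]
    rw [hφ]
    simp only [← sum_mul_transfer]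
    conv_rhs => rw [Finset.sum_comm]
    refine Finset.sum_congr rfl fun j _ => ?_
    conv_rhs => rw [Finset.sum_comm]
    refine Finset.sum_congr rfl fun x' _ => Finset.sum_congr rfl fun x _ => ?_
    rw [diagCoeff]
    ring
  have hcol : ∀ i, diagCoeff ψ i = ∑ x : Fin (n + 1), ∑ z ∈ levelSet u n x, dψ (i, z) := by
    intro i
    rw [hψ]
    have : ∀ x : Fin (n + 1), ∑ z ∈ levelSet u n x,
        blockFn (fun j x => ‖ψ j‖ ^ 2 * S.α x / levelDim u n x) (i, z) = ‖ψ i‖ ^ 2 * S.α x := by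
      intro x
      rw [Finset.sum_congr rfl fun z hz => blockFn_of_mem _ i (x := x) hz, Finset.sum_const,
        nsmul_eq_mul, card_levelSet hu (by omega), mul_div_cancel₀ _ (hD x).ne']
    simp only [this]
    rw [← Finset.mul_sum, h.ideal.2.1, mul_one, diagCoeff]
  have hblock := sum_blockFn_mul (u := u) (n := n) (fun (_ : ι) _ => (1 : ℝ))
    (fun s => |mixFn S.r dφ s - dψ s|)
  simp only [one_mul] at hblock
  calc _ ≤ ∑ i, ∑ x : Fin (n + 1), ∑ z ∈ levelSet u n x, |mixFn S.r dφ (i, z) - dψ (i, z)| := by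
        refine Finset.sum_le_sum fun i _ => ?_
        rw [hrow, hcol]
        simp only [← Finset.sum_sub_distrib]
        exact (Finset.abs_sum_le_sum_abs _ _).trans
          (Finset.sum_le_sum fun x _ => Finset.abs_sum_le_sum_abs _ _)
    _ = ∑ s, blockFn (fun _ _ => (1 : ℝ)) s * |mixFn S.r dφ s - dψ s| := hblock.symm
    _ ≤ ∑ s, |mixFn S.r dφ s - dψ s| := by
        refine Finset.sum_le_sum fun s _ => mul_le_of_le_one_left (abs_nonneg _) ?_
        obtain ⟨i, z⟩ := s
        by_cases hz : ∃ x : Fin (n + 1), z ∈ levelSet u n x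
        · obtain ⟨x, hx⟩ := hz
          rw [blockFn_of_mem _ _ hx]
        · push Not at hz
          rw [blockFn_of_notMem _ _ hz]
          exact zero_le_one
    _ ≤ ∑ s, (|mixFn S.r dφ s - mixFn S.r (fun s => ‖S.finalKet s‖ ^ 2) s| +
          |‖S.initialKet s‖ ^ 2 - dψ s|) := by
        refine Finset.sum_le_sum fun s _ => ?_
        rw [← h.norm_sq_initialKet]
        exact abs_sub_le _ _ _
    _ ≤ ε + ε := by
        rw [Finset.sum_add_distrib]
        refine add_le_add ?_ ((sum_abs_norm_sq_sub_le _ _).trans h.initial_close)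
        refine (sum_abs_mixFn_sub_le h.weight_nonneg h.weight_sum _ _).trans ?_
        refine le_trans (le_of_eq ?_) ((sum_abs_norm_sq_sub_le _ _).trans h.final_close)
        exact Finset.sum_congr rfl fun s _ => abs_sub_comm _ _
    _ = 2 * ε := by ring

end

/-! ### Necessity in the limit of ideal batteries -/

theorem linearCombination_eq_sum (g : ℝ → ℝ) (P : ℝ →₀ ℝ) :
    Finsupp.linearCombination ℝ g P = ∑ w ∈ P.support, P w * g w := by
  rw [Finsupp.linearCombination_apply]
  rfl

theorem linearCombination_mono {P : ℝ →₀ ℝ} (hP : ∀ w, 0 ≤ P w) {g h : ℝ → ℝ}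
    (hgh : ∀ w, P w ≠ 0 → g w ≤ h w) :
    Finsupp.linearCombination ℝ g P ≤ Finsupp.linearCombination ℝ h P := by
  rw [linearCombination_eq_sum, linearCombination_eq_sum]
  exact Finset.sum_le_sum fun w hw =>
    mul_le_mul_of_nonneg_left (hgh w (Finsupp.mem_support_iff.1 hw)) (hP w)

theorem linearCombination_nonneg {P : ℝ →₀ ℝ} (hP : ∀ w, 0 ≤ P w) {g : ℝ → ℝ}
    (hg : ∀ w, P w ≠ 0 → 0 ≤ g w) : 0 ≤ Finsupp.linearCombination ℝ g P := by
  rw [linearCombination_eq_sum]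
  exact Finset.sum_nonneg fun w hw => mul_nonneg (hP w) (hg w (Finsupp.mem_support_iff.1 hw))

/-- A continuous function that is `1` at `a` and `0` at the other points of a finite set. -/
def hat (s : Finset ℝ) (a : ℝ) : C(ℝ, ℝ) where
  toFun w := ∏ b ∈ s.erase a, min 1 (|w - b| / |a - b|)
  continuous_toFun := by fun_prop

theorem hat_nonneg (s : Finset ℝ) (a w : ℝ) : 0 ≤ hat s a w :=
  Finset.prod_nonneg fun b _ => le_min zero_le_one (by positivity)

theorem hat_apply {s : Finset ℝ} (a : ℝ) {b : ℝ} (hb : b ∈ s) :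
    hat s a b = if b = a then 1 else 0 := by
  change ∏ c ∈ s.erase a, min 1 (|b - c| / |a - c|) = _
  split_ifs with h
  · subst h
    refine Finset.prod_eq_one fun c hc => ?_
    rw [div_self, min_self]
    exact abs_ne_zero.2 (sub_ne_zero.2 (Finset.ne_of_mem_erase hc).symm)
  · exact Finset.prod_eq_zero (Finset.mem_erase.2 ⟨h, hb⟩) (by simp)

section Limit

variable {ι : Type*} [Fintype ι]

theorem totalMass_eq (P : ι → ι → ℝ →₀ ℝ) (j : ι) :
    totalMass P j = ∑ i, Finsupp.linearCombination ℝ (fun _ => (1 : ℝ)) (P i j) := by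
  simp only [totalMass, sum_eq_linearCombination]

theorem expMass_eq (P : ι → ι → ℝ →₀ ℝ) (i : ι) :
    expMass P i = ∑ j, Finsupp.linearCombination ℝ Real.exp (P i j) := by
  simp only [expMass, sum_mul_eq_linearCombination]

theorem rowMarginal_eq (P : ι → ι → ℝ →₀ ℝ) (q : ι → ℝ) (i : ι) :
    rowMarginal P q i = ∑ j, q j * Finsupp.linearCombination ℝ (fun _ => (1 : ℝ)) (P i j) := by
  simp only [rowMarginal]
  refine Finset.sum_congr rfl fun j _ => ?_
  rw [linearCombination_eq_sum, Finsupp.sum, Finset.mul_sum]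
  exact Finset.sum_congr rfl fun w _ => by ring

theorem linearCombination_coherenceMarginal (P : ι → ι → ℝ →₀ ℝ) (q : ι → ℝ) (g : ℝ → ℝ) :
    Finsupp.linearCombination ℝ g (coherenceMarginal P q) =
      ∑ i, ∑ j, q j * Finsupp.linearCombination ℝ g (P i j) := by
  simp only [coherenceMarginal, map_sum, map_smul, smul_eq_mul]

/-- Limits of uniformly bounded conditional distributions. Along an ultrafilter, the moments of
all continuous functions converge, which defines positive functionals `M i j`. For `q j > 0` the
functional `M i j` is concentrated on the atoms of the limiting distribution `Pw`, hence is a finite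
sum of point evaluations. For `q j = 0` there is no control on the support, but only the mass and
the exponential moment of `M i j` matter, and these are those of a single atom. -/
theorem exists_conditions_of_tendsto (p q : ι → ℝ) (hq : ∀ j, 0 ≤ q j)
    (Q : ℕ → ι → ι → ℝ →₀ ℝ) (hQ : ∀ N i j w, 0 ≤ Q N i j w)
    (hmass : ∀ N j, totalMass (Q N) j = 1)
    (hexp : ∀ i, Tendsto (fun N => expMass (Q N) i) atTop (𝓝 1))
    (hmarg : ∀ i, Tendsto (fun N => rowMarginal (Q N) q i) atTop (𝓝 (p i)))
    (wmax : ℝ) (hbd : ∀ N i j w, Q N i j w ≠ 0 → |w| ≤ wmax) (Pw : ℝ →₀ ℝ)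
    (hconv : ∀ g : ℝ → ℝ, Continuous g →
      Tendsto (fun N => Finsupp.linearCombination ℝ g (coherenceMarginal (Q N) q)) atTop
        (𝓝 (Finsupp.linearCombination ℝ g Pw))) :
    ∃ P : ι → ι → ℝ →₀ ℝ, Conditions p q P ∧ coherenceMarginal P q = Pw := by
  set 𝒰 : Ultrafilter ℕ := Filter.hyperfilter ℕ with h𝒰
  have h𝒰le : (𝒰 : Filter ℕ) ≤ atTop := Nat.hyperfilter_le_atTop
  simp only [totalMass_eq, expMass_eq, rowMarginal_eq, linearCombination_coherenceMarginal] at *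
  have hmass1 : ∀ N i j, Finsupp.linearCombination ℝ (fun _ => (1 : ℝ)) (Q N i j) ≤ 1 := by
    intro N i j
    refine le_trans ?_ (hmass N j).le
    exact Finset.single_le_sum
      (f := fun i => Finsupp.linearCombination ℝ (fun _ => (1 : ℝ)) (Q N i j))
      (fun i _ => linearCombination_nonneg (hQ N i j) fun _ _ => zero_le_one) (Finset.mem_univ i)
  have hlim : ∀ i j (g : C(ℝ, ℝ)), ∃ m, Tendsto
      (fun N => Finsupp.linearCombination ℝ g (Q N i j)) 𝒰 (𝓝 m) := by
    intro i j g
    obtain ⟨C, hC⟩ := (isCompact_Icc (a := -wmax) (b := wmax)).exists_bound_of_continuousOn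
      g.continuous.continuousOn
    have hC' : ∀ N w, Q N i j w ≠ 0 → |g w| ≤ |C| := fun N w hw =>
      (hC w (abs_le.1 (hbd N i j w hw))).trans (le_abs_self C)
    have hconst : ∀ N (c : ℝ), Finsupp.linearCombination ℝ (fun _ => c) (Q N i j) =
        c * Finsupp.linearCombination ℝ (fun _ => (1 : ℝ)) (Q N i j) := by
      intro N c
      rw [linearCombination_eq_sum, linearCombination_eq_sum, Finset.mul_sum]
      exact Finset.sum_congr rfl fun w _ => by ring
    have hmem : ∀ N, Finsupp.linearCombination ℝ g (Q N i j) ∈ Set.Icc (-|C|) |C| := by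
      intro N
      have hup := linearCombination_mono (hQ N i j) (g := g) (h := fun _ => |C|)
        fun w hw => (abs_le.1 (hC' N w hw)).2
      have hlo := linearCombination_mono (hQ N i j) (g := fun _ => -|C|) (h := g)
        fun w hw => (abs_le.1 (hC' N w hw)).1
      rw [hconst] at hup hlo
      have h1 := hmass1 N i j
      have h2 := abs_nonneg C
      constructor <;> nlinarith
    obtain ⟨m, -, hm⟩ := (isCompact_Icc (a := -|C|) (b := |C|)).ultrafilter_le_nhds
      (𝒰.map fun N => Finsupp.linearCombination ℝ g (Q N i j))
      (by
        rw [Ultrafilter.coe_map, le_principal_iff, mem_map]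
        exact Filter.univ_mem' hmem)
    exact ⟨m, hm⟩
  choose M hM using hlim
  set e : C(ℝ, ℝ) := ⟨Real.exp, Real.continuous_exp⟩ with he
  have hmono : ∀ i j (g h : C(ℝ, ℝ)), (∀ w, |w| ≤ wmax → g w ≤ h w) → M i j g ≤ M i j h :=
    fun i j g h hgh => le_of_tendsto_of_tendsto' (hM i j g) (hM i j h) fun N =>
      linearCombination_mono (hQ N i j) fun w hw => hgh w (hbd N i j w hw)
  have hsmul : ∀ i j (c : ℝ) (g : C(ℝ, ℝ)), M i j (c • g) = c * M i j g := by
    intro i j c g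
    refine tendsto_nhds_unique (hM i j (c • g)) (((hM i j g).const_mul c).congr fun N => ?_)
    rw [linearCombination_eq_sum, linearCombination_eq_sum, Finset.mul_sum]
    exact Finset.sum_congr rfl fun w _ => by
      rw [ContinuousMap.smul_apply, smul_eq_mul]; ring
  have hsub : ∀ i j (g h : C(ℝ, ℝ)), M i j (g - h) = M i j g - M i j h := by
    intro i j g h
    refine tendsto_nhds_unique (hM i j (g - h)) (((hM i j g).sub (hM i j h)).congr fun N => ?_)
    rw [linearCombination_eq_sum, linearCombination_eq_sum, linearCombination_eq_sum,
      ← Finset.sum_sub_distrib]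
    exact Finset.sum_congr rfl fun w _ => by
      rw [ContinuousMap.sub_apply]; ring
  have hsum : ∀ i j (s : Finset ℝ) (g : ℝ → C(ℝ, ℝ)),
      M i j (∑ a ∈ s, g a) = ∑ a ∈ s, M i j (g a) := by
    intro i j s g
    refine tendsto_nhds_unique (hM i j (∑ a ∈ s, g a))
      ((tendsto_finsetSum s fun a _ => hM i j (g a)).congr fun N => ?_)
    simp only [linearCombination_eq_sum]
    rw [Finset.sum_comm]
    refine Finset.sum_congr rfl fun w _ => ?_
    rw [ContinuousMap.sum_apply, Finset.mul_sum]
  have hM0 : ∀ i j (g : C(ℝ, ℝ)), (∀ w, 0 ≤ g w) → 0 ≤ M i j g := by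
    intro i j g hg
    exact ge_of_tendsto' (hM i j g) fun N => linearCombination_nonneg (hQ N i j) fun w _ => hg w
  have hmassM : ∀ j, ∑ i, M i j 1 = 1 := by
    intro j
    refine tendsto_nhds_unique (tendsto_finsetSum Finset.univ fun i _ => hM i j 1) ?_
    exact tendsto_const_nhds.congr fun N => (hmass N j).symm
  have hexpM : ∀ i, ∑ j, M i j e = 1 := fun i =>
    tendsto_nhds_unique (tendsto_finsetSum Finset.univ fun j _ => hM i j e)
      ((hexp i).mono_left h𝒰le)
  have hmargM : ∀ i, ∑ j, q j * M i j 1 = p i := fun i =>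
    tendsto_nhds_unique (tendsto_finsetSum Finset.univ fun j _ => (hM i j 1).const_mul (q j))
      ((hmarg i).mono_left h𝒰le)
  have hconvM : ∀ g : C(ℝ, ℝ), ∑ i, ∑ j, q j * M i j g = Finsupp.linearCombination ℝ g Pw :=
    fun g => tendsto_nhds_unique (tendsto_finsetSum Finset.univ fun i _ =>
      tendsto_finsetSum Finset.univ fun j _ => (hM i j g).const_mul (q j))
      ((hconv g g.continuous).mono_left h𝒰le)
  -- for `q j > 0`, the functional `M i j` only sees the values at the atoms of `Pw`
  have hconc : ∀ i j, q j ≠ 0 → ∀ g : C(ℝ, ℝ), (∀ a ∈ Pw.support, g a = 0) → M i j g = 0 := by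
    intro i j hj g hg
    have habs : M i j |g| = 0 := by
      have h1 : ∑ i, ∑ j, q j * M i j |g| = 0 := by
        rw [hconvM, linearCombination_eq_sum]
        exact Finset.sum_eq_zero fun a ha => by
          rw [ContinuousMap.abs_apply, hg a ha, abs_zero, mul_zero]
      have hnn : ∀ i j, 0 ≤ q j * M i j |g| := fun i j =>
        mul_nonneg (hq j) (hM0 i j _ fun w => by rw [ContinuousMap.abs_apply]; exact abs_nonneg _)
      rw [Finset.sum_eq_zero_iff_of_nonneg fun i _ => Finset.sum_nonneg fun j _ => hnn i j] at h1
      have h2 := h1 i (Finset.mem_univ i)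
      rw [Finset.sum_eq_zero_iff_of_nonneg fun j _ => hnn i j] at h2
      exact (mul_eq_zero.1 (h2 j (Finset.mem_univ j))).resolve_left hj
    have hup := hmono i j g |g| fun w _ => by
      rw [ContinuousMap.abs_apply]; exact le_abs_self _
    have hlo := hmono i j ((-1 : ℝ) • |g|) g fun w _ => by
      rw [ContinuousMap.smul_apply, ContinuousMap.abs_apply, smul_eq_mul]
      linarith [neg_abs_le (g w)]
    rw [hsmul, habs] at hlo
    rw [habs] at hup
    linarith
  have hatoms : ∀ i j, q j ≠ 0 → ∀ g : C(ℝ, ℝ),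
      M i j g = ∑ a ∈ Pw.support, g a * M i j (hat Pw.support a) := by
    intro i j hj g
    have h1 := hconc i j hj (g - ∑ a ∈ Pw.support, g a • hat Pw.support a) fun b hb => by
      rw [ContinuousMap.sub_apply, ContinuousMap.sum_apply]
      simp only [ContinuousMap.smul_apply, hat_apply _ hb, smul_eq_mul, mul_ite, mul_one, mul_zero]
      rw [Finset.sum_ite_eq, if_pos hb, sub_self]
    rw [hsub, hsum] at h1
    simp only [hsmul] at h1
    linarith
  set P : ι → ι → ℝ →₀ ℝ := fun i j =>
    if q j = 0 then Finsupp.single (Real.log (M i j e / M i j 1)) (M i j 1)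
    else ∑ a ∈ Pw.support, Finsupp.single a (M i j (hat Pw.support a)) with hP
  have hPatoms : ∀ i j, q j ≠ 0 → ∀ g : C(ℝ, ℝ),
      Finsupp.linearCombination ℝ g (P i j) = M i j g := by
    intro i j hj g
    simp only [hP, if_neg hj]
    rw [hatoms i j hj g, map_sum]
    exact Finset.sum_congr rfl fun a _ => by
      rw [Finsupp.linearCombination_single, smul_eq_mul, mul_comm]
  have hPone : ∀ i j, Finsupp.linearCombination ℝ (fun _ => (1 : ℝ)) (P i j) = M i j 1 := by
    intro i j
    by_cases hj : q j = 0
    · simp only [hP, if_pos hj]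
      rw [Finsupp.linearCombination_single, smul_eq_mul, mul_one]
    · exact hPatoms i j hj 1
  have hPexp : ∀ i j, Finsupp.linearCombination ℝ Real.exp (P i j) = M i j e := by
    intro i j
    by_cases hj : q j = 0
    · simp only [hP, if_pos hj]
      rw [Finsupp.linearCombination_single, smul_eq_mul]
      have hlo := hmono i j (Real.exp (-wmax) • 1) e fun w hw => by
        rw [ContinuousMap.smul_apply, ContinuousMap.one_apply, smul_eq_mul, mul_one]
        exact Real.exp_le_exp.2 (abs_le.1 hw).1
      have hup := hmono i j e (Real.exp wmax • 1) fun w hw => by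
        rw [ContinuousMap.smul_apply, ContinuousMap.one_apply, smul_eq_mul, mul_one]
        exact Real.exp_le_exp.2 (abs_le.1 hw).2
      rw [hsmul] at hlo hup
      rcases (hM0 i j 1 fun w => zero_le_one).eq_or_lt with h0 | hpos
      · rw [← h0, mul_zero] at hlo hup
        rw [← h0, zero_mul]
        linarith
      · have h1 : 0 < M i j e := lt_of_lt_of_le (mul_pos (Real.exp_pos _) hpos) hlo
        rw [Real.exp_log (div_pos h1 hpos), mul_div_cancel₀ _ hpos.ne']
    · exact hPatoms i j hj e
  refine ⟨P, ⟨fun i j w => ?_, fun j => ?_, fun i => ?_, fun i => ?_⟩, ?_⟩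
  · simp only [hP]
    split_ifs with hj
    · rw [Finsupp.single_apply]
      split_ifs
      · exact hM0 i j 1 fun w => zero_le_one
      · rfl
    · rw [Finsupp.finsetSum_apply]
      refine Finset.sum_nonneg fun a _ => ?_
      rw [Finsupp.single_apply]
      split_ifs
      · exact hM0 i j _ (hat_nonneg _ _)
      · rfl
  · simp only [totalMass_eq, hPone, hmassM]
  · simp only [expMass_eq, hPexp, hexpM]
  · simp only [rowMarginal_eq, hPone, hmargM]
  · have h1 : ∀ i j, q j • P i j =
        ∑ a ∈ Pw.support, Finsupp.single a (q j * M i j (hat Pw.support a)) := by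
      intro i j
      by_cases hj : q j = 0
      · simp [hj]
      · simp only [hP, if_neg hj, Finset.smul_sum, Finsupp.smul_single, smul_eq_mul]
    have h2 : ∀ a ∈ Pw.support, ∑ i, ∑ j, q j * M i j (hat Pw.support a) = Pw a := by
      intro a ha
      rw [hconvM, linearCombination_eq_sum, Finset.sum_eq_single a]
      · rw [hat_apply _ ha, if_pos rfl, mul_one]
      · intro b hb hba
        rw [hat_apply _ hb, if_neg hba, mul_zero]
      · exact fun h => absurd ha h
    calc coherenceMarginal P q = ∑ a ∈ Pw.support,
          Finsupp.single a (∑ i, ∑ j, q j * M i j (hat Pw.support a)) := by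
          simp only [coherenceMarginal, h1, Finsupp.single_finsetSum]
          rw [Finset.sum_congr rfl fun i _ => Finset.sum_comm]
          rw [Finset.sum_comm]
      _ = ∑ a ∈ Pw.support, Finsupp.single a (Pw a) :=
          Finset.sum_congr rfl fun a ha => by rw [h2 a ha]
      _ = Pw := Finsupp.sum_single Pw

end Limit

theorem Protocol.Realises.abs_le_of_cond_ne_zero {ι : Type*} [Fintype ι] [DecidableEq ι]
    {u n : ℕ} {S : Protocol ι u n} {c : FreeClass} {wmax ε : ℝ} {ψ φ : ι → ℂ} (hu : 2 ≤ u)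
    (hw : 0 < wmax) (h : S.Realises c wmax ε ψ φ) (i j : ι) (w : ℝ) (hne : S.cond i j w ≠ 0) :
    |w| ≤ wmax := by
  rw [S.cond_eq hu h.ideal.1, Finsupp.finsetSum_apply] at hne
  obtain ⟨x', -, h1⟩ := Finset.exists_ne_zero_of_sum_ne_zero hne
  rw [Finsupp.finsetSum_apply] at h1
  obtain ⟨x, -, h2⟩ := Finset.exists_ne_zero_of_sum_ne_zero h1
  rw [Finsupp.single_apply] at h2
  split_ifs at h2 with hx
  · have h3 : |((x' : ℕ) : ℤ) - ((x : ℕ) : ℤ)| ≤ maxStep wmax u := by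
      by_contra hlt
      rw [h.transfer_eq_zero hu i j x x' (not_le.1 hlt), mul_zero] at h2
      exact h2 rfl
    have hq := quid_pos hu
    have h4 : |((x' : ℕ) : ℝ) - ((x : ℕ) : ℝ)| ≤ maxStep wmax u := by exact_mod_cast h3
    have h5 : (maxStep wmax u : ℝ) ≤ wmax / quid u := Nat.floor_le (div_pos hw hq).le
    rw [← hx, abs_mul, abs_of_pos hq]
    calc _ ≤ wmax / quid u * quid u := mul_le_mul_of_nonneg_right (h4.trans h5) hq.le
      _ = wmax := div_mul_cancel₀ _ hq.ne'
  · exact absurd rfl h2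

theorem Implements.exists_conditions {ι : Type*} [Fintype ι] [DecidableEq ι] {c : FreeClass}
    {ψ φ : ι → ℂ} {u : ℕ → ℕ} {Pw : ℝ →₀ ℝ} (hu : ∀ N, 2 ≤ u N) (h : Implements c ψ φ u Pw) :
    ∃ P : ι → ι → ℝ →₀ ℝ, Conditions (diagCoeff ψ) (diagCoeff φ) P ∧
      coherenceMarginal P (diagCoeff φ) = Pw := by
  obtain ⟨wmax, ε, n, S, hw, hS, hε, herr, hconv⟩ := h
  refine exists_conditions_of_tendsto (diagCoeff ψ) (diagCoeff φ) (fun j => sq_nonneg _)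
    (fun N => (S N).cond)
    (fun N => (hS N).cond_nonneg (hu N)) (fun N => (hS N).totalMass_cond (hu N)) (fun i => ?_)
    (fun i => ?_) wmax (fun N => (hS N).abs_le_of_cond_ne_zero (hu N) hw) Pw (fun g hg => ?_)
  · rw [tendsto_iff_norm_sub_tendsto_zero]
    exact squeeze_zero (fun _ => norm_nonneg _)
      (fun N => (hS N).abs_expMass_sub_one_le (hu N) i) herr
  · rw [tendsto_iff_norm_sub_tendsto_zero]
    refine squeeze_zero (fun _ => norm_nonneg _) (fun N => ?_)
      (show Tendsto (fun N => 2 * ε N) atTop (𝓝 0) by simpa using hε.const_mul 2)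
    exact (Finset.single_le_sum
      (f := fun i => |rowMarginal (S N).cond (diagCoeff φ) i - diagCoeff ψ i|)
      (fun i _ => abs_nonneg _) (Finset.mem_univ i)).trans
      ((hS N).sum_abs_rowMarginal_sub_le (hu N))
  · simpa only [sum_mul_eq_linearCombination] using hconv g hg

/-! ### Long uniform batteries are almost ideal -/

/-- The uniform distribution on the levels `f ≤ x ≤ n - f`. -/
def boxBattery (n f : ℕ) : Fin (n + 1) → ℝ := fun x =>
  if f ≤ (x : ℕ) ∧ (x : ℕ) + f ≤ n then ((n : ℝ) + 1 - 2 * f)⁻¹ else 0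

theorem sum_ite_between (n a : ℕ) (c : ℝ) (h : 2 * a ≤ n) :
    ∑ x : Fin (n + 1), (if a ≤ (x : ℕ) ∧ (x : ℕ) + a ≤ n then c else 0) =
      ((n : ℝ) + 1 - 2 * a) * c := by
  rw [Fin.sum_univ_eq_sum_range (fun x => if a ≤ x ∧ x + a ≤ n then c else 0),
    ← Finset.sum_filter, Finset.sum_const, nsmul_eq_mul]
  have h1 : (Finset.range (n + 1)).filter (fun x => a ≤ x ∧ x + a ≤ n) =
      Finset.Ico a (n + 1 - a) := by
    ext x
    simp only [Finset.mem_filter, Finset.mem_range, Finset.mem_Ico]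
    omega
  rw [h1, Nat.card_Ico, Nat.cast_sub (by omega), Nat.cast_sub (by omega)]
  push_cast
  ring

theorem boxBattery_nonneg {n f : ℕ} (h : 2 * f ≤ n) (x : Fin (n + 1)) : 0 ≤ boxBattery n f x := by
  have : (2 : ℝ) * f ≤ n := by exact_mod_cast h
  rw [boxBattery]
  split_ifs
  · exact inv_nonneg.2 (by linarith)
  · rfl

theorem sum_boxBattery {n f : ℕ} (h : 2 * f ≤ n) : ∑ x, boxBattery n f x = 1 := by
  have : (2 : ℝ) * f ≤ n := by exact_mod_cast h
  simp only [boxBattery]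
  rw [sum_ite_between n f _ h, mul_inv_cancel₀ (by linarith)]

theorem boxBattery_ne_zero {n f : ℕ} {x : Fin (n + 1)} (h : boxBattery n f x ≠ 0) :
    f ≤ (x : ℕ) ∧ (x : ℕ) + f ≤ n := by
  by_contra hx
  rw [boxBattery, if_neg hx] at h
  exact h rfl

/-- A joint ket that agrees with `v ⊗ λ`, for a uniform battery `λ`, at distance at least `2 * f`
from bottom and top, is close to it: both kets are normalised, and `v ⊗ λ` has weight at most
`2 * f / (n + 1 - 2 * f)` at the remaining levels. -/
theorem traceNorm_sub_box_le {ι : Type*} [Fintype ι] [DecidableEq ι] {u n f : ℕ} (hu : 2 ≤ u)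
    (hn : 4 * f ≤ n) (v : ι → ℂ) (hv : IsKet v) (A : ι → Fin (n + 1) → ℂ)
    (hA : IsKet (jointKet u n A))
    (hbulk : ∀ i (y : Fin (n + 1)), 2 * f ≤ (y : ℕ) → (y : ℕ) + 2 * f ≤ n →
      A i y = v i * (Real.sqrt (boxBattery n f y) : ℂ)) :
    traceNorm (density (jointKet u n A) - density (tensorKet v (batteryKet u n (boxBattery n f)))) ≤
      Real.sqrt (64 * (f / ((n : ℝ) + 1 - 2 * f))) := by
  set B : ι → Fin (n + 1) → ℂ := fun i y => v i * (Real.sqrt (boxBattery n f y) : ℂ) with hB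
  have hn' : (4 : ℝ) * f ≤ n := by exact_mod_cast hn
  have hf0 : (0 : ℝ) ≤ f := Nat.cast_nonneg f
  have hL : 0 < (n : ℝ) + 1 - 2 * f := by linarith
  have hBsq : ∀ i y, ‖B i y‖ ^ 2 = ‖v i‖ ^ 2 * boxBattery n f y := by
    intro i y
    simp only [hB]
    rw [norm_mul, mul_pow, Complex.norm_real, Real.norm_eq_abs, sq_abs,
      Real.sq_sqrt (boxBattery_nonneg (by omega) y)]
  have hA1 : ∑ i, ∑ y, ‖A i y‖ ^ 2 = 1 := by rw [← sum_norm_sq_jointKet hu]; exact hA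
  have hB1 : ∑ i, ∑ y, ‖B i y‖ ^ 2 = 1 := by
    simp only [hBsq, ← Finset.mul_sum, sum_boxBattery (show 2 * f ≤ n by omega), mul_one]
    exact hv
  have hBk : IsKet (jointKet u n B) := by rw [IsKet, sum_norm_sq_jointKet hu, hB1]
  rw [tensorKet_batteryKet]
  refine (traceNorm_density_sub_le _ _ hA hBk).trans (Real.sqrt_le_sqrt ?_)
  have hsub : ∑ s, ‖jointKet u n A s - jointKet u n B s‖ ^ 2 = ∑ i, ∑ y, ‖A i y - B i y‖ ^ 2 := by
    have := sum_norm_sq_jointKet (n := n) hu (A - B)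
    rw [← jointKet_sub] at this
    exact this
  rw [hsub]
  -- `m C` is the weight of the amplitudes `C` at the inner levels
  set m : (ι → Fin (n + 1) → ℂ) → ℝ := fun C =>
    ∑ i, ∑ y : Fin (n + 1), (if 2 * f ≤ (y : ℕ) ∧ (y : ℕ) + 2 * f ≤ n then ‖C i y‖ ^ 2 else 0)
    with hm
  have hmAB : m A = m B := by
    simp only [hm]
    refine Finset.sum_congr rfl fun i _ => Finset.sum_congr rfl fun y _ => ?_
    split_ifs with hy
    · rw [hbulk i y hy.1 hy.2]
    · rfl
  have hmB : 1 - m B = 2 * (f / ((n : ℝ) + 1 - 2 * f)) := by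
    have h1 : m B = ∑ i, ‖v i‖ ^ 2 * (((n : ℝ) + 1 - 2 * (2 * f : ℕ)) *
        ((n : ℝ) + 1 - 2 * f)⁻¹) := by
      simp only [hm]
      refine Finset.sum_congr rfl fun i _ => ?_
      rw [← sum_ite_between n (2 * f) _ (by omega), Finset.mul_sum]
      refine Finset.sum_congr rfl fun y _ => ?_
      split_ifs with hy
      · rw [hBsq, boxBattery, if_pos (by omega)]
      · rw [mul_zero]
    rw [h1, ← Finset.sum_mul, show ∑ i, ‖v i‖ ^ 2 = 1 from hv]
    push_cast
    field_simp
    ring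
  have hpt : ∀ i y, ‖A i y - B i y‖ ^ 2 ≤ 2 * (‖A i y‖ ^ 2 -
      if 2 * f ≤ (y : ℕ) ∧ (y : ℕ) + 2 * f ≤ n then ‖A i y‖ ^ 2 else 0) + 2 * (‖B i y‖ ^ 2 -
      if 2 * f ≤ (y : ℕ) ∧ (y : ℕ) + 2 * f ≤ n then ‖B i y‖ ^ 2 else 0) := by
    intro i y
    split_ifs with hy
    · rw [hbulk i y hy.1 hy.2]
      simp [hB]
    · have h1 : ‖A i y - B i y‖ ≤ ‖A i y‖ + ‖B i y‖ := norm_sub_le _ _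
      calc _ ≤ (‖A i y‖ + ‖B i y‖) ^ 2 := by gcongr
        _ ≤ _ := by nlinarith [sq_nonneg (‖A i y‖ - ‖B i y‖)]
  have htot : ∑ i, ∑ y, ‖A i y - B i y‖ ^ 2 ≤ 2 * (1 - m A) + 2 * (1 - m B) := by
    refine (Finset.sum_le_sum fun i _ => Finset.sum_le_sum fun y _ => hpt i y).trans (le_of_eq ?_)
    simp only [Finset.sum_add_distrib, ← Finset.mul_sum, Finset.sum_sub_distrib]
    rw [hA1, hB1]
  rw [hmAB, hmB] at htot
  linarith

/-- In `Φ' = ∑_k φ'_k ⊗ Γ^k λ`, the shifts `Γ^k λ` of a uniform battery all have the same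
coefficients away from bottom and top, where `Φ'` is thus exactly `φ' ⊗ λ`. -/
theorem isIdealBattery_box {c : FreeClass} {u n f : ℕ} (hu : 2 ≤ u) (hn : 4 * f ≤ n) {ε : ℝ}
    (hε : Real.sqrt (64 * (f / ((n : ℝ) + 1 - 2 * f))) ≤ ε) :
    IsIdealBattery c u n (boxBattery n f) f ε := by
  refine ⟨boxBattery_nonneg (by omega), sum_boxBattery (by omega), fun x => boxBattery_ne_zero, ?_⟩
  intro m ψ φ φs Φ _ hφ hΦk hφs hΦ _ _ _
  have hΦj : Φ = jointKet u n fun i y => ∑ k ∈ Finset.Icc (-(f : ℤ)) f,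
      φs k i * (Real.sqrt (extendZero (boxBattery n f) (((y : ℕ) : ℤ) - k)) : ℂ) := by
    rw [hΦ]
    have h1 : ∀ k ∈ Finset.Icc (-(f : ℤ)) f,
        tensorKet (φs k) (shiftedBattery u n (boxBattery n f) k) = jointKet u n fun i y =>
          φs k i * (Real.sqrt (extendZero (boxBattery n f) (((y : ℕ) : ℤ) - k)) : ℂ) := by
      intro k hk
      rw [Finset.mem_Icc] at hk
      refine tensorKet_shiftedBattery _ _ _ fun x hx => ?_
      have := boxBattery_ne_zero hx
      omega
    rw [Finset.sum_congr rfl h1]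
    ext s
    simp only [Finset.sum_apply, jointKet, Finset.sum_mul]
    exact Finset.sum_comm
  rw [hΦj] at hΦk ⊢
  refine (traceNorm_sub_box_le hu hn φ hφ _ hΦk fun i y h1 h2 => ?_).trans hε
  have h3 : ∀ k ∈ Finset.Icc (-(f : ℤ)) f,
      extendZero (boxBattery n f) (((y : ℕ) : ℤ) - k) = boxBattery n f y := by
    intro k hk
    rw [Finset.mem_Icc] at hk
    rw [extendZero, dif_pos (by omega)]
    simp only [boxBattery]
    rw [if_pos ⟨by omega, by omega⟩, if_pos ⟨by omega, by omega⟩]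
  rw [Finset.sum_congr rfl fun k hk => by rw [h3 k hk], ← Finset.sum_mul, hφs, Finset.sum_apply]

/-! ### Rounding to multiples of the quid -/

/-- The weight of the upper of the two neighbours of `w` in `δ ℤ`, when `w` is split between these
neighbours in such a way that the mass and the exponential moment are preserved. -/
def splitWeight (δ w : ℝ) : ℝ :=
  (Real.exp w - Real.exp (⌊w / δ⌋ * δ)) /
    (Real.exp ((⌊w / δ⌋ + 1) * δ) - Real.exp (⌊w / δ⌋ * δ))

/-- The distribution on `ℤ` that splits `w` between its two neighbours in `δ ℤ`. -/
def split (δ w : ℝ) : ℤ →₀ ℝ :=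
  Finsupp.single ⌊w / δ⌋ (1 - splitWeight δ w) + Finsupp.single (⌊w / δ⌋ + 1) (splitWeight δ w)

theorem floor_mul_le {δ : ℝ} (hδ : 0 < δ) (w : ℝ) : ⌊w / δ⌋ * δ ≤ w := by
  have := Int.floor_le (w / δ)
  rwa [le_div_iff₀ hδ] at this

theorem lt_floor_add_one_mul {δ : ℝ} (hδ : 0 < δ) (w : ℝ) : w < (⌊w / δ⌋ + 1) * δ := by
  have := Int.lt_floor_add_one (w / δ)
  rwa [div_lt_iff₀ hδ] at this

theorem splitWeight_nonneg {δ : ℝ} (hδ : 0 < δ) (w : ℝ) : 0 ≤ splitWeight δ w := by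
  have h1 := Real.exp_le_exp.2 (floor_mul_le hδ w)
  have h2 := Real.exp_lt_exp.2 (lt_floor_add_one_mul hδ w)
  exact div_nonneg (by linarith) (by linarith)

theorem splitWeight_le_one {δ : ℝ} (hδ : 0 < δ) (w : ℝ) : splitWeight δ w ≤ 1 := by
  have h1 := Real.exp_le_exp.2 (floor_mul_le hδ w)
  have h2 := Real.exp_lt_exp.2 (lt_floor_add_one_mul hδ w)
  exact div_le_one_of_le₀ (by linarith) (by linarith)

theorem linearCombination_split (δ w : ℝ) (h : ℤ → ℝ) :
    Finsupp.linearCombination ℝ h (split δ w) =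
      (1 - splitWeight δ w) * h ⌊w / δ⌋ + splitWeight δ w * h (⌊w / δ⌋ + 1) := by
  rw [split, map_add, Finsupp.linearCombination_single, Finsupp.linearCombination_single,
    smul_eq_mul, smul_eq_mul]

theorem linearCombination_exp_split {δ : ℝ} (hδ : 0 < δ) (w : ℝ) :
    Finsupp.linearCombination ℝ (fun k : ℤ => Real.exp (k * δ)) (split δ w) = Real.exp w := by
  have h1 := Real.exp_le_exp.2 (floor_mul_le hδ w)
  have h2 := Real.exp_lt_exp.2 (lt_floor_add_one_mul hδ w)
  have h3 : Real.exp ((⌊w / δ⌋ + 1) * δ) - Real.exp (⌊w / δ⌋ * δ) ≠ 0 := by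
    intro h; linarith
  rw [linearCombination_split, splitWeight]
  push_cast
  generalize Real.exp ((⌊w / δ⌋ + 1) * δ) = b at *
  generalize Real.exp (⌊w / δ⌋ * δ) = a at *
  field_simp
  ring

theorem split_nonneg {δ : ℝ} (hδ : 0 < δ) (w : ℝ) (k : ℤ) : 0 ≤ split δ w k := by
  rw [split, Finsupp.add_apply, Finsupp.single_apply, Finsupp.single_apply]
  have h1 := splitWeight_nonneg hδ w
  have h2 := splitWeight_le_one hδ w
  refine add_nonneg ?_ ?_ <;> split_ifs <;> linarith

theorem abs_mul_le_of_split_ne_zero {δ : ℝ} (hδ : 0 < δ) (w : ℝ) (k : ℤ) (h : split δ w k ≠ 0) :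
    |(k : ℝ)| * δ ≤ |w| + δ := by
  rw [← abs_of_pos hδ, ← abs_mul, abs_of_pos hδ]
  have h1 := floor_mul_le hδ w
  have h2 := lt_floor_add_one_mul hδ w
  have h3 := abs_le.1 (le_refl |w|)
  have hk : k = ⌊w / δ⌋ ∨ k = ⌊w / δ⌋ + 1 := by
    by_contra hk
    push Not at hk
    rw [split, Finsupp.add_apply, Finsupp.single_eq_of_ne hk.1,
      Finsupp.single_eq_of_ne hk.2, add_zero] at h
    exact h rfl
  rw [abs_le]
  rcases hk with rfl | rfl
  · constructor <;> linarith
  · push_cast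
    constructor <;> linarith

/-- The mean displacement of `w` under splitting is small as soon as one of the two neighbours is
close: the weight of the remote neighbour is proportional to the distance of the close one. -/
theorem split_displacement_le {δ : ℝ} (hδ : 0 < δ) (hδ2 : δ ≤ Real.log 2) (w : ℝ) :
    (1 - splitWeight δ w) * (w - ⌊w / δ⌋ * δ) + splitWeight δ w * ((⌊w / δ⌋ + 1) * δ - w) ≤
      5 * |w - round (w / δ) * δ| := by
  set t := splitWeight δ w with ht
  set d₁ := w - ⌊w / δ⌋ * δ with hd₁
  set d₂ := (⌊w / δ⌋ + 1) * δ - w with hd₂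
  have h1 : 0 ≤ d₁ := by have := floor_mul_le hδ w; linarith
  have h2 : 0 ≤ d₂ := by have := lt_floor_add_one_mul hδ w; linarith
  have h12 : d₁ + d₂ = δ := by rw [hd₁, hd₂]; ring
  have ht0 : 0 ≤ t := splitWeight_nonneg hδ w
  have ht1 : 0 ≤ 1 - t := by have := splitWeight_le_one hδ w; linarith
  have hE : |w - round (w / δ) * δ| = min d₁ d₂ := by
    have h3 : w - round (w / δ) * δ = (w / δ - round (w / δ)) * δ := by
      rw [sub_mul, div_mul_cancel₀ _ hδ.ne']
    rw [h3, abs_mul, abs_of_pos hδ, abs_sub_round_eq_min, min_mul_of_nonneg _ _ hδ.le,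
      ← Int.self_sub_floor]
    congr 1
    · rw [sub_mul, div_mul_cancel₀ _ hδ.ne']
    · rw [sub_mul, sub_mul, div_mul_cancel₀ _ hδ.ne', hd₂]; ring
  have hbal : (1 - t) * (1 - Real.exp (-d₁)) = t * (Real.exp d₂ - 1) := by
    have h3 := linearCombination_exp_split hδ w
    rw [linearCombination_split, ← ht] at h3
    have h4 : Real.exp (-d₁) = Real.exp (⌊w / δ⌋ * δ) / Real.exp w := by
      rw [← Real.exp_sub, hd₁]; congr 1; ring
    have h5 : Real.exp d₂ = Real.exp ((⌊w / δ⌋ + 1) * δ) / Real.exp w := by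
      rw [← Real.exp_sub]
    push_cast at h3
    rw [h4, h5]
    have := Real.exp_ne_zero w
    generalize Real.exp ((⌊w / δ⌋ + 1) * δ) = b at *
    generalize Real.exp (⌊w / δ⌋ * δ) = a at *
    field_simp
    linarith
  have hexp1 : 1 - Real.exp (-d₁) ≤ d₁ := by linarith [Real.add_one_le_exp (-d₁)]
  have hexp2 : d₂ ≤ Real.exp d₂ - 1 := by linarith [Real.add_one_le_exp d₂]
  have hle2 : ∀ d, d ≤ δ → Real.exp d ≤ 2 := fun d hd => by
    rw [← Real.exp_log (show (0 : ℝ) < 2 by norm_num)]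
    exact Real.exp_le_exp.2 (hd.trans hδ2)
  have hexp3 : d₁ / 2 ≤ 1 - Real.exp (-d₁) := by
    -- `1 - exp (-d) = exp (-d) (exp d - 1) ≥ exp (-d) d`
    have h3 : Real.exp (-d₁) * Real.exp d₁ = 1 := by rw [← Real.exp_add]; simp
    have h4 := Real.add_one_le_exp d₁
    have h5 := hle2 d₁ (by linarith)
    have h6 := Real.exp_pos (-d₁)
    nlinarith
  have hexp4 : Real.exp d₂ - 1 ≤ 2 * d₂ := by
    have h3 : Real.exp (-d₂) * Real.exp d₂ = 1 := by rw [← Real.exp_add]; simp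
    have h4 := Real.add_one_le_exp (-d₂)
    have h5 := hle2 d₂ (by linarith)
    have h6 := Real.exp_pos d₂
    nlinarith
  have hA : t * d₂ ≤ (1 - t) * d₁ := by
    calc t * d₂ ≤ t * (Real.exp d₂ - 1) := mul_le_mul_of_nonneg_left hexp2 ht0
      _ = (1 - t) * (1 - Real.exp (-d₁)) := hbal.symm
      _ ≤ _ := mul_le_mul_of_nonneg_left hexp1 ht1
  have hB : (1 - t) * d₁ ≤ 4 * (t * d₂) := by
    have h3 : (1 - t) * (d₁ / 2) ≤ (1 - t) * (1 - Real.exp (-d₁)) :=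
      mul_le_mul_of_nonneg_left hexp3 ht1
    have h4 : t * (Real.exp d₂ - 1) ≤ t * (2 * d₂) := mul_le_mul_of_nonneg_left hexp4 ht0
    linarith
  rw [hE]
  rcases min_cases d₁ d₂ with ⟨h3, -⟩ | ⟨h3, -⟩
  · rw [h3]
    nlinarith
  · rw [h3]
    nlinarith

/-- Splitting converges weakly to the identity for every `w` that is resolved in the limit. -/
theorem tendsto_split {δ : ℕ → ℝ} (hδ : ∀ N, 0 < δ N) (hδ2 : ∀ N, δ N ≤ Real.log 2) {w : ℝ}
    (hw : Tendsto (fun N => w - (round (w / δ N) : ℝ) * δ N) atTop (𝓝 0)) {g : ℝ → ℝ}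
    (hg : Continuous g) :
    Tendsto (fun N => Finsupp.linearCombination ℝ (fun k : ℤ => g (k * δ N)) (split (δ N) w))
      atTop (𝓝 (g w)) := by
  obtain ⟨C, hC⟩ := (isCompact_Icc (a := w - 1) (b := w + 1)).exists_bound_of_continuousOn
    hg.continuousOn
  have hC0 : 0 ≤ C := (norm_nonneg _).trans (hC w ⟨by linarith, by linarith⟩)
  rw [Metric.tendsto_atTop]
  intro e he
  obtain ⟨d, hd, hgd⟩ := Metric.continuous_iff.1 hg w (e / 2) (by linarith)
  -- on `[w - 1, w + 1]`, the modulus of continuity is bounded by an affine function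
  have haff : ∀ y, |y - w| ≤ 1 → |g y - g w| ≤ e / 2 + 2 * C / d * |y - w| := by
    intro y hy
    by_cases hyd : |y - w| < d
    · have := hgd y hyd
      rw [Real.dist_eq] at this
      have h0 : 0 ≤ 2 * C / d * |y - w| := by positivity
      linarith
    · push Not at hyd
      have h1 : |g y - g w| ≤ 2 * C := by
        have h2 := hC y ⟨by linarith [(abs_le.1 hy).1], by linarith [(abs_le.1 hy).2]⟩
        have h3 := hC w ⟨by linarith, by linarith⟩
        rw [Real.norm_eq_abs] at h2 h3
        linarith [abs_sub (g y) (g w)]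
      have h2 : 2 * C ≤ 2 * C / d * |y - w| := by
        rw [div_mul_eq_mul_div, le_div_iff₀ hd]
        exact mul_le_mul_of_nonneg_left hyd (by linarith)
      linarith
  have hK : 0 < 10 * C / d + 1 := by positivity
  obtain ⟨N₀, hN₀⟩ := Metric.tendsto_atTop.1 hw (e / 2 / (10 * C / d + 1)) (by positivity)
  refine ⟨N₀, fun N hN => ?_⟩
  have hE := hN₀ N hN
  rw [Real.dist_eq, sub_zero, lt_div_iff₀ hK] at hE
  set E := |w - (round (w / δ N) : ℝ) * δ N| with hEdef
  have hE0 : 0 ≤ E := abs_nonneg _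
  have hdisp := split_displacement_le (hδ N) (hδ2 N) w
  rw [← hEdef] at hdisp
  have hlog : Real.log 2 ≤ 1 := by
    have := Real.log_le_sub_one_of_pos (show (0 : ℝ) < 2 by norm_num)
    linarith
  have h1 := floor_mul_le (hδ N) w
  have h2 := lt_floor_add_one_mul (hδ N) w
  have hδ1 := (hδ2 N).trans hlog
  have ht0 := splitWeight_nonneg (hδ N) w
  have ht1 : 0 ≤ 1 - splitWeight (δ N) w := by have := splitWeight_le_one (hδ N) w; linarith
  rw [Real.dist_eq, linearCombination_split]
  push_cast
  set t := splitWeight (δ N) w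
  set w₁ := (⌊w / δ N⌋ : ℝ) * δ N with hw₁
  set w₂ := ((⌊w / δ N⌋ : ℝ) + 1) * δ N with hw₂
  have hw12 : w₂ - w₁ = δ N := by rw [hw₁, hw₂]; ring
  have ha1 : |w₁ - w| = w - w₁ := by rw [abs_sub_comm, abs_of_nonneg (by linarith)]
  have ha2 : |w₂ - w| = w₂ - w := abs_of_nonneg (by linarith)
  have hg1 := haff w₁ (by rw [ha1]; linarith)
  have hg2 := haff w₂ (by rw [ha2]; linarith)
  rw [ha1] at hg1
  rw [ha2] at hg2
  have hsplit : (1 - t) * g w₁ + t * g w₂ - g w = (1 - t) * (g w₁ - g w) + t * (g w₂ - g w) := by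
    ring
  rw [hsplit]
  calc _ ≤ (1 - t) * |g w₁ - g w| + t * |g w₂ - g w| := by
        refine (abs_add_le _ _).trans ?_
        rw [abs_mul, abs_mul, abs_of_nonneg ht1, abs_of_nonneg ht0]
    _ ≤ (1 - t) * (e / 2 + 2 * C / d * (w - w₁)) + t * (e / 2 + 2 * C / d * (w₂ - w)) :=
        add_le_add (mul_le_mul_of_nonneg_left hg1 ht1) (mul_le_mul_of_nonneg_left hg2 ht0)
    _ = e / 2 + 2 * C / d * ((1 - t) * (w - w₁) + t * (w₂ - w)) := by ring
    _ ≤ e / 2 + 2 * C / d * (5 * E) := by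
        have : 0 ≤ 2 * C / d := by positivity
        have := mul_le_mul_of_nonneg_left hdisp this
        linarith
    _ < e := by
        have : 2 * C / d * (5 * E) = E * (10 * C / d) := by ring
        have h3 : E * (10 * C / d + 1) = E * (10 * C / d) + E := by ring
        linarith

theorem quid_le_log_two {u : ℕ} (hu : 2 ≤ u) : quid u ≤ Real.log 2 := by
  have h : (2 : ℝ) ≤ u := by exact_mod_cast hu
  refine Real.log_le_log (div_pos (by linarith) (by linarith)) ?_
  rw [div_le_iff₀ (by linarith)]
  linarith

/-- The distribution `P` on `ℝ`, rounded to `δ ℤ`. -/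
def roundTo (δ : ℝ) (P : ℝ →₀ ℝ) : ℤ →₀ ℝ := Finsupp.linearCombination ℝ (split δ) P

theorem linearCombination_roundTo (δ : ℝ) (P : ℝ →₀ ℝ) (h : ℤ → ℝ) :
    Finsupp.linearCombination ℝ h (roundTo δ P) =
      Finsupp.linearCombination ℝ (fun w => Finsupp.linearCombination ℝ h (split δ w)) P := by
  rw [roundTo, Finsupp.apply_linearCombination]
  rfl

theorem linearCombination_one_roundTo (δ : ℝ) (P : ℝ →₀ ℝ) :
    Finsupp.linearCombination ℝ (fun _ : ℤ => (1 : ℝ)) (roundTo δ P) =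
      Finsupp.linearCombination ℝ (fun _ => (1 : ℝ)) P := by
  simp only [linearCombination_roundTo, linearCombination_split, mul_one, sub_add_cancel]

theorem linearCombination_exp_roundTo {δ : ℝ} (hδ : 0 < δ) (P : ℝ →₀ ℝ) :
    Finsupp.linearCombination ℝ (fun k : ℤ => Real.exp (k * δ)) (roundTo δ P) =
      Finsupp.linearCombination ℝ Real.exp P := by
  rw [linearCombination_roundTo]
  simp only [linearCombination_exp_split hδ]

theorem roundTo_apply (δ : ℝ) (P : ℝ →₀ ℝ) (k : ℤ) :
    roundTo δ P k = ∑ w ∈ P.support, P w * split δ w k := by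
  rw [roundTo, Finsupp.linearCombination_apply, Finsupp.sum, Finsupp.finsetSum_apply]
  rfl

theorem roundTo_nonneg {δ : ℝ} (hδ : 0 < δ) {P : ℝ →₀ ℝ} (hP : ∀ w, 0 ≤ P w) (k : ℤ) :
    0 ≤ roundTo δ P k := by
  rw [roundTo_apply]
  exact Finset.sum_nonneg fun w _ => mul_nonneg (hP w) (split_nonneg hδ w k)

theorem abs_mul_le_of_roundTo_ne_zero {δ : ℝ} (hδ : 0 < δ) {P : ℝ →₀ ℝ} {B : ℝ}
    (hB : ∀ w ∈ P.support, |w| ≤ B) (k : ℤ) (h : roundTo δ P k ≠ 0) :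
    |(k : ℝ)| * δ ≤ B + δ := by
  rw [roundTo_apply] at h
  obtain ⟨w, hw, h1⟩ := Finset.exists_ne_zero_of_sum_ne_zero h
  have := abs_mul_le_of_split_ne_zero hδ w k (right_ne_zero_of_mul h1)
  linarith [hB w hw]

/-! ### Completing translation invariant weights on finitely many levels -/

theorem exists_coupling {α β : Type*} [Fintype α] [Fintype β] (R : α → ℝ) (C : β → ℝ)
    (hR : ∀ a, 0 ≤ R a) (hC : ∀ b, 0 ≤ C b) (h : ∑ a, R a = ∑ b, C b) :
    ∃ W : α → β → ℝ, (∀ a b, 0 ≤ W a b) ∧ (∀ a, ∑ b, W a b = R a) ∧ (∀ b, ∑ a, W a b = C b) ∧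
      (∀ a b, R a = 0 → W a b = 0) ∧ ∀ a b, C b = 0 → W a b = 0 := by
  refine ⟨fun a b => R a * C b / ∑ a, R a, fun a b => div_nonneg (mul_nonneg (hR a) (hC b))
    (Finset.sum_nonneg fun a _ => hR a), fun a => ?_, fun b => ?_, fun a b h0 => by simp [h0],
    fun a b h0 => by simp [h0]⟩
  · rw [← Finset.sum_div, ← Finset.mul_sum, ← h]
    by_cases h0 : ∑ a, R a = 0
    · rw [h0, mul_zero, zero_div,
        (Finset.sum_eq_zero_iff_of_nonneg fun a _ => hR a).1 h0 a (Finset.mem_univ a)]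
    · rw [mul_div_cancel_right₀ _ h0]
  · rw [← Finset.sum_div, ← Finset.sum_mul]
    by_cases h0 : ∑ a, R a = 0
    · rw [h0, zero_mul, zero_div,
        (Finset.sum_eq_zero_iff_of_nonneg fun b _ => hC b).1 (h.symm.trans h0) b
          (Finset.mem_univ b)]
    · rw [mul_div_cancel_left₀ _ h0]

theorem sum_levels (n : ℕ) (K : Finset ℤ) (F : ℤ → ℝ) (hF : ∀ k, k ∉ K → F k = 0) (x : ℤ) :
    ∑ x' : Fin (n + 1), F (((x' : ℕ) : ℤ) - x) =
      ∑ k ∈ K, if 0 ≤ x + k ∧ x + k ≤ n then F k else 0 := by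
  have h1 : ∀ k ∈ K, (if 0 ≤ x + k ∧ x + k ≤ n then F k else 0) =
      ∑ x' : Fin (n + 1), if k = ((x' : ℕ) : ℤ) - x then F k else 0 := by
    intro k _
    split_ifs with h
    · rw [Finset.sum_eq_single ⟨(x + k).toNat, by omega⟩]
      · rw [if_pos]
        simp only
        omega
      · intro y _ hy
        rw [if_neg]
        intro hk
        apply hy
        ext
        simp only
        omega
      · simp
    · exact (Finset.sum_eq_zero fun y _ => if_neg (by omega)).symm
  rw [Finset.sum_congr rfl h1, Finset.sum_comm]
  refine Finset.sum_congr rfl fun x' _ => ?_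
  rw [Finset.sum_ite_eq']
  split_ifs with h
  · rfl
  · exact hF _ h

theorem sum_levels_neg (n : ℕ) (K : Finset ℤ) (F : ℤ → ℝ) (hF : ∀ k, k ∉ K → F k = 0) (x' : ℤ) :
    ∑ x : Fin (n + 1), F (x' - ((x : ℕ) : ℤ)) =
      ∑ k ∈ K, if 0 ≤ x' - k ∧ x' - k ≤ n then F k else 0 := by
  have h := sum_levels n (K.map (Equiv.neg ℤ).toEmbedding) (fun k => F (-k)) (fun k hk =>
    hF _ fun h => hk (Finset.mem_map.2 ⟨-k, h, by simp⟩)) x'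
  rw [Finset.sum_map] at h
  simpa [sub_eq_add_neg, add_comm] using h

/-- The deficits that a jump by `k` levels leaves at the bottom of a geometric sequence. -/
theorem sum_geometric_deficit {b : ℝ} (hb : 1 < b) (n : ℕ) (k : ℤ) (hk : |k| ≤ n + 1) :
    ∑ x : Fin (n + 1), (if ((x : ℕ) : ℤ) - k < 0 then b ^ ((x : ℕ) : ℤ) else 0) -
      ∑ x : Fin (n + 1), (if ((x : ℕ) : ℤ) + k < 0 then b ^ (((x : ℕ) : ℤ) + k) else 0) =
      (b ^ k - 1) / (b - 1) := by
  have hb0 : b ≠ 0 := by linarith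
  have hgeom : ∀ m : ℕ, m ≤ n + 1 → ∀ F : ℕ → ℝ,
      ∑ x : Fin (n + 1), (if (x : ℕ) < m then F x else 0) = ∑ x ∈ Finset.range m, F x := by
    intro m hm F
    rw [Fin.sum_univ_eq_sum_range (fun x => if x < m then F x else 0), ← Finset.sum_filter]
    refine Finset.sum_congr ?_ fun _ _ => rfl
    ext x
    simp only [Finset.mem_filter, Finset.mem_range]
    omega
  rw [abs_le] at hk
  obtain ⟨m, rfl | rfl⟩ := k.eq_nat_or_neg
  · have h1 : ∀ x : Fin (n + 1), ¬ ((x : ℕ) : ℤ) + m < 0 := fun x => by omega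
    have h2 : ∀ x : Fin (n + 1), (((x : ℕ) : ℤ) - m < 0) = ((x : ℕ) < m) := fun x =>
      propext (by omega)
    simp only [h1, h2, if_false, Finset.sum_const_zero, sub_zero, zpow_natCast]
    rw [hgeom m (by omega) fun x => b ^ x, geom_sum_eq hb.ne']
  · have h1 : ∀ x : Fin (n + 1), ¬ ((x : ℕ) : ℤ) - -(m : ℤ) < 0 := fun x => by omega
    have h2 : ∀ x : Fin (n + 1), (((x : ℕ) : ℤ) + -(m : ℤ) < 0) = ((x : ℕ) < m) := fun x =>
      propext (by omega)
    simp only [h1, h2, if_false, Finset.sum_const_zero, zero_sub]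
    rw [hgeom m (by omega) fun x => b ^ ((x : ℤ) + -(m : ℤ))]
    simp only [zpow_add₀ hb0, zpow_natCast, ← Finset.sum_mul]
    rw [geom_sum_eq hb.ne', zpow_neg, zpow_natCast]
    have h3 : b - 1 ≠ 0 := by linarith
    field_simp
    ring

section Weights

variable {ι : Type*} [Fintype ι]

/-- Let jumps of the battery from level `x'` to level `x' - k` happen with probabilities `Q i j k`.
On finitely many levels this leaves the blocks near the bottom and the top short of weight, both as
initial and as final blocks. The deficits of the initial and of the final blocks near the bottom
are geometric sums, with equal totals as the mass of `Q` equals its exponential moment. The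
total deficits near the top are then equal too, and the weights can be completed by coupling the
deficits at either end. -/
theorem exists_weights {u : ℕ} (hu : 2 ≤ u) {n f : ℕ} (hn : 2 * f ≤ n) (Q : ι → ι → ℤ → ℝ)
    (hQ : ∀ i j k, 0 ≤ Q i j k) (hQf : ∀ i j k, k ∉ Finset.Icc (-(f : ℤ)) f → Q i j k = 0)
    (hmass : ∀ j, ∑ i, ∑ k ∈ Finset.Icc (-(f : ℤ)) f, Q i j k = 1)
    (hexp : ∀ i, ∑ j, ∑ k ∈ Finset.Icc (-(f : ℤ)) f, Q i j k * Real.exp (k * quid u) = 1) :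
    ∃ G : ι → Fin (n + 1) → ι → Fin (n + 1) → ℝ,
      (∀ i x j x', 0 ≤ G i x j x') ∧
      (∀ i x, ∑ j, ∑ x', G i x j x' = levelDim u n x) ∧
      (∀ j x', ∑ i, ∑ x, G i x j x' = levelDim u n x') ∧
      (∀ i (x : Fin (n + 1)) j (x' : Fin (n + 1)),
        (f : ℤ) < |((x' : ℕ) : ℤ) - ((x : ℕ) : ℤ)| → G i x j x' = 0) ∧
      ∀ i (x : Fin (n + 1)) j (x' : Fin (n + 1)), f ≤ (x' : ℕ) → (x' : ℕ) + f ≤ n →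
        G i x j x' = levelDim u n x' * Q i j (((x' : ℕ) : ℤ) - ((x : ℕ) : ℤ)) := by
  set K := Finset.Icc (-(f : ℤ)) f with hK
  have hu' : (2 : ℝ) ≤ u := by exact_mod_cast hu
  set b : ℝ := (u : ℝ) / ((u : ℝ) - 1) with hb
  have hb1 : 1 < b := by rw [hb, one_lt_div (by linarith)]; linarith
  have hbpos : 0 < b := by linarith
  have hexpb : ∀ k : ℤ, Real.exp (k * quid u) = b ^ k := by
    intro k
    rw [mul_comm, Real.exp_mul, exp_quid hu, Real.rpow_intCast]
  simp only [hexpb] at hexp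
  set c : ℝ := ((u : ℝ) - 1) ^ n with hc
  have hcpos : 0 < c := pow_pos (by linarith) n
  have hD : ∀ x : Fin (n + 1), levelDim u n x = c * b ^ ((x : ℕ) : ℤ) := by
    intro x
    rw [levelDim_eq hu (by omega), ← hexpb]
    push_cast
    rfl
  -- weight sent to, and received from, the (possibly fictitious) levels that satisfy `p`
  let R : (ℤ → Prop) → ι × Fin (n + 1) → ℝ := fun p a => by
    classical
    exact ∑ j, ∑ k ∈ K, if p (((a.2 : ℕ) : ℤ) + k) then
      c * b ^ (((a.2 : ℕ) : ℤ) + k) * Q a.1 j k else 0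
  let C : (ℤ → Prop) → ι × Fin (n + 1) → ℝ := fun p a => by
    classical
    exact ∑ i, ∑ k ∈ K, if p (((a.2 : ℕ) : ℤ) - k) then
      c * b ^ ((a.2 : ℕ) : ℤ) * Q i a.1 k else 0
  let inside : ℤ → Prop := fun y => 0 ≤ y ∧ y ≤ n
  let below : ℤ → Prop := fun y => y < 0
  let above : ℤ → Prop := fun y => n < y
  have hR0 : ∀ p a, 0 ≤ R p a := fun p a => Finset.sum_nonneg fun j _ =>
    Finset.sum_nonneg fun k _ => by
      have := hQ a.1 j k
      split_ifs <;> positivity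
  have hC0 : ∀ p a, 0 ≤ C p a := fun p a => Finset.sum_nonneg fun j _ =>
    Finset.sum_nonneg fun k _ => by
      have := hQ j a.1 k
      split_ifs <;> positivity
  have hpart : ∀ (y : ℤ) (d : ℝ) [Decidable (inside y)] [Decidable (below y)]
      [Decidable (above y)], (if inside y then d else 0) + (if below y then d else 0) +
        (if above y then d else 0) = d := by
    intro y d _ _ _
    by_cases h1 : y < 0
    · rw [if_neg (show ¬ inside y from fun h => by have := h.1; omega),
        if_pos (show below y from h1),
        if_neg (show ¬ above y from fun h => by have : (n : ℤ) < y := h; omega)]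
      ring
    · by_cases h2 : (n : ℤ) < y
      · rw [if_neg (show ¬ inside y from fun h => by have := h.2; omega),
          if_neg (show ¬ below y from h1), if_pos (show above y from h2)]
        ring
      · rw [if_pos (show inside y from ⟨by omega, by omega⟩),
          if_neg (show ¬ below y from h1), if_neg (show ¬ above y from h2)]
        ring
  have hRall : ∀ a, R inside a + R below a + R above a = levelDim u n a.2 := by
    intro a
    simp only [R, ← Finset.sum_add_distrib, hpart]
    rw [hD, ← mul_one (c * _), ← hexp a.1, Finset.mul_sum]
    refine Finset.sum_congr rfl fun j _ => ?_
    rw [Finset.mul_sum]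
    refine Finset.sum_congr rfl fun k _ => ?_
    rw [zpow_add₀ hbpos.ne']
    ring
  have hCall : ∀ a, C inside a + C below a + C above a = levelDim u n a.2 := by
    intro a
    simp only [C, ← Finset.sum_add_distrib, hpart]
    conv_rhs => rw [hD, ← mul_one (c * _), ← hmass a.1, Finset.mul_sum]
    exact Finset.sum_congr rfl fun j _ => by rw [Finset.mul_sum]
  set G₀ : ι × Fin (n + 1) → ι × Fin (n + 1) → ℝ := fun a a' =>
    levelDim u n a'.2 * Q a.1 a'.1 (((a'.2 : ℕ) : ℤ) - ((a.2 : ℕ) : ℤ)) with hG₀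
  have hG₀row : ∀ a, ∑ a', G₀ a a' = R inside a := by
    intro a
    rw [Fintype.sum_prod_type]
    refine Finset.sum_congr rfl fun j _ => ?_
    have h := sum_levels n K (fun k => c * b ^ (((a.2 : ℕ) : ℤ) + k) * Q a.1 j k)
      (fun k hk => by rw [hQf _ _ _ hk, mul_zero]) ((a.2 : ℕ) : ℤ)
    refine Eq.trans (Finset.sum_congr rfl fun x' _ => ?_) (h.trans ?_)
    · simp only [hG₀, hD, add_sub_cancel]
    · exact Finset.sum_congr rfl fun k _ => by congr
  have hG₀col : ∀ a', ∑ a, G₀ a a' = C inside a' := by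
    intro a'
    rw [Fintype.sum_prod_type]
    refine Finset.sum_congr rfl fun i _ => ?_
    have h := sum_levels_neg n K (fun k => c * b ^ ((a'.2 : ℕ) : ℤ) * Q i a'.1 k)
      (fun k hk => by rw [hQf _ _ _ hk, mul_zero]) ((a'.2 : ℕ) : ℤ)
    refine Eq.trans (Finset.sum_congr rfl fun x' _ => ?_) (h.trans ?_)
    · simp only [hG₀, hD]
    · exact Finset.sum_congr rfl fun k _ => by congr
  have hlow : ∑ a, R below a = ∑ a, C below a := by
    have h1 : ∑ a, C below a - ∑ a, R below a =
        ∑ i, ∑ j, ∑ k ∈ K, c * Q i j k * ((b ^ k - 1) / (b - 1)) := by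
      have hRs : ∑ a, R below a = ∑ i, ∑ j, ∑ k ∈ K, c * Q i j k *
          ∑ x : Fin (n + 1), (if ((x : ℕ) : ℤ) + k < 0 then b ^ (((x : ℕ) : ℤ) + k) else 0) := by
        rw [Fintype.sum_prod_type]
        refine Finset.sum_congr rfl fun i _ => ?_
        simp only [R, Finset.mul_sum]
        rw [Finset.sum_comm]
        refine Finset.sum_congr rfl fun j _ => ?_
        rw [Finset.sum_comm]
        refine Finset.sum_congr rfl fun k _ => Finset.sum_congr rfl fun x _ => ?_
        by_cases h : ((x : ℕ) : ℤ) + k < 0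
        · rw [if_pos (show below _ from h), if_pos h]; ring
        · rw [if_neg (show ¬ below _ from h), if_neg h, mul_zero]
      have hCs : ∑ a, C below a = ∑ i, ∑ j, ∑ k ∈ K, c * Q i j k *
          ∑ x : Fin (n + 1), (if ((x : ℕ) : ℤ) - k < 0 then b ^ ((x : ℕ) : ℤ) else 0) := by
        rw [Fintype.sum_prod_type]
        simp only [C, Finset.mul_sum]
        conv_rhs => rw [Finset.sum_comm]
        refine Finset.sum_congr rfl fun j _ => ?_
        rw [Finset.sum_comm]
        refine Finset.sum_congr rfl fun i _ => ?_
        rw [Finset.sum_comm]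
        refine Finset.sum_congr rfl fun k _ => Finset.sum_congr rfl fun x _ => ?_
        by_cases h : ((x : ℕ) : ℤ) - k < 0
        · rw [if_pos (show below _ from h), if_pos h]; ring
        · rw [if_neg (show ¬ below _ from h), if_neg h, mul_zero]
      rw [hRs, hCs]
      simp only [← Finset.sum_sub_distrib]
      refine Finset.sum_congr rfl fun i _ => Finset.sum_congr rfl fun j _ =>
        Finset.sum_congr rfl fun k hk => ?_
      rw [hK, Finset.mem_Icc] at hk
      rw [← mul_sub, sum_geometric_deficit hb1 n k (by rw [abs_le]; omega)]
    have h2 : ∑ i, ∑ j, ∑ k ∈ K, c * Q i j k * ((b ^ k - 1) / (b - 1)) =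
        c / (b - 1) * ((∑ i, ∑ j, ∑ k ∈ K, Q i j k * b ^ k) - ∑ j, ∑ i, ∑ k ∈ K, Q i j k) := by
      rw [Finset.sum_comm (f := fun j i => ∑ k ∈ K, Q i j k)]
      simp only [← Finset.sum_sub_distrib, Finset.mul_sum]
      refine Finset.sum_congr rfl fun i _ => Finset.sum_congr rfl fun j _ =>
        Finset.sum_congr rfl fun k hk => ?_
      ring
    rw [h2] at h1
    simp only [hexp, hmass, sub_self, mul_zero] at h1
    linarith
  have hhigh : ∑ a, R above a = ∑ a, C above a := by
    have h1 : ∑ a, R inside a = ∑ a, C inside a := by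
      simp only [← hG₀row, ← hG₀col]
      exact Finset.sum_comm
    have h2 : ∑ a, (R inside a + R below a + R above a) =
        ∑ a, (C inside a + C below a + C above a) :=
      Finset.sum_congr rfl fun a _ => by rw [hRall, hCall]
    simp only [Finset.sum_add_distrib] at h2
    linarith
  -- deficits occur only at the `f` lowest and at the `f` highest levels
  have hRzero : ∀ (p : ℤ → Prop) (a : ι × Fin (n + 1)),
      (∀ k ∈ K, ¬ p (((a.2 : ℕ) : ℤ) + k)) → R p a = 0 := fun p a h =>
    Finset.sum_eq_zero fun j _ => Finset.sum_eq_zero fun k hk => if_neg (h k hk)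
  have hCzero : ∀ (p : ℤ → Prop) (a : ι × Fin (n + 1)),
      (∀ k ∈ K, ¬ p (((a.2 : ℕ) : ℤ) - k)) → C p a = 0 := fun p a h =>
    Finset.sum_eq_zero fun j _ => Finset.sum_eq_zero fun k hk => if_neg (h k hk)
  have hRlow : ∀ a : ι × Fin (n + 1), f ≤ (a.2 : ℕ) → R below a = 0 := fun a ha =>
    hRzero _ _ fun k hk h => by
      rw [hK, Finset.mem_Icc] at hk
      have h' : ((a.2 : ℕ) : ℤ) + k < 0 := h
      omega
  have hClow : ∀ a : ι × Fin (n + 1), f ≤ (a.2 : ℕ) → C below a = 0 := fun a ha =>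
    hCzero _ _ fun k hk h => by
      rw [hK, Finset.mem_Icc] at hk
      have h' : ((a.2 : ℕ) : ℤ) - k < 0 := h
      omega
  have hRhigh : ∀ a : ι × Fin (n + 1), (a.2 : ℕ) + f ≤ n → R above a = 0 := fun a ha =>
    hRzero _ _ fun k hk h => by
      rw [hK, Finset.mem_Icc] at hk
      have h' : (n : ℤ) < ((a.2 : ℕ) : ℤ) + k := h
      omega
  have hChigh : ∀ a : ι × Fin (n + 1), (a.2 : ℕ) + f ≤ n → C above a = 0 := fun a ha =>
    hCzero _ _ fun k hk h => by
      rw [hK, Finset.mem_Icc] at hk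
      have h' : (n : ℤ) < ((a.2 : ℕ) : ℤ) - k := h
      omega
  obtain ⟨W₁, hW₁0, hW₁r, hW₁c, hW₁zr, hW₁zc⟩ := exists_coupling _ _ (hR0 below) (hC0 below) hlow
  obtain ⟨W₂, hW₂0, hW₂r, hW₂c, hW₂zr, hW₂zc⟩ := exists_coupling _ _ (hR0 above) (hC0 above) hhigh
  refine ⟨fun i x j x' => G₀ (i, x) (j, x') + W₁ (i, x) (j, x') + W₂ (i, x) (j, x'),
    fun i x j x' => ?_, fun i x => ?_, fun j x' => ?_, fun i x j x' h => ?_,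
    fun i x j x' h1 h2 => ?_⟩
  · refine add_nonneg (add_nonneg (mul_nonneg (levelDim_pos hu _ _).le (hQ _ _ _)) (hW₁0 _ _))
      (hW₂0 _ _)
  · rw [← Fintype.sum_prod_type' (f := fun j x' =>
      G₀ (i, x) (j, x') + W₁ (i, x) (j, x') + W₂ (i, x) (j, x'))]
    simp only [Prod.mk.eta, Finset.sum_add_distrib, hG₀row, hW₁r, hW₂r, hRall]
  · rw [← Fintype.sum_prod_type' (f := fun i x =>
      G₀ (i, x) (j, x') + W₁ (i, x) (j, x') + W₂ (i, x) (j, x'))]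
    simp only [Prod.mk.eta, Finset.sum_add_distrib, hG₀col, hW₁c, hW₂c, hCall]
  · have h0 : G₀ (i, x) (j, x') = 0 := by
      simp only [hG₀]
      rw [hQf _ _ _ (by rw [hK, Finset.mem_Icc]; rw [lt_abs] at h; omega), mul_zero]
    have h1 : W₁ (i, x) (j, x') = 0 := by
      by_cases hx : f ≤ (x : ℕ)
      · exact hW₁zr _ _ (hRlow (i, x) hx)
      · refine hW₁zc _ _ (hClow (j, x') ?_)
        rw [lt_abs] at h
        simp only
        omega
    have h2 : W₂ (i, x) (j, x') = 0 := by
      by_cases hx : (x : ℕ) + f ≤ n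
      · exact hW₂zr _ _ (hRhigh (i, x) hx)
      · refine hW₂zc _ _ (hChigh (j, x') ?_)
        rw [lt_abs] at h
        simp only
        omega
    simp only [h0, h1, h2, add_zero]
  · simp only [hW₁zc _ _ (hClow (j, x') h1), hW₂zc _ _ (hChigh (j, x') h2), add_zero, hG₀]

end Weights

/-! ### Mixtures of permutations with given block weights -/

theorem exists_mixture_of_doublyStochastic {X : Type*} [Fintype X] [DecidableEq X]
    (T : X → X → ℝ) (hT : ∀ s t, 0 ≤ T s t) (hrow : ∀ s, ∑ t, T s t = 1)
    (hcol : ∀ t, ∑ s, T s t = 1) :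
    ∃ r : Equiv.Perm X → ℝ, (∀ π, 0 ≤ r π) ∧ ∑ π, r π = 1 ∧
      ∀ (d : X → ℝ) (s : X), mixFn r d s = ∑ t, T s t * d t := by
  obtain ⟨r, hr, hr1, hrT⟩ := exists_eq_sum_perm_of_mem_doublyStochastic
    (M := Matrix.of T) (mem_doublyStochastic_iff_sum.2 ⟨hT, hrow, hcol⟩)
  refine ⟨r, hr, hr1, fun d s => ?_⟩
  have h : ∀ t, T s t = ∑ π : Equiv.Perm X, r π * if π s = t then 1 else 0 := by
    intro t
    have h1 := congrFun (congrFun hrT s) t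
    rw [Matrix.sum_apply] at h1
    refine h1.symm.trans (Finset.sum_congr rfl fun π _ => ?_)
    rw [Matrix.smul_apply, smul_eq_mul, Equiv.Perm.permMatrix, PEquiv.toMatrix_apply]
    simp [eq_comm]
  simp only [h, mixFn, Finset.sum_mul]
  rw [Finset.sum_comm]
  refine Finset.sum_congr rfl fun π _ => ?_
  simp

/-- Block weights with the right marginals come from a mixture of permutations that transfers
weight uniformly between blocks, and that is trivial off the support of the battery. -/
theorem exists_mixture_of_weights {ι : Type*} [Fintype ι] [DecidableEq ι] {u n : ℕ} (hu : 2 ≤ u)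
    (G : ι → Fin (n + 1) → ι → Fin (n + 1) → ℝ) (hG : ∀ i x j x', 0 ≤ G i x j x')
    (hrow : ∀ i x, ∑ j, ∑ x', G i x j x' = levelDim u n x)
    (hcol : ∀ j x', ∑ i, ∑ x, G i x j x' = levelDim u n x') :
    ∃ r : Equiv.Perm (ι × BatteryIndex u n) → ℝ, (∀ π, 0 ≤ r π) ∧ ∑ π, r π = 1 ∧
      ∀ d : ι → Fin (n + 1) → ℝ, mixFn r (blockFn d) =
        blockFn fun i x => (∑ j, ∑ x', G i x j x' * d j x') / levelDim u n x := by
  have hD := levelDim_pos hu n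
  set H : ι → Fin (n + 1) → ι → Fin (n + 1) → ℝ := fun i x j x' =>
    G i x j x' / (levelDim u n x * levelDim u n x') with hH
  have hH0 : ∀ i x j x', 0 ≤ H i x j x' := fun i x j x' =>
    div_nonneg (hG _ _ _ _) (mul_nonneg (hD x).le (hD x').le)
  set T : ι × BatteryIndex u n → ι × BatteryIndex u n → ℝ := fun s t =>
    blockFn (fun i x => blockFn (fun j x' => H i x j x') t) s +
      if s = t ∧ ∀ x : Fin (n + 1), s.2 ∉ levelSet u n x then 1 else 0 with hT
  have hTmem : ∀ i z (x : Fin (n + 1)), z ∈ levelSet u n x → ∀ t,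
      T (i, z) t = blockFn (fun j x' => H i x j x') t := by
    intro i z x hz t
    simp only [hT]
    rw [blockFn_of_mem _ i hz, if_neg fun h => h.2 x hz, add_zero]
  have hTnot : ∀ i z, (∀ x : Fin (n + 1), z ∉ levelSet u n x) → ∀ t,
      T (i, z) t = if (i, z) = t then 1 else 0 := by
    intro i z hz t
    simp only [hT]
    rw [blockFn_of_notMem _ i hz, zero_add]
    by_cases h : (i, z) = t
    · rw [if_pos ⟨h, hz⟩, if_pos h]
    · rw [if_neg fun h' => h h'.1, if_neg h]
  have hTmem' : ∀ s j z (x' : Fin (n + 1)), z ∈ levelSet u n x' →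
      T s (j, z) = blockFn (fun i x => H i x j x') s := by
    intro s j z x' hz
    simp only [hT]
    rw [if_neg fun h => ?_, add_zero]
    · congr 1
      ext i x
      rw [blockFn_of_mem _ j hz]
    · exact h.2 x' (by rw [h.1]; exact hz)
  have hTnot' : ∀ s j z, (∀ x : Fin (n + 1), z ∉ levelSet u n x) →
      T s (j, z) = if s = (j, z) then 1 else 0 := by
    intro s j z hz
    obtain ⟨i, y⟩ := s
    by_cases hy : ∀ x : Fin (n + 1), y ∉ levelSet u n x
    · exact hTnot i y hy _
    · push Not at hy
      obtain ⟨x, hx⟩ := hy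
      rw [hTmem i y x hx, blockFn_of_notMem _ _ hz, if_neg]
      intro h
      have h' : y = z := (Prod.ext_iff.1 h).2
      exact hz x (h' ▸ hx)
  have hT0 : ∀ s t, 0 ≤ T s t := by
    intro s t
    refine add_nonneg ?_ (by split_ifs <;> norm_num)
    refine Finset.sum_nonneg fun x _ => ?_
    split_ifs
    · refine Finset.sum_nonneg fun x' _ => ?_
      split_ifs
      · exact hH0 _ _ _ _
      · rfl
    · rfl
  have hTrow : ∀ s, ∑ t, T s t = 1 := by
    rintro ⟨i, z⟩
    by_cases hz : ∃ x : Fin (n + 1), z ∈ levelSet u n x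
    · obtain ⟨x, hx⟩ := hz
      simp only [hTmem i z x hx]
      rw [sum_blockFn hu]
      trans (∑ j, ∑ x', G i x j x') / levelDim u n x
      swap
      · rw [hrow, div_self (hD x).ne']
      rw [Finset.sum_div]
      refine Finset.sum_congr rfl fun j _ => ?_
      rw [Finset.sum_div]
      refine Finset.sum_congr rfl fun x' _ => ?_
      have h1 := (hD x).ne'
      have h2 := (hD x').ne'
      simp only [hH]
      field_simp
    · push Not at hz
      simp only [hTnot i z hz]
      rw [Finset.sum_ite_eq, if_pos (Finset.mem_univ _)]
  have hTcol : ∀ t, ∑ s, T s t = 1 := by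
    rintro ⟨j, z⟩
    by_cases hz : ∃ x : Fin (n + 1), z ∈ levelSet u n x
    · obtain ⟨x', hx'⟩ := hz
      simp only [hTmem' _ j z x' hx']
      rw [sum_blockFn hu]
      trans (∑ i, ∑ x, G i x j x') / levelDim u n x'
      swap
      · rw [hcol, div_self (hD x').ne']
      rw [Finset.sum_div]
      refine Finset.sum_congr rfl fun i _ => ?_
      rw [Finset.sum_div]
      refine Finset.sum_congr rfl fun x _ => ?_
      have h1 := (hD x).ne'
      have h2 := (hD x').ne'
      simp only [hH]
      field_simp
    · push Not at hz
      simp only [hTnot' _ j z hz]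
      rw [Finset.sum_ite_eq', if_pos (Finset.mem_univ _)]
  obtain ⟨r, hr, hr1, hrT⟩ := exists_mixture_of_doublyStochastic T hT0 hTrow hTcol
  refine ⟨r, hr, hr1, fun d => ?_⟩
  ext ⟨i, z⟩
  rw [hrT]
  by_cases hz : ∃ x : Fin (n + 1), z ∈ levelSet u n x
  · obtain ⟨x, hx⟩ := hz
    rw [blockFn_of_mem _ i hx]
    simp only [hTmem i z x hx]
    rw [Finset.sum_congr rfl fun t _ => blockFn_map₂ (fun a b : ℝ => a * b) (by simp) _ d t,
      sum_blockFn hu, Finset.sum_div]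
    refine Finset.sum_congr rfl fun j _ => ?_
    rw [Finset.sum_div]
    refine Finset.sum_congr rfl fun x' _ => ?_
    have h1 := (hD x).ne'
    have h2 := (hD x').ne'
    simp only [hH]
    field_simp
  · push Not at hz
    simp only [hTnot i z hz]
    rw [blockFn_of_notMem _ i hz]
    simp only [ite_mul, one_mul, zero_mul]
    rw [Finset.sum_ite_eq, if_pos (Finset.mem_univ _), blockFn_of_notMem _ i hz]

/-! ### Realising a conditional distribution on the multiples of the quid -/

theorem linearCombination_eq_sum_of_subset {P : ℤ →₀ ℝ} {K : Finset ℤ}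
    (h : ∀ k, P k ≠ 0 → k ∈ K) (g : ℤ → ℝ) :
    Finsupp.linearCombination ℝ g P = ∑ k ∈ K, P k * g k := by
  rw [Finsupp.linearCombination_apply]
  exact Finsupp.sum_of_support_subset P (fun k hk => h k (Finsupp.mem_support_iff.1 hk)) _ (by simp)

theorem blockInd_eq_blockFn {ι : Type*} [DecidableEq ι] {u n : ℕ} (j : ι) (x : Fin (n + 1)) :
    blockInd u n j x = blockFn fun i y => if i = j ∧ y = x then (1 : ℝ) else 0 := by
  ext s
  rw [blockFn, Finset.sum_eq_single x]
  · by_cases h1 : s.1 = j <;> by_cases h2 : s.2 ∈ levelSet u n x <;> simp [blockInd, h1, h2]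
  · intro y _ hy
    simp [hy]
  · simp

/-- Any conditional distribution on `δw ℤ` with range `f` that satisfies the three conditions is
exactly the conditional distribution of a protocol with a long uniform battery. The final joint ket
is `φ ⊗ λ`; the initial ket takes its moduli from the image of the final diagonal under the
completed weights, and its phases from `ψ`. -/
theorem exists_realisation {ι : Type*} [Fintype ι] [DecidableEq ι] {ψ φ : ι → ℂ} (hφ : IsKet φ)
    (hψ : IsKet ψ) (c : FreeClass) {u n : ℕ} (hu : 2 ≤ u) {wmax ε : ℝ}
    (hn : 4 * maxStep wmax u ≤ n)
    (hε : Real.sqrt (64 * (maxStep wmax u / ((n : ℝ) + 1 - 2 * maxStep wmax u))) ≤ ε)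
    (Q : ι → ι → ℤ →₀ ℝ) (hQ : ∀ i j k, 0 ≤ Q i j k)
    (hQf : ∀ i j k, Q i j k ≠ 0 → k ∈ Finset.Icc (-(maxStep wmax u : ℤ)) (maxStep wmax u))
    (hmass : ∀ j, ∑ i, Finsupp.linearCombination ℝ (fun _ => (1 : ℝ)) (Q i j) = 1)
    (hexp : ∀ i, ∑ j, Finsupp.linearCombination ℝ (fun k : ℤ => Real.exp (k * quid u)) (Q i j) = 1)
    (hmarg : ∀ i, ∑ j, diagCoeff φ j * Finsupp.linearCombination ℝ (fun _ => (1 : ℝ)) (Q i j) =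
      diagCoeff ψ i) :
    ∃ S : Protocol ι u n, S.Realises c wmax ε ψ φ ∧ ∀ i j (g : ℝ → ℝ),
      Finsupp.linearCombination ℝ g (S.cond i j) =
        Finsupp.linearCombination ℝ (fun k : ℤ => g (k * quid u)) (Q i j) := by
  set f := maxStep wmax u with hf
  set K := Finset.Icc (-(f : ℤ)) f with hK
  have hlc : ∀ i j (g : ℤ → ℝ), Finsupp.linearCombination ℝ g (Q i j) =
      ∑ k ∈ K, Q i j k * g k := fun i j g => linearCombination_eq_sum_of_subset (hQf i j) g
  have hQf' : ∀ i j k, k ∉ K → Q i j k = 0 := fun i j k hk => by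
    by_contra h
    exact hk (hQf i j k h)
  simp only [hlc, mul_one] at hmass hexp hmarg
  have hD := levelDim_pos hu n
  obtain ⟨G, hG, hGrow, hGcol, hGstep, hGbulk⟩ := exists_weights hu (show 2 * f ≤ n by omega)
    (fun i j k => Q i j k) hQ hQf' hmass hexp
  obtain ⟨r, hr, hr1, hrG⟩ := exists_mixture_of_weights hu G hG hGrow hGcol
  set α := boxBattery n f with hα
  have hα0 : ∀ x, 0 ≤ α x := boxBattery_nonneg (by omega)
  have hα1 : ∑ x, α x = 1 := sum_boxBattery (by omega)
  set val : ι → Fin (n + 1) → ℝ := fun i x =>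
    ∑ j, ∑ x' : Fin (n + 1), G i x j x' * (‖φ j‖ ^ 2 * α x' / levelDim u n x') with hval
  have hval0 : ∀ i x, 0 ≤ val i x := fun i x => Finset.sum_nonneg fun j _ =>
    Finset.sum_nonneg fun x' _ => mul_nonneg (hG _ _ _ _)
      (div_nonneg (mul_nonneg (sq_nonneg _) (hα0 x')) (hD _).le)
  -- the phases of `ψ`
  set ph : ι → ℂ := fun i => if ψ i = 0 then 1 else ψ i / (‖ψ i‖ : ℂ) with hph
  have hph1 : ∀ i, ‖ph i‖ = 1 := by
    intro i
    simp only [hph]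
    split_ifs with h
    · simp
    · rw [norm_div, Complex.norm_real, norm_norm, div_self (norm_ne_zero_iff.2 h)]
  have hphψ : ∀ i, ph i * (‖ψ i‖ : ℂ) = ψ i := by
    intro i
    simp only [hph]
    split_ifs with h
    · simp [h]
    · rw [div_mul_cancel₀]
      exact_mod_cast norm_ne_zero_iff.2 h
  set Ψ : ι → Fin (n + 1) → ℂ := fun i x => ph i * (Real.sqrt (val i x) : ℂ) with hΨ
  set Φ : ι → Fin (n + 1) → ℂ := fun i x => φ i * (Real.sqrt (α x) : ℂ) with hΦ
  have hΦt : tensorKet φ (batteryKet u n α) = jointKet u n Φ := tensorKet_batteryKet φ α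
  have hΨsq : ∀ i x, ‖Ψ i x‖ ^ 2 = val i x := by
    intro i x
    simp only [hΨ]
    rw [norm_mul, mul_pow, hph1, Complex.norm_real, Real.norm_eq_abs, sq_abs,
      Real.sq_sqrt (hval0 i x), one_pow, one_mul]
  have hmix : (fun s => ‖jointKet u n Ψ s‖ ^ 2) = mixFn r fun s => ‖jointKet u n Φ s‖ ^ 2 := by
    have h1 : (fun s => ‖jointKet u n Φ s‖ ^ 2) =
        blockFn fun j x' => ‖φ j‖ ^ 2 * α x' / levelDim u n x' := by
      rw [← hΦt]
      exact funext fun s => norm_sq_tensorKet_batteryKet hu φ hα0 s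
    rw [h1, hrG]
    ext s
    rw [norm_sq_jointKet hu]
    simp only [hΨsq, hval]
  have hΦk : IsKet (jointKet u n Φ) := by
    rw [IsKet, sum_norm_sq_jointKet hu]
    have h1 : ∀ i x, ‖Φ i x‖ ^ 2 = ‖φ i‖ ^ 2 * α x := by
      intro i x
      simp only [hΦ]
      rw [norm_mul, mul_pow, Complex.norm_real, Real.norm_eq_abs, sq_abs, Real.sq_sqrt (hα0 x)]
    simp only [h1, ← Finset.mul_sum, hα1, mul_one]
    exact hφ
  have hΨk : IsKet (jointKet u n Ψ) := by
    rw [IsKet]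
    have h1 : ∑ s, ‖jointKet u n Ψ s‖ ^ 2 =
        ∑ s, mixFn r (fun s => ‖jointKet u n Φ s‖ ^ 2) s :=
      Finset.sum_congr rfl fun s _ => congrFun hmix s
    rw [h1, sum_mixFn hr1]
    exact hΦk
  have htransfer : ∀ i (x : Fin (n + 1)) j (x' : Fin (n + 1)),
      transfer r i x j x' = G i x j x' := by
    intro i x j x'
    rw [transfer, blockInd_eq_blockFn, hrG, Finset.sum_congr rfl fun z hz =>
      blockFn_of_mem _ i (x := x) hz, Finset.sum_const, nsmul_eq_mul,
      card_levelSet hu (by omega), mul_div_cancel₀ _ (hD x).ne', Finset.sum_eq_single j,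
      Finset.sum_eq_single x']
    · simp
    · intro y _ hy
      simp [hy]
    · simp
    · intro k _ hk
      simp [hk]
    · simp
  have hbulk : ∀ i (y : Fin (n + 1)), 2 * f ≤ (y : ℕ) → (y : ℕ) + 2 * f ≤ n →
      Ψ i y = ψ i * (Real.sqrt (α y) : ℂ) := by
    intro i y h1 h2
    have hterm : ∀ j (x' : Fin (n + 1)), G i y j x' * (‖φ j‖ ^ 2 * α x' / levelDim u n x') =
        α y * ‖φ j‖ ^ 2 * Q i j (((x' : ℕ) : ℤ) - ((y : ℕ) : ℤ)) := by
      intro j x'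
      by_cases hx' : f ≤ (x' : ℕ) ∧ (x' : ℕ) + f ≤ n
      · have h3 : α x' = α y := by
          simp only [hα, boxBattery]
          rw [if_pos hx', if_pos ⟨by omega, by omega⟩]
        rw [hGbulk i y j x' hx'.1 hx'.2, h3]
        have := (hD x').ne'
        field_simp
      · have h3 : α x' = 0 := by
          simp only [hα, boxBattery]
          rw [if_neg hx']
        rw [h3, hQf' i j _ (by rw [hK, Finset.mem_Icc]; omega)]
        simp
    have hvaly : val i y = ‖ψ i‖ ^ 2 * α y := by
      simp only [hval, hterm, ← Finset.mul_sum]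
      have h3 : ∀ j, ∑ x' : Fin (n + 1), Q i j (((x' : ℕ) : ℤ) - ((y : ℕ) : ℤ)) =
          ∑ k ∈ K, Q i j k := by
        intro j
        rw [sum_levels n K (fun k => Q i j k) (hQf' i j)]
        refine Finset.sum_congr rfl fun k hk => ?_
        rw [hK, Finset.mem_Icc] at hk
        rw [if_pos ⟨by omega, by omega⟩]
      simp only [h3]
      rw [mul_comm, show ‖ψ i‖ ^ 2 = diagCoeff ψ i from rfl, ← hmarg i, Finset.mul_sum]
      refine Finset.sum_congr rfl fun j _ => ?_
      rw [diagCoeff]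
      ring
    simp only [hΨ]
    rw [hvaly, Real.sqrt_mul (sq_nonneg _), Real.sqrt_sq (norm_nonneg _)]
    push_cast
    rw [← mul_assoc, hphψ]
  refine ⟨⟨α, Ψ, Φ, r⟩, ⟨?_, hΨk, hΦk, ?_, ?_, ?_, hr, hr1, ?_, ?_, ?_⟩, ?_⟩
  · exact isIdealBattery_box hu hn hε
  · exact (traceNorm_sub_box_le hu hn ψ hψ Ψ hΨk hbulk).trans hε
  · exact (traceNorm_sub_box_le hu hn φ hφ Φ hΦk fun _ _ _ _ => rfl).trans hε
  · exact converts_of_mixture c _ _ r hr hr1 fun s => congrFun hmix s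
  · rw [dephase_density, dephase_density]
    change Matrix.diagonal (fun s => ((‖jointKet u n Ψ s‖ ^ 2 : ℝ) : ℂ)) =
      permMix r (Matrix.diagonal fun s => ((‖jointKet u n Φ s‖ ^ 2 : ℝ) : ℂ))
    rw [permMix_diagonal_ofReal r fun s => ‖jointKet u n Φ s‖ ^ 2, ← hmix]
  · rw [one_kronecker_batteryProj hu, Protocol.unital, permMix_diagonal_ofReal, hrG]
    simp only [mul_one, hGrow, div_self (hD _).ne']
  · intro i j x x' hx
    rw [Protocol.unital, trace_transfer hu _ _ _ (by omega) (by omega), htransfer,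
      hGstep i x j x' hx, Complex.ofReal_zero]
  · intro i j g
    rw [Protocol.linearCombination_cond hu _ hα0, hlc]
    simp only [htransfer]
    have hrow : ∀ x' : Fin (n + 1), ∑ x : Fin (n + 1), α x' / levelDim u n x' * G i x j x' *
        g ((((x' : ℕ) : ℝ) - ((x : ℕ) : ℝ)) * quid u) =
        α x' * ∑ k ∈ K, Q i j k * g (k * quid u) := by
      intro x'
      by_cases hx' : α x' = 0
      · simp [hx']
      · have h1 := boxBattery_ne_zero hx'
        have h2 := sum_levels_neg n K (fun k => Q i j k * g (k * quid u))
          (fun k hk => by rw [hQf' i j k hk, zero_mul]) ((x' : ℕ) : ℤ)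
        have h3 : ∑ k ∈ K, (if 0 ≤ ((x' : ℕ) : ℤ) - k ∧ ((x' : ℕ) : ℤ) - k ≤ n then
            Q i j k * g (k * quid u) else 0) = ∑ k ∈ K, Q i j k * g (k * quid u) := by
          refine Finset.sum_congr rfl fun k hk => ?_
          rw [hK, Finset.mem_Icc] at hk
          rw [if_pos ⟨by omega, by omega⟩]
        rw [← h3, ← h2, Finset.mul_sum]
        refine Finset.sum_congr rfl fun x _ => ?_
        rw [hGbulk i x j x' h1.1 h1.2]
        have := (hD x').ne'
        push_cast
        field_simp
    simp only [hrow]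
    rw [← Finset.sum_mul, hα1, one_mul]

/-! ### Sufficiency in the limit of ideal batteries -/

theorem exists_battery_length (f : ℕ) {ε : ℝ} (hε : 0 < ε) :
    ∃ n : ℕ, 4 * f ≤ n ∧ Real.sqrt (64 * (f / ((n : ℝ) + 1 - 2 * f))) ≤ ε := by
  obtain ⟨M, hM⟩ := exists_nat_ge (64 * f / ε ^ 2)
  refine ⟨4 * f + M, by omega, ?_⟩
  rw [div_le_iff₀ (by positivity)] at hM
  have hf : (0 : ℝ) ≤ f := Nat.cast_nonneg f
  have hM0 : (0 : ℝ) ≤ M := Nat.cast_nonneg M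
  rw [Real.sqrt_le_left hε.le, ← mul_div_assoc, div_le_iff₀ (by push_cast; linarith)]
  push_cast
  nlinarith [sq_nonneg ε, mul_nonneg (sq_nonneg ε) hf]

/-- Round the conditional distribution to `δw_N ℤ` and realise the result exactly. Rounding moves an
atom by at most `δw_N ≤ 1`, so that one more than a bound for the atoms of `P` serves as range.
Atoms of `P i j` that are not resolved only occur for `diagCoeff φ j = 0`, and do not contribute to the
extracted distribution. -/
theorem Conditions.implements {ι : Type*} [Fintype ι] [DecidableEq ι] {c : FreeClass}
    {ψ φ : ι → ℂ} (hψ : IsKet ψ) (hφ : IsKet φ) {u : ℕ → ℕ} (hu : ∀ N, 2 ≤ u N)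
    {P : ι → ι → ℝ →₀ ℝ} (hP : Conditions (diagCoeff ψ) (diagCoeff φ) P)
    (hres : ∀ w ∈ (coherenceMarginal P (diagCoeff φ)).support,
      Tendsto (fun N => w - (round (w / quid (u N)) : ℝ) * quid (u N)) atTop (𝓝 0)) :
    Implements c ψ φ u (coherenceMarginal P (diagCoeff φ)) := by
  set B : ℝ := ∑ i, ∑ j, ∑ w ∈ (P i j).support, |w| with hB
  have hB0 : 0 ≤ B := Finset.sum_nonneg fun i _ => Finset.sum_nonneg fun j _ =>
    Finset.sum_nonneg fun w _ => abs_nonneg w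
  have hPB : ∀ i j, ∀ w ∈ (P i j).support, |w| ≤ B := by
    intro i j w hw
    refine (Finset.single_le_sum (f := fun w : ℝ => |w|) (fun w _ => abs_nonneg w) hw).trans ?_
    refine (Finset.single_le_sum (f := fun j => ∑ w ∈ (P i j).support, |w|)
      (fun j _ => Finset.sum_nonneg fun w _ => abs_nonneg w) (Finset.mem_univ j)).trans ?_
    exact Finset.single_le_sum (f := fun i => ∑ j, ∑ w ∈ (P i j).support, |w|)
      (fun i _ => Finset.sum_nonneg fun j _ => Finset.sum_nonneg fun w _ => abs_nonneg w)
      (Finset.mem_univ i)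
  set f : ℕ → ℕ := fun N => maxStep (B + 1) (u N) with hf
  -- the fourth power absorbs the factor `f (f + 1)` of the error in `Implements`
  set ε : ℕ → ℝ := fun N => 1 / (((N : ℝ) + 1) * ((f N : ℝ) + 1) ^ 4) with hε
  have hεpos : ∀ N, 0 < ε N := fun N => by simp only [hε]; positivity
  choose n hn4 hnε using fun N => exists_battery_length (f N) (hεpos N)
  have hlog : Real.log 2 ≤ 1 := by
    have := Real.log_le_sub_one_of_pos (show (0 : ℝ) < 2 by norm_num)
    linarith
  have hδ : ∀ N, 0 < quid (u N) := fun N => quid_pos (hu N)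
  have hδ2 : ∀ N, quid (u N) ≤ Real.log 2 := fun N => quid_le_log_two (hu N)
  have hS : ∀ N, ∃ S : Protocol ι (u N) (n N), S.Realises c (B + 1) (ε N) ψ φ ∧
      ∀ i j (g : ℝ → ℝ), Finsupp.linearCombination ℝ g (S.cond i j) =
        Finsupp.linearCombination ℝ (fun k : ℤ => g (k * quid (u N)))
          (roundTo (quid (u N)) (P i j)) := by
    intro N
    refine exists_realisation hφ hψ c (hu N) (hn4 N) (hnε N)
      (fun i j => roundTo (quid (u N)) (P i j))
      (fun i j k => roundTo_nonneg (hδ N) (hP.nonneg i j) k)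
      (fun i j k hk => ?_) (fun j => ?_)
      (fun i => ?_) (fun i => ?_)
    · have h1 := abs_mul_le_of_roundTo_ne_zero (hδ N) (hPB i j) k hk
      have h2 : |(k : ℝ)| ≤ (B + 1) / quid (u N) := by
        rw [le_div_iff₀ (hδ N)]
        linarith [hδ2 N]
      have h3 : k.natAbs ≤ maxStep (B + 1) (u N) := by
        refine Nat.le_floor ?_
        rw [Nat.cast_natAbs, Int.cast_abs]
        exact h2
      rw [Finset.mem_Icc]
      omega
    · simp only [linearCombination_one_roundTo]
      rw [← totalMass_eq, hP.normalisation]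
    · simp only [linearCombination_exp_roundTo (hδ N)]
      rw [← expMass_eq, hP.exponential]
    · simp only [linearCombination_one_roundTo]
      rw [← rowMarginal_eq, hP.marginal]
  choose S hSr hSc using hS
  have hinv : Tendsto (fun N : ℕ => 1 / ((N : ℝ) + 1)) atTop (𝓝 0) :=
    tendsto_one_div_add_atTop_nhds_zero_nat
  refine ⟨B + 1, ε, n, S, by linarith, hSr, ?_, ?_, fun g hg => ?_⟩
  · refine squeeze_zero (fun N => (hεpos N).le) (fun N => ?_) hinv
    simp only [hε]
    refine one_div_le_one_div_of_le (by positivity) ?_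
    refine le_mul_of_one_le_right (by positivity) (one_le_pow₀ ?_)
    have : (0 : ℝ) ≤ f N := Nat.cast_nonneg _
    linarith
  · have hlim : Tendsto (fun N : ℕ => Real.sqrt (8 * (1 / ((N : ℝ) + 1)))) atTop (𝓝 0) := by
      have := (Real.continuous_sqrt.tendsto 0).comp
        (show Tendsto (fun N : ℕ => 8 * (1 / ((N : ℝ) + 1))) atTop (𝓝 0) by
          simpa using hinv.const_mul 8)
      rw [Real.sqrt_zero] at this
      exact this
    refine squeeze_zero (fun N => by positivity) (fun N => ?_) hlim
    change Real.sqrt (8 * ε N) * ((f N : ℝ) * ((f N : ℝ) + 1)) ≤ _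
    have hfN : (0 : ℝ) ≤ f N := Nat.cast_nonneg _
    refine Real.le_sqrt_of_sq_le ?_
    rw [mul_pow, Real.sq_sqrt (by have := hεpos N; positivity)]
    have h1 : ((f N : ℝ) * ((f N : ℝ) + 1)) ^ 2 ≤ ((f N : ℝ) + 1) ^ 4 := by
      have : ((f N : ℝ) * ((f N : ℝ) + 1)) ≤ ((f N : ℝ) + 1) ^ 2 := by nlinarith
      calc _ ≤ (((f N : ℝ) + 1) ^ 2) ^ 2 := by gcongr
        _ = _ := by ring
    calc _ ≤ 8 * ε N * ((f N : ℝ) + 1) ^ 4 :=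
          mul_le_mul_of_nonneg_left h1 (by have := hεpos N; positivity)
      _ = _ := by
          simp only [hε]
          have : (f N : ℝ) + 1 ≠ 0 := by linarith
          have : (N : ℝ) + 1 ≠ 0 := by positivity
          field_simp
  · simp only [sum_mul_eq_linearCombination]
    have h1 : ∀ N, Finsupp.linearCombination ℝ g (coherenceMarginal (S N).cond (diagCoeff φ)) =
        Finsupp.linearCombination ℝ (fun w => Finsupp.linearCombination ℝ
          (fun k : ℤ => g (k * quid (u N))) (split (quid (u N)) w))
          (coherenceMarginal P (diagCoeff φ)) := by
      intro N
      simp only [linearCombination_coherenceMarginal, hSc, linearCombination_roundTo]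
    simp only [h1]
    simp only [linearCombination_eq_sum _ (coherenceMarginal P (diagCoeff φ))]
    exact tendsto_finsetSum _ fun w hw => (tendsto_split hδ hδ2 (hres w hw) hg).const_mul _

end CoherenceBattery

end

theorem mainTheorem1 {ι : Type*} [Fintype ι] [DecidableEq ι]
    (ψ φ : ι → ℂ) (hψ : CoherenceBattery.IsKet ψ) (hφ : CoherenceBattery.IsKet φ)
    (c : CoherenceBattery.FreeClass) :
    -- necessity for a single battery, with explicit errors
    (∀ (u n : ℕ) (wmax ε : ℝ) (S : CoherenceBattery.Protocol ι u n), 2 ≤ u → 0 < wmax →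
      S.Realises c wmax ε ψ φ →
        (∀ i j w, 0 ≤ S.cond i j w) ∧
        (∀ j, CoherenceBattery.totalMass S.cond j = 1) ∧
        (∀ i, |CoherenceBattery.expMass S.cond i - 1| ≤
          Real.sqrt (8 * ε) * ((CoherenceBattery.maxStep wmax u : ℝ) *
            ((CoherenceBattery.maxStep wmax u : ℝ) + 1))) ∧
        ∑ i, |CoherenceBattery.rowMarginal S.cond (CoherenceBattery.diagCoeff φ) i -
          CoherenceBattery.diagCoeff ψ i| ≤ 2 * ε) ∧
    -- equivalence in the limit of ideal batteries
    (∀ (u : ℕ → ℕ) (Pw : ℝ →₀ ℝ), (∀ N, 2 ≤ u N) →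
      (∀ w, 0 ≤ Pw w) → (Pw.sum fun _ a => a) = 1 →
      (∀ w ∈ Pw.support, Filter.Tendsto
        (fun N => w - (round (w / CoherenceBattery.quid (u N)) : ℝ) * CoherenceBattery.quid (u N))
        Filter.atTop (nhds 0)) →
      (CoherenceBattery.Implements c ψ φ u Pw ↔
        ∃ P : ι → ι → ℝ →₀ ℝ,
          CoherenceBattery.Conditions (CoherenceBattery.diagCoeff ψ)
            (CoherenceBattery.diagCoeff φ) P ∧
          CoherenceBattery.coherenceMarginal P (CoherenceBattery.diagCoeff φ) = Pw)) := by
  refine ⟨fun u n wmax ε S hu _ h => ⟨h.cond_nonneg hu, h.totalMass_cond hu,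
    h.abs_expMass_sub_one_le hu, h.sum_abs_rowMarginal_sub_le hu⟩,
    fun u Pw hu _ _ hres => ⟨fun h => h.exists_conditions hu, ?_⟩⟩
  rintro ⟨P, hP, rfl⟩
  exact hP.implements hψ hφ hu hres
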